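/- **Conventions.** Let $X,Y$ be integral Noetherian schemes over a scheme $S$ and $\pi:X\to Y$ a dominant $S$-morphism, locally of finite type and generically smooth (smooth near the generic point $\xi$ of $X$). Put $T_{X/S}=\mathcal Hom(\Omega_{X/S},\mathcal O_X)$ and $T_{X/S\to Y/S}=\mathcal Hom(\pi^*\Omega_{Y/S},\mathcal O_X)$ (derivations from $\mathcal O_Y$ to $\mathcal O_X$ over $S$), let $d\pi:T_{X/S}\to T_{X/S\to Y/S}$ be the tangent morphism, $\overline T_{X/S}=\operatorname{Im} d\pi$ and $\mathcal C_{X/Y}=\operatorname{Coker} d\pi$; let $\Gamma_{X/Y/S}$ and $\mathcal V_{X/Y/S}$ be the kernel and the image of $\pi^*\Omega_{Y/S}\to\Omega_{X/S}$. Let $C_\pi=\operatorname{supp}\mathcal C_{X/Y}$, let $B_\pi$ be the set of $x$ where $\Omega_{X/Y,x}$ is not free, and for $i\ge 0$ let $B^{(i)}_\pi$ and $C^{(i)}_\pi$ be the closed sets defined by the Fitting ideals $F_{d_{X/Y}+i}(\Omega_{X/Y})$ and $F_i(\mathcal C_{X/Y})$. Here $d_{X/Y}=\dim_{k(\xi)}\Omega_{X/Y,\xi}$,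 and $d_{X/S}$, $d_{Y/S}$ are defined likewise at the generic points of $X$ and $Y$; $\operatorname{rank}$ is the generic rank. Let $\operatorname{ht}(x)=\dim\mathcal O_{X,x}$; the maximal points of $T\subset X$ are the points of $T$ having no other generization in $T$; $\operatorname{codim}^+_XT$ is the supremum of the heights of the maximal points of $T$, and $-1$ if $T=\emptyset$. For a coherent $M$ let $\beta_i(M_x)=\dim_{k_x}\operatorname{Tor}_i^{\mathcal O_{X,x}}(k_x,M_x)$ and $\beta_i(M)=\sup_x\beta_i(M_x)$. Let $\chi_2(M_x)$ be the generic rank of the second syzygy in a minimal free resolution of $M_x$, i.e. $\chi_2(M_x)=\sum_{j\ge2}(-1)^j\beta_j(M_x)$ when $\operatorname{pd}M_x<\infty$, and $\chi_2(M_x)=\beta_1(M_x)-\beta_0(M_x)+\operatorname{rank}M$ otherwise; $\chi_2(M)=\sup_x\chi_2(M_x)$. Put $\delta_{Y/S,y}=\beta_0(\Omega_{Y/S,y})-d_{Y/S}$, $\delta_{Y/S}=\sup_y\delta_{Y/S,y}$, $\eta_{X/S,x}=\beta_0(T_{X/S,x})-d_{X/S}$, $\eta_{X/S}=\sup_x\eta_{X/S,x}$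 and $\eta_{X/Y,x}=\beta_0(T_{X/Y,x})-d_{X/Y}$. A coherent module $M$ satisfies $(S_2)$ if $\operatorname{depth}M_x\ge\min(2,\dim M_x)$ for all $x$. The morphism $\pi$ is d.c.i. if $\operatorname{pd}\Omega_{X/Y,x}\le 1$ for all $x$. **Theorem.** 1. $C_\pi\subset B_\pi$, and if $\Omega_{X/S}$ is locally projective, then canonically $\mathcal C_{X/Y}\cong\mathcal Ext^1_{\mathcal O_X}(\Omega_{X/Y},\mathcal O_X)$. 2. Assume that $X/S$ and $Y/S$ are locally of finite type, and let $i\ge0$. All suprema below are finite. (a) $\operatorname{codim}^+_XB^{(i)}_\pi\le(d_{X/Y}+i+1)(i+1+\chi_2(\Omega_{X/Y}))$, and $$\begin{aligned}\operatorname{codim}^+_XB^{(i)}_\pi&\le(d_{X/Y}+i+1)\big(d_{X/Y}-\operatorname{rank}\Omega_{X/S}+i+1+\beta_0(\mathcal V_{X/Y/S})+\beta_1(\Omega_{X/S})\big)\\&\le(d_{X/Y}+i+1)\big(i+1+\beta_0(\mathcal V_{X/Y/S})+\beta_1(\Omega_{X/S})-d_{Y/S}\big),\end{aligned}$$ the last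 inequality being an equality if $X/S$ is generically smooth. Moreover, for each maximal point $x$ of $B^{(i)}_\pi$, $$\begin{aligned}\operatorname{ht}(x)&\le(d_{X/Y}+i+1)\big(d_{X/Y}-\operatorname{rank}\Omega_{X/S}+i+1+\beta_0(\mathcal V_{X/Y/S,x})+\beta_1(\Omega_{X/S,x})\big)\\&\le(d_{X/Y}+i+1)\big(i+1+\beta_0(\mathcal V_{X/Y/S,x})+\beta_1(\Omega_{X/S,x})-d_{Y/S}\big)\\&\le(d_{X/Y}+i+1)\big(\delta_{Y/S,\pi(x)}-\beta_0(\Gamma_{X/Y/S,x})+\beta_1(\mathcal V_{X/Y/S,x})+\beta_1(\Omega_{X/S,x})+i+1\big)\\&\le(d_{X/Y}+i+1)\big(\delta_{Y/S}-\beta_0(\Gamma_{X/Y/S,x})+\beta_1(\mathcal V_{X/Y/S,x})+\beta_1(\Omega_{X/S,x})+i+1\big),\end{aligned}$$ where all the inequalities but the first hold at every point $x$ of $X$. (b) $\operatorname{codim}^+_XC^{(i)}_\pi\le(d_{X/Y}+i+1)(i+1+\chi_2(\mathcal C_{X/Y}))$, and $$\begin{aligned}\operatorname{codim}^+_XC^{(i)}_\pi&\le(i+1)\big(\beta_0(\overline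 T_{X/S})+\beta_1(T_{X/S\to Y/S})-\operatorname{rank}T_{X/S\to Y/S}+i+1\big)\\&\le(i+1)\big(\beta_0(\overline T_{X/S})+\beta_1(T_{X/S\to Y/S})-d_{Y/S}+i+1\big),\end{aligned}$$ the last inequality being an equality if $Y/S$ is generically smooth. Moreover, for each maximal point $x$ of $C^{(i)}_\pi$, $$\begin{aligned}\operatorname{ht}(x)&\le(i+1)\big(\beta_0(\overline T_{X/S,x})+\beta_1(T_{X/S\to Y/S,x})-\operatorname{rank}T_{X/S\to Y/S}+i+1\big)\\&\le(i+1)\big(\beta_0(\overline T_{X/S,x})+\beta_1(T_{X/S\to Y/S,x})-d_{Y/S}+i+1\big)\\&\le(i+1)\big(\eta_{X/S,x}-\eta_{X/Y,x}+\beta_1(\overline T_{X/S,x})+\beta_1(T_{X/S\to Y/S,x})+i+1\big)\\&\le(i+1)\big(\eta_{X/S}-\eta_{X/Y,x}+\beta_1(\overline T_{X/S,x})+\beta_1(T_{X/S\to Y/S,x})+i+1\big),\end{aligned}$$ where all the inequalities but the first hold at every point $x$ of $X$. 3. Assume that $\Omega_{X/S}$ is coherent (then so is $\mathcal C_{X/Y}$).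 If $\overline T_{X/S}$ satisfies $(S_2)$, then $\operatorname{codim}^+_XC_\pi\le1$. If $\mathcal O_{X,x}$ is regular and $\Omega_{X/S,x}$ is free whenever $\operatorname{ht}(x)\le1$, then the maximal points of height $1$ of $C_\pi$ and of $B_\pi$ coincide. 4. If $X/S$ and $Y/S$ are smooth and $\overline T_{X/S}$ satisfies $(S_2)$, then $\operatorname{codim}^+_XB_\pi\le1$. 5. If $\pi$ is d.c.i., then $\operatorname{codim}^+_XB^{(i)}_\pi\le(d_{X/Y}+i+1)(i+1)$ for all $i\ge0$. -/

import Mathlib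

open CategoryTheory AlgebraicGeometry

universe u

namespace PurityLoci

noncomputable section

/-! ### Commutative algebra over a local ring -/

section LocalAlgebra

variable {R : Type u} [CommRing R] [IsLocalRing R]

/-- The `i`-th Betti number `dim_k Tor_i(k, M)`, `k` the residue field. The module `Tor_i(k, M)` is
killed by the maximal ideal, so its dimension over `k` is its length over `R`. -/
def betti (M : ModuleCat.{u} R) (i : ℕ) : ℕ :=
  (Module.length R
    (((Tor (ModuleCat.{u} R) i).obj (ModuleCat.of R (IsLocalRing.ResidueField R))).obj M)).toNat

/-- The generic rank of a module over a domain, i.e. the maximal number of linearly independent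
elements, which is the dimension of `K ⊗ M` over the fraction field `K`. -/
def genRank (M : ModuleCat.{u} R) : ℕ := Module.finrank R M

open Classical in
/-- The partial Euler number `χ₂(M) = ∑_{j ≥ 2} (-1)^j β_j(M)` if `M` has finite projective
dimension. In general it is the generic rank of the second syzygy `Z` in a minimal free resolution,
computed from `0 → Z → R^{β₁} → R^{β₀} → M → 0`. -/
def chiTwo (M : ModuleCat.{u} R) : ℤ :=
  if projectiveDimension M ≠ ⊤ then
    ∑ᶠ j : ℕ, if 2 ≤ j then (-1 : ℤ) ^ j * (betti M j : ℤ) else 0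
  else (betti M 1 : ℤ) - (betti M 0 : ℤ) + (genRank M : ℤ)

/-- Serre's condition on the depth at the closed point:
`depth M ≥ min (k, dim M)`. -/
def SerreAt (k : ℕ) (M : ModuleCat.{u} R) : Prop :=
  ∀ n : ℕ, n ≤ k → (n : WithBot ℕ∞) ≤ Module.supportDim R M →
    ∃ rs : List R, rs.length = n ∧ (∀ r ∈ rs, r ∈ IsLocalRing.maximalIdeal R) ∧
      RingTheory.Sequence.IsRegular M rs

end LocalAlgebra

/-- The `i`-th Fitting ideal of a finitely generated module: it is generated by the minors of size
`n - i` of the matrices of relations between `n` generators. Here `n = k + i`, the family `v`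
generates `M`, the rows of `r` are `k` relations, and `e` selects `k` columns. (Generating families
with fewer than `i` members are padded by zeros and give `k = 0`, i.e. the unit ideal.) -/
def fittingIdeal (R : Type u) [CommRing R] (M : ModuleCat.{u} R) (i : ℕ) : Ideal R :=
  Ideal.span {a : R | ∃ (k : ℕ) (v : Fin (k + i) → M) (e : Fin k → Fin (k + i))
    (r : Fin k → Fin (k + i) → R),
    Submodule.span R (Set.range v) = ⊤ ∧ (∀ s, ∑ j, r s j • v j = 0) ∧
    a = Matrix.det (Matrix.of fun s t => r s (e t))}

variable {X Y S : Scheme.{u}}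

/-! ### Affine charts and the sheaf-theoretic definition of the critical locus -/

/-- A triple of affine opens `U`, `V`, `W` of `X`, `Y`, `S` with `π(U) ⊆ V` and `f(V) ⊆ W`. -/
structure Chart (π : X ⟶ Y) (f : Y ⟶ S) where
  U : X.Opens
  V : Y.Opens
  W : S.Opens
  affineU : IsAffineOpen U
  affineV : IsAffineOpen V
  affineW : IsAffineOpen W
  leUV : U ≤ π ⁻¹ᵁ V
  leVW : V ≤ f ⁻¹ᵁ W

namespace Chart

variable {π : X ⟶ Y} {f : Y ⟶ S} (c : Chart π f)

/-- The coordinate ring of the open subset of `X`. -/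
abbrev B : Type u := Γ(X, c.U)

/-- The coordinate ring of the open subset of `Y`. -/
abbrev A : Type u := Γ(Y, c.V)

/-- The coordinate ring of the open subset of `S`. -/
abbrev R : Type u := Γ(S, c.W)

instance algAB : Algebra c.A c.B := (π.appLE c.V c.U c.leUV).hom.toAlgebra

instance algRA : Algebra c.R c.A := (f.appLE c.W c.V c.leVW).hom.toAlgebra

instance algRB : Algebra c.R c.B := ((algebraMap c.A c.B).comp (algebraMap c.R c.A)).toAlgebra

instance towerRAB : IsScalarTower c.R c.A c.B := IsScalarTower.of_algebraMap_eq fun _ => rfl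

/-- The chart obtained by shrinking the open subset of `X`. -/
def shrink (U' : X.Opens) (hU' : IsAffineOpen U') (h : U' ≤ c.U) : Chart π f where
  U := U'
  V := c.V
  W := c.W
  affineU := hU'
  affineV := c.affineV
  affineW := c.affineW
  leUV := h.trans c.leUV
  leVW := c.leVW

/-- The tangent morphism on sections over the chart, from `T_{X/S}(U) = Der_R(B, B)` to
`T_{X/S → Y/S}(U) = Der_R(A, B)`. -/
def dpi : Derivation c.R c.B c.B →ₗ[c.B] Derivation c.R c.A c.B :=
  Derivation.compAlgebraMapL c.R c.A c.B c.B

/-- Over the chart, `T_{X/S → Y/S}(U) / dπ(T_{X/S}(U))` is canonically isomorphic to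
`Ext¹_B(Ω_{B/A}, B)`: the class of a derivation `D : A → B` is sent to the class of the extension
`0 → B → E → Ω_{B/A} → 0` obtained from `Ω_{B/R} → Ω_{B/A}` by pushing out along `D`, i.e. of an
extension `E` with a `B`-linear map `ψ : Ω_{B/R} → E` over `Ω_{B/A}` that restricts to `D`. -/
def CriticalIsoExt : Prop :=
  ∃ e : (Derivation c.R c.A c.B ⧸ LinearMap.range c.dpi) ≃ₗ[c.B]
      Abelian.Ext (ModuleCat.of c.B (Ω[c.B⁄c.A])) (ModuleCat.of c.B c.B) 1,
    ∀ D : Derivation c.R c.A c.B,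
      ∃ (E : ModuleCat.{u} c.B) (ι : ModuleCat.of c.B c.B ⟶ E)
        (q : E ⟶ ModuleCat.of c.B (Ω[c.B⁄c.A])) (w : ι ≫ q = 0)
        (hE : (ShortComplex.mk ι q w).ShortExact) (ψ : Ω[c.B⁄c.R] →ₗ[c.B] E),
        (∀ b : c.B, q.hom (ψ (KaehlerDifferential.D c.R c.B b)) = KaehlerDifferential.D c.A c.B b) ∧
        (∀ a : c.A, ψ (KaehlerDifferential.D c.R c.B (algebraMap c.A c.B a)) = ι.hom (D a)) ∧
        e (Submodule.Quotient.mk D) = hE.extClass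

end Chart

/-- `π` is submersive at `x`: the stalk at `x` of the critical module, the cokernel of the morphism
of sheaves `dπ : T_{X/S} → T_{X/S → Y/S}`, is zero. That is, every germ at `x` of a derivation from
`𝒪_Y` to `𝒪_X` over `S` lifts to a germ of a derivation of `𝒪_X` over `S`. -/
def IsSubmersiveAt (π : X ⟶ Y) (f : Y ⟶ S) (x : X) : Prop :=
  ∀ c : Chart π f, x ∈ c.U → ∀ D : Derivation c.R c.A c.B,
    ∃ (U' : X.Opens) (hU' : IsAffineOpen U') (h : U' ≤ c.U), x ∈ U' ∧
      ∃ E : Derivation (c.shrink U' hU' h).R (c.shrink U' hU' h).B (c.shrink U' hU' h).B,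
        ∀ a : c.A, E (algebraMap (c.shrink U' hU' h).A (c.shrink U' hU' h).B a) =
          X.presheaf.map (homOfLE h).op (D a)

/-- The critical locus `C_π`: the support of the critical module. -/
def criticalLocus (π : X ⟶ Y) (f : Y ⟶ S) : Set X := {x | ¬ IsSubmersiveAt π f x}

/-- `Ω_{X/S}` is locally projective. -/
def LocallyProjectiveDifferentials (π : X ⟶ Y) (f : Y ⟶ S) : Prop :=
  ∀ x : X, ∃ c : Chart π f, x ∈ c.U ∧ Module.Projective c.B (Ω[c.B⁄c.R])

/-- `Ω_{X/S}` is coherent (on a locally Noetherian scheme). -/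
def CoherentDifferentials (π : X ⟶ Y) (f : Y ⟶ S) : Prop :=
  ∀ c : Chart π f, Module.Finite c.B (Ω[c.B⁄c.R])

/-- The critical module `C_{X/Y}` and the sheaf `Ext¹(Ω_{X/Y}, 𝒪_X)` are canonically isomorphic:
their sections over all sufficiently small affine charts are. -/
def CriticalModuleIsoExt (π : X ⟶ Y) (f : Y ⟶ S) : Prop :=
  ∀ x : X, ∃ O : X.Opens, x ∈ O ∧ ∀ c : Chart π f, c.U ≤ O → c.CriticalIsoExt

/-! ### Stalks -/

section Stalks

/-- The local ring of a scheme at a point. -/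
abbrev Loc (X : Scheme.{u}) (x : X) : Type u := X.presheaf.stalk x

/-- The algebra structure on `𝒪_{X,x}` over `𝒪_{Y,π(x)}`. -/
abbrev stalkAlg (π : X ⟶ Y) (x : X) : Algebra (Loc Y (π x)) (Loc X x) :=
  (π.stalkMap x).hom.toAlgebra

/-- The algebra structure on `𝒪_{X,x}` over `𝒪_{S,f(π(x))}`. -/
abbrev stalkAlgOver (π : X ⟶ Y) (f : Y ⟶ S) (x : X) : Algebra (Loc S (f (π x))) (Loc X x) :=
  ((π.stalkMap x).hom.comp (f.stalkMap (π x)).hom).toAlgebra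

attribute [local instance] stalkAlg stalkAlgOver

/-- `𝒪_{S,f(π(x))} → 𝒪_{Y,π(x)} → 𝒪_{X,x}` is a tower of algebras. -/
theorem stalkTower (π : X ⟶ Y) (f : Y ⟶ S) (x : X) :
    IsScalarTower (Loc S (f (π x))) (Loc Y (π x)) (Loc X x) :=
  IsScalarTower.of_algebraMap_eq fun _ => rfl

attribute [local instance] stalkTower

/-- The stalk `Ω_{X/Y,x}`. -/
def Omega (π : X ⟶ Y) (x : X) : ModuleCat.{u} (Loc X x) :=
  ModuleCat.of _ (Ω[Loc X x⁄Loc Y (π x)])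

/-- The stalk `Ω_{X/S,x}`. -/
def OmegaOver (π : X ⟶ Y) (f : Y ⟶ S) (x : X) : ModuleCat.{u} (Loc X x) :=
  ModuleCat.of _ (Ω[Loc X x⁄Loc S (f (π x))])

/-- The stalk at `x` of the canonical map `π^*(Ω_{Y/S}) → Ω_{X/S}`. -/
def canMap (π : X ⟶ Y) (f : Y ⟶ S) (x : X) :
    TensorProduct (Loc Y (π x)) (Loc X x) (Ω[Loc Y (π x)⁄Loc S (f (π x))]) →ₗ[Loc X x]
      Ω[Loc X x⁄Loc S (f (π x))] :=
  KaehlerDifferential.mapBaseChange (Loc S (f (π x))) (Loc Y (π x)) (Loc X x)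

/-- The stalk of the imperfection module `Γ_{X/Y/S} = Ker (π^*(Ω_{Y/S}) → Ω_{X/S})`. -/
def Imperfection (π : X ⟶ Y) (f : Y ⟶ S) (x : X) : ModuleCat.{u} (Loc X x) :=
  ModuleCat.of _ (LinearMap.ker (canMap π f x))

/-- The stalk of `V_{X/Y/S} = Im (π^*(Ω_{Y/S}) → Ω_{X/S})`. -/
def ImageOmega (π : X ⟶ Y) (f : Y ⟶ S) (x : X) : ModuleCat.{u} (Loc X x) :=
  ModuleCat.of _ (LinearMap.range (canMap π f x))

/-- The stalk of `T_{X/Y}` (for `Ω_{X/Y}` coherent). -/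
def Tangent (π : X ⟶ Y) (x : X) : ModuleCat.{u} (Loc X x) :=
  ModuleCat.of _ (Derivation (Loc Y (π x)) (Loc X x) (Loc X x))

/-- The stalk of `T_{X/S}` (for `Ω_{X/S}` coherent). -/
def TangentOver (π : X ⟶ Y) (f : Y ⟶ S) (x : X) : ModuleCat.{u} (Loc X x) :=
  ModuleCat.of _ (Derivation (Loc S (f (π x))) (Loc X x) (Loc X x))

/-- The stalk of `T_{X/S → Y/S}`, the derivations from `𝒪_Y` to `𝒪_X` over `S`
(for `π^*(Ω_{Y/S})` coherent). -/
def TangentAlong (π : X ⟶ Y) (f : Y ⟶ S) (x : X) : ModuleCat.{u} (Loc X x) :=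
  ModuleCat.of _ (Derivation (Loc S (f (π x))) (Loc Y (π x)) (Loc X x))

/-- The stalk of the tangent morphism `dπ : T_{X/S} → T_{X/S → Y/S}`. -/
def tangentMap (π : X ⟶ Y) (f : Y ⟶ S) (x : X) :
    Derivation (Loc S (f (π x))) (Loc X x) (Loc X x) →ₗ[Loc X x]
      Derivation (Loc S (f (π x))) (Loc Y (π x)) (Loc X x) :=
  Derivation.compAlgebraMapL (Loc S (f (π x))) (Loc Y (π x)) (Loc X x) (Loc X x)

/-- The stalk of the image of the tangent morphism. -/
def TangentImage (π : X ⟶ Y) (f : Y ⟶ S) (x : X) : ModuleCat.{u} (Loc X x) :=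
  ModuleCat.of _ (LinearMap.range (tangentMap π f x))

/-- The stalk of the critical module (for `Ω_{X/S}` and `π^*(Ω_{Y/S})` coherent). -/
def Critical (π : X ⟶ Y) (f : Y ⟶ S) (x : X) : ModuleCat.{u} (Loc X x) :=
  ModuleCat.of _ (Derivation (Loc S (f (π x))) (Loc Y (π x)) (Loc X x) ⧸
    LinearMap.range (tangentMap π f x))

end Stalks

/-! ### Numerical invariants -/

/-- The relative dimension `d_{X/Y}` of an integral scheme `X`: the dimension over the function
field of the stalk of `Ω_{X/Y}` at the generic point. -/
def relDim [IsIntegral X] (π : X ⟶ Y) : ℕ := genRank (Omega π (genericPoint X))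

/-- The relative dimension `d_{X/S}`, which is the generic rank of `Ω_{X/S}`. -/
def relDimOver [IsIntegral X] (π : X ⟶ Y) (f : Y ⟶ S) : ℕ :=
  genRank (OmegaOver π f (genericPoint X))

/-- The smoothness defect of `Y/S` at `y`. -/
def smoothDefectAt [IsIntegral Y] (f : Y ⟶ S) (y : Y) : ℤ :=
  (betti (Omega f y) 0 : ℤ) - (relDim f : ℤ)

/-- The smoothness defect `δ_{Y/S} = sup_y β₀(Ω_{Y/S,y}) - d_{Y/S}`. -/
def smoothDefect [IsIntegral Y] (f : Y ⟶ S) : ℤ :=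
  ((⨆ y : Y, betti (Omega f y) 0 : ℕ) : ℤ) - (relDim f : ℤ)

/-- The defect of tangent space dimension of `X/Y` at `x`. -/
def tangentDefectAt [IsIntegral X] (π : X ⟶ Y) (x : X) : ℤ :=
  (betti (Tangent π x) 0 : ℤ) - (relDim π : ℤ)

/-- The defect of tangent space dimension of `X/S` at `x`. -/
def tangentDefectOverAt [IsIntegral X] (π : X ⟶ Y) (f : Y ⟶ S) (x : X) : ℤ :=
  (betti (TangentOver π f x) 0 : ℤ) - (relDimOver π f : ℤ)

/-- The defect of tangent space dimension `η_{X/S} = sup_x β₀(T_{X/S,x}) - d_{X/S}`. -/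
def tangentDefectOver [IsIntegral X] (π : X ⟶ Y) (f : Y ⟶ S) : ℤ :=
  ((⨆ x : X, betti (TangentOver π f x) 0 : ℕ) : ℤ) - (relDimOver π f : ℤ)

/-! ### Loci and codimension -/

/-- The branch locus `B_π`: the points where the stalk of `Ω_{X/Y}` is not free. -/
def branchLocus (π : X ⟶ Y) : Set X := {x | ¬ Module.Free (Loc X x) (Omega π x)}

/-- The higher branch locus `B_π^{(i)}`, defined by the Fitting ideal `F_{d_{X/Y}+i}(Ω_{X/Y})`. -/
def branchLocusHigher [IsIntegral X] (π : X ⟶ Y) (i : ℕ) : Set X :=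
  {x | fittingIdeal (Loc X x) (Omega π x) (relDim π + i) ≠ ⊤}

/-- The higher critical locus `C_π^{(i)}`, defined by the Fitting ideal `F_i(C_{X/Y})`. -/
def criticalLocusHigher (π : X ⟶ Y) (f : Y ⟶ S) (i : ℕ) : Set X :=
  {x | fittingIdeal (Loc X x) (Critical π f x) i ≠ ⊤}

/-- The height of a point: the Krull dimension of its local ring. -/
def height (x : X) : ℕ∞ := (ringKrullDim (Loc X x)).unbotD 0

/-- The height of a point as an extended real number. -/
def heightE (x : X) : EReal := ((height x : ENNReal) : EReal)

/-- The maximal points of a subset `T`: the points of `T` with no other generization in `T`. -/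
def maxPoints (T : Set X) : Set X := {x | x ∈ T ∧ ∀ y ∈ T, y ⤳ x → y = x}

/-- The upper codimension of `T`: the supremum of the heights of the maximal points of `T`,
and `-1` if `T` is empty. -/
def codimPlus (T : Set X) : EReal := max (-1) (⨆ x ∈ maxPoints T, heightE x)

/-! ### Conditions on morphisms -/

/-- `π` is smooth on a neighbourhood of the generic point of `X`. -/
def GenericallySmooth [IsIntegral X] (π : X ⟶ Y) : Prop :=
  ∃ U : X.Opens, genericPoint X ∈ U ∧ Smooth (U.ι ≫ π)

/-- `π` is a differential complete intersection: `Ω_{X/Y,x}` has projective dimension at most one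
for all `x`. -/
def IsDCI (π : X ⟶ Y) : Prop := ∀ x : X, HasProjectiveDimensionLE (Omega π x) 1

/-- An integer as an extended real number. -/
abbrev toE (n : ℤ) : EReal := ((n : ℝ) : EReal)

end

end PurityLoci

open PurityLoci

set_option linter.unusedSectionVars false

namespace PurityLoci

noncomputable section

/-! ### Determinantal ideals: the height bound of Eagon and Northcott -/

section Minors

/-! The theorem rests on a height bound for degeneracy loci and on the description of derivations
along π as the dual of 𝒱 = Im(π^*Ω_{Y/S} → Ω_{X/S}).

Height bound. Let M be coherent of generic rank r. Its Fitting locus of index r + i is the set of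
points with β₀(M_x) > r + i (`fittingIdeal_ne_top_iff`). At a maximal point x of this locus a
minimal presentation of M_x is a matrix of size β₀ × β₁; its minors of size β₀ - r - i all vanish at
the closed point, but not all of them vanish at any other prime of the local ring. The
Eagon–Northcott bound (`height_le_of_minimal_minors`) gives ht(x) ≤ (r + i + 1)(β₁ - β₀ + r + i +
1), which is (r + i + 1)(i + 1 + χ₂(M_x)) by `chiTwo_eq`. This is applied to Ω_{X/Y} with r =
d_{X/Y}, and to the critical module with r = 0. The other bounds estimate χ₂ by Tor along 0 → 𝒱 →
Ω_{X/S} → Ω_{X/Y} → 0 and the analogous tangent sequences (`betti_one_add_minGens_le`,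
`minGens_add_minGens_le`). Suprema are finite by quasi-compactness.

Duality. Generic smoothness makes π^*Ω_{Y/S} → Ω_{X/S} injective at the generic point, so every
derivation from 𝒪_Y to 𝒪_X kills its kernel (`derivationsKillKernel_of_formallySmooth`). Hence
T_{X/S→Y/S} is the dual of 𝒱, and dπ is the restriction of linear forms from Ω_{X/S} to 𝒱. All of
this is coherent and localizes well once Ω_{X/S} is coherent. Where Ω_{X/Y} is free, the sequence
splits and forms extend, so C_π ⊆ B_π. Where Ω_{X/S} is projective, the Ext sequence identifies the
cokernel with Ext¹(Ω_{X/Y}, 𝒪_X). Conversely, where 𝒱 and Ω_{X/S} are free, extending the coordinate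
forms of 𝒱 splits the sequence; this compares the two loci over discrete valuation rings and for
smooth X and Y.

Purity. At a maximal point of C_π of height at least two, the critical module is nonzero and
supported at the closed point. A submodule of depth two in a torsion-free module admits no such
cokernel (`eq_top_of_serreAt_two`). -/

theorem exists_linearIndependent_comp_of_le_finrank_span {K V ι : Type*} [Field K] [AddCommGroup V]
    [Module K V] [Finite ι] (v : ι → V) {t : ℕ}
    (h : t ≤ Module.finrank K (Submodule.span K (Set.range v))) :
    ∃ c : Fin t → ι, LinearIndependent K (v ∘ c) := by
  obtain ⟨κ, a, ha, hsp, hli⟩ := exists_linearIndependent' K v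
  have : Finite κ := Finite.of_injective a ha
  have := Fintype.ofFinite κ
  rw [← hsp, finrank_span_eq_card hli] at h
  let e := (Fintype.equivFin κ).symm
  exact ⟨fun i => a (e (Fin.castLE h i)),
    hli.comp (fun i => e (Fin.castLE h i)) (e.injective.comp (Fin.castLE_injective h))⟩

/-- The minor is chosen in two stages: `t` independent columns, then `t` independent rows of the
matrix that they form. -/
theorem exists_minor_ne_zero_iff_le_rank {K : Type*} [Field K] {p q t : ℕ}
    (A : Matrix (Fin p) (Fin q) K) :
    (∃ (r : Fin t → Fin p) (c : Fin t → Fin q), (A.submatrix r c).det ≠ 0) ↔ t ≤ A.rank := by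
  constructor
  · rintro ⟨r, c, h⟩
    have h1 := A.rank_submatrix_le r c
    rw [Matrix.rank_of_isUnit _ ((Matrix.isUnit_iff_isUnit_det _).2 h.isUnit),
      Fintype.card_fin] at h1
    exact h1
  · intro h
    rw [Matrix.rank_eq_finrank_span_cols] at h
    obtain ⟨c, hc⟩ := exists_linearIndependent_comp_of_le_finrank_span _ h
    have h2 : t ≤ Module.finrank K (Submodule.span K (Set.range (A.submatrix id c).row)) := by
      have h3 : (A.submatrix id c).rank = t := by
        rw [Matrix.rank_eq_finrank_span_cols]
        have : (A.submatrix id c).col = A.col ∘ c := rfl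
        rw [this, finrank_span_eq_card hc, Fintype.card_fin]
      rw [← Matrix.rank_eq_finrank_span_row, h3]
    obtain ⟨r, hr⟩ := exists_linearIndependent_comp_of_le_finrank_span _ h2
    refine ⟨r, c, ?_⟩
    have h4 : LinearIndependent K (A.submatrix r c).row := hr
    have := Matrix.linearIndependent_rows_iff_isUnit.1 h4
    exact ((Matrix.isUnit_iff_isUnit_det _).1 this).ne_zero

/-- The Schur complement of the entry `(i, j)`, multiplied by that entry. -/
def schurComplement {R : Type*} [CommRing R] {p q : ℕ} (A : Matrix (Fin (p + 1)) (Fin (q + 1)) R)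
    (i : Fin (p + 1)) (j : Fin (q + 1)) : Matrix (Fin p) (Fin q) R :=
  Matrix.of fun k l => A i j * A (i.succAbove k) (j.succAbove l) -
    A (i.succAbove k) j * A i (j.succAbove l)

theorem schurComplement_map {R S : Type*} [CommRing R] [CommRing S] (f : R →+* S) {p q : ℕ}
    (A : Matrix (Fin (p + 1)) (Fin (q + 1)) R) (i : Fin (p + 1)) (j : Fin (q + 1)) :
    schurComplement (A.map f) i j = (schurComplement A i j).map f := by
  ext k l
  simp [schurComplement]

/-- Forgetting the coordinate `j` identifies the kernel of `A` with that of the Schur complement,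
because row `i` determines this coordinate from the others. The numbers of columns differ by one. -/
theorem rank_schurComplement {K : Type*} [Field K] {p q : ℕ}
    (A : Matrix (Fin (p + 1)) (Fin (q + 1)) K) (i : Fin (p + 1)) (j : Fin (q + 1))
    (h : A i j ≠ 0) : A.rank = (schurComplement A i j).rank + 1 := by
  have hA := LinearMap.finrank_range_add_finrank_ker A.mulVecLin
  have hN := LinearMap.finrank_range_add_finrank_ker (schurComplement A i j).mulVecLin
  have hrow : ∀ (x : Fin (q + 1) → K) (k : Fin p),
      ((schurComplement A i j).mulVec fun l => x (j.succAbove l)) k =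
        A i j * A.mulVec x (i.succAbove k) - A (i.succAbove k) j * A.mulVec x i := by
    intro x k
    simp only [Matrix.mulVec, dotProduct, schurComplement, Matrix.of_apply]
    rw [Fin.sum_univ_succAbove (fun l => A (i.succAbove k) l * x l) j,
      Fin.sum_univ_succAbove (fun l => A i l * x l) j]
    simp only [mul_add, Finset.mul_sum, sub_mul, Finset.sum_sub_distrib, mul_assoc]
    ring
  let φ : LinearMap.ker A.mulVecLin →ₗ[K] LinearMap.ker (schurComplement A i j).mulVecLin :=
    ((LinearMap.funLeft K K j.succAbove).comp (Submodule.subtype _)).codRestrict _ (by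
      rintro ⟨x, hx⟩
      rw [LinearMap.mem_ker, Matrix.mulVecLin_apply] at hx ⊢
      ext k
      have := hrow x k
      simp only [hx, Pi.zero_apply, mul_zero, sub_zero] at this
      exact this)
  have hφ : Function.Bijective φ := by
    constructor
    · rw [← LinearMap.ker_eq_bot, LinearMap.ker_eq_bot']
      rintro ⟨x, hx⟩ h0
      have h1 : ∀ l, x (j.succAbove l) = 0 := fun l => congrFun (congrArg Subtype.val h0) l
      rw [LinearMap.mem_ker, Matrix.mulVecLin_apply] at hx
      have h2 := congrFun hx i
      simp only [Matrix.mulVec, dotProduct] at h2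
      rw [Fin.sum_univ_succAbove _ j] at h2
      simp only [h1, mul_zero, Finset.sum_const_zero, add_zero, Pi.zero_apply, mul_eq_zero, h,
        false_or] at h2
      ext l
      rcases Fin.eq_self_or_eq_succAbove j l with rfl | ⟨l, rfl⟩
      · exact h2
      · exact h1 l
    · rintro ⟨y, hy⟩
      rw [LinearMap.mem_ker, Matrix.mulVecLin_apply] at hy
      -- The inserted coordinate is the solution of the equation given by row `i`.
      let x : Fin (q + 1) → K :=
        j.insertNth (-(A i j)⁻¹ * ∑ l, A i (j.succAbove l) * y l) y
      have hxy : (fun l => x (j.succAbove l)) = y := by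
        ext l
        simp [x]
      have hxi : A.mulVec x i = 0 := by
        simp only [Matrix.mulVec, dotProduct]
        rw [Fin.sum_univ_succAbove _ j]
        simp only [x, Fin.insertNth_apply_same, Fin.insertNth_apply_succAbove]
        field_simp
        ring
      refine ⟨⟨x, ?_⟩, Subtype.ext hxy⟩
      rw [LinearMap.mem_ker, Matrix.mulVecLin_apply]
      ext k
      rcases Fin.eq_self_or_eq_succAbove i k with rfl | ⟨k, rfl⟩
      · exact hxi
      · have := hrow x k
        rw [hxy, hy, hxi] at this
        simpa [h] using this
  have hker := (LinearEquiv.ofBijective φ hφ).finrank_eq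
  rw [Matrix.rank, Matrix.rank]
  simp only [Module.finrank_fintype_fun_eq_card, Fintype.card_fin] at hA hN
  omega

/-- Some minor of size `t` of the matrix does not belong to the ideal. -/
def HasMinorOutside {R : Type*} [CommRing R] {p q : ℕ} (A : Matrix (Fin p) (Fin q) R) (t : ℕ)
    (P : Ideal R) : Prop :=
  ∃ (r : Fin t → Fin p) (c : Fin t → Fin q), (A.submatrix r c).det ∉ P

variable {R : Type*} [CommRing R] {p q t : ℕ}

theorem HasMinorOutside.mono {A : Matrix (Fin p) (Fin q) R} {P P' : Ideal R} (h : P ≤ P')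
    (hA : HasMinorOutside A t P') : HasMinorOutside A t P := by
  obtain ⟨r, c, hrc⟩ := hA
  exact ⟨r, c, fun h' => hrc (h h')⟩

/-- Minors commute with ring homomorphisms, so only the kernel of the map to the field matters. Rank
arguments thus become available at every prime. -/
theorem hasMinorOutside_iff_le_rank {K : Type*} [Field K] (f : R →+* K) {P : Ideal R}
    (hP : RingHom.ker f = P) (A : Matrix (Fin p) (Fin q) R) :
    HasMinorOutside A t P ↔ t ≤ (A.map f).rank := by
  rw [← exists_minor_ne_zero_iff_le_rank]
  have : ∀ (r : Fin t → Fin p) (c : Fin t → Fin q),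
      ((A.map f).submatrix r c).det = f (A.submatrix r c).det := by
    intro r c
    rw [RingHom.map_det]
    rfl
  simp_rw [this, HasMinorOutside, ← hP, RingHom.mem_ker]

/-- Over the residue field of `P` the pivot is invertible, so `rank_schurComplement` applies there.
-/
theorem hasMinorOutside_schurComplement_iff (P : Ideal R) [P.IsPrime]
    (A : Matrix (Fin (p + 1)) (Fin (q + 1)) R) (i : Fin (p + 1)) (j : Fin (q + 1))
    (h : A i j ∉ P) :
    HasMinorOutside (schurComplement A i j) t P ↔ HasMinorOutside A (t + 1) P := by
  have hk : RingHom.ker (algebraMap R P.ResidueField) = P := P.ker_algebraMap_residueField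
  rw [hasMinorOutside_iff_le_rank _ hk, hasMinorOutside_iff_le_rank _ hk,
    rank_schurComplement (A.map (algebraMap R P.ResidueField)) i j, schurComplement_map,
    Nat.add_le_add_iff_right]
  · intro h0
    apply h
    rw [← hk]
    exact h0

theorem hasMinorOutside_map_iff {S : Type*} [CommRing S] (f : R →+* S) (P : Ideal S)
    (A : Matrix (Fin p) (Fin q) R) :
    HasMinorOutside (A.map f) t P ↔ HasMinorOutside A t (P.comap f) := by
  have : ∀ (r : Fin t → Fin p) (c : Fin t → Fin q),
      ((A.map f).submatrix r c).det = f (A.submatrix r c).det := by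
    intro r c
    rw [RingHom.map_det]
    rfl
  simp_rw [HasMinorOutside, this, Ideal.mem_comap]

theorem hasMinorOutside_congr {P : Ideal R} (A A' : Matrix (Fin p) (Fin q) R)
    (h : ∀ i j, A i j - A' i j ∈ P) : HasMinorOutside A t P ↔ HasMinorOutside A' t P := by
  have hk : ∀ B : Matrix (Fin p) (Fin q) R, HasMinorOutside B t P ↔
      HasMinorOutside (B.map (Ideal.Quotient.mk P)) t ⊥ := by
    intro B
    rw [hasMinorOutside_map_iff, ← RingHom.ker_eq_comap_bot, Ideal.mk_ker]
  rw [hk, hk]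
  have : A.map (Ideal.Quotient.mk P) = A'.map (Ideal.Quotient.mk P) := by
    ext i j
    exact Ideal.Quotient.eq.2 (h i j)
  rw [this]

theorem not_hasMinorOutside_vecMulVec (u : Fin p → R) (v : Fin q → R) (P : Ideal R) [P.IsPrime]
    (ht : 2 ≤ t) : ¬ HasMinorOutside (Matrix.vecMulVec u v) t P := by
  rw [hasMinorOutside_iff_le_rank _ P.ker_algebraMap_residueField, not_le]
  have : (Matrix.vecMulVec u v).map (algebraMap R P.ResidueField) =
      Matrix.vecMulVec (algebraMap R P.ResidueField ∘ u) (algebraMap R P.ResidueField ∘ v) := by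
    ext i j
    simp [Matrix.vecMulVec]
  rw [this]
  exact (Matrix.rank_vecMulVec_le _ _).trans_lt ht

open Polynomial in
theorem map_C_injective : Function.Injective (Ideal.map (C : R →+* R[X])) := by
  intro I J h
  ext x
  have key : ∀ I : Ideal R, x ∈ I ↔ C x ∈ I.map (C : R →+* R[X]) := by
    intro I
    refine ⟨Ideal.mem_map_of_mem _, fun hx => ?_⟩
    rw [Ideal.mem_map_C_iff] at hx
    simpa using hx 0
  rw [key, key, h]

-- Extension along `C` preserves primes and is injective on ideals, so strict chains below `P`
-- remain strict in the polynomial ring. The induction is on a bound for the height of the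
-- extension.
open Polynomial in
theorem height_le_height_map_C (P : Ideal R) [P.IsPrime] :
    P.height ≤ (P.map (C : R →+* R[X])).height := by
  have key : ∀ (n : ℕ) (P : Ideal R) [P.IsPrime],
      (P.map (C : R →+* R[X])).height ≤ n → P.height ≤ n := by
    intro n
    induction n with
    | zero =>
      intro P _ h
      have := Ideal.isPrime_map_C_of_isPrime (P := P)
      rw [Ideal.height_le_iff] at h ⊢
      intro q hq hqP
      have := Ideal.isPrime_map_C_of_isPrime (P := q)
      refine absurd (h (q.map C) this ?_) (by simp)
      exact lt_of_le_of_ne (Ideal.map_mono hqP.le) fun he => hqP.ne (map_C_injective he)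
    | succ n ih =>
      intro P _ h
      have := Ideal.isPrime_map_C_of_isPrime (P := P)
      rw [Ideal.height_le_iff] at h ⊢
      intro q hq hqP
      have := Ideal.isPrime_map_C_of_isPrime (P := q)
      have hlt : (q.map (C : R →+* R[X])).height < (n + 1 : ℕ) := by
        refine h (q.map C) this ?_
        refine lt_of_le_of_ne (Ideal.map_mono hqP.le) fun he => hqP.ne ?_
        exact map_C_injective he
      have h2 : q.height ≤ n := ih q (by
        push_cast at hlt
        exact Order.le_of_lt_add_one hlt)
      refine h2.trans_lt ?_
      exact_mod_cast Nat.lt_succ_self n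
  by_cases h : (P.map (C : R →+* R[X])).height = ⊤
  · rw [h]
    exact le_top
  · obtain ⟨n, hn⟩ := ENat.ne_top_iff_exists.1 h
    rw [← hn]
    exact key n P hn.symm.le

open Polynomial in
/-- If `P` is minimal among the primes where the rank drops, then `P[X]` is minimal among the
primes where the rank of a generic perturbation of one entry drops. -/
theorem hasMinorOutside_add_X [IsNoetherianRing R] (A : Matrix (Fin (p + 1)) (Fin (q + 1)) R)
    (P : Ideal R) [P.IsPrime]
    (hmin : ∀ q : Ideal R, q.IsPrime → q < P → HasMinorOutside A t q)
    (Q : Ideal R[X]) [Q.IsPrime] (hQ : Q < P.map C) :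
    HasMinorOutside (A.map C + Matrix.vecMulVec (Pi.single 0 X) (Pi.single 0 1)) t Q := by
  by_contra hno
  have hPX := Ideal.isPrime_map_C_of_isPrime (P := P)
  let Q₀ : Ideal R[X] := P.comap (evalRingHom 0)
  have hQ₀ : Q₀.IsPrime := Ideal.IsPrime.comap _
  have hXQ₀ : (X : R[X]) ∈ Q₀ := by simp [Q₀, Ideal.mem_comap]
  have hPQ₀ : P.map C ≤ Q₀ := by
    rw [Ideal.map_le_iff_le_comap]
    intro x hx
    simpa [Q₀, Ideal.mem_comap] using hx
  -- Here `Q₀ = P + (X)`. A prime `Q'` between `Q + (X)` and `Q₀` contracts to a prime inside `P`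
  -- where all minors of `A` vanish. By minimality of `P` the contraction is `P` itself, and then
  -- `Q' = Q₀`.
  have hmem : Q₀ ∈ (Q ⊔ Ideal.span {X}).minimalPrimes := by
    refine ⟨⟨hQ₀, sup_le (hQ.le.trans hPQ₀) (by simpa [Ideal.span_le] using hXQ₀)⟩, ?_⟩
    rintro Q' ⟨hQ', hle⟩ hQ'Q₀
    have hX : (X : R[X]) ∈ Q' := hle (Ideal.mem_sup_right (Ideal.subset_span rfl))
    have hno' : ¬ HasMinorOutside A t (Q'.comap C) := by
      rw [← hasMinorOutside_map_iff,
        hasMinorOutside_congr _ (A.map C + Matrix.vecMulVec (Pi.single 0 X) (Pi.single 0 1))]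
      · exact fun h => hno (h.mono (le_sup_left.trans hle))
      · intro i j
        simp only [Matrix.map_apply, Matrix.add_apply, Matrix.vecMulVec_apply, sub_add_cancel_left]
        refine Q'.neg_mem (Q'.mul_mem_right _ ?_)
        by_cases hi : i = 0
        · subst hi
          simpa using hX
        · simp [hi]
    have hle' : Q'.comap C ≤ P := by
      intro x hx
      have := hQ'Q₀ hx
      simpa [Q₀, Ideal.mem_comap] using this
    have heq : Q'.comap C = P := by
      by_contra hne
      exact hno' (hmin _ (hQ'.comap _) (lt_of_le_of_ne hle' hne))
    intro f hf
    rw [← X_mul_divX_add f]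
    refine Q'.add_mem (Q'.mul_mem_right _ hX) ?_
    have : f.coeff 0 ∈ P := by
      simpa [Q₀, Ideal.mem_comap, ← coeff_zero_eq_eval_zero] using hf
    rw [← heq] at this
    exact this
  -- By Krull, `Q₀` has height at most one modulo `Q`. This contradicts the chain `Q < P[X] < Q₀`.
  have h1 := Ideal.map_height_le_one_of_mem_minimalPrimes hmem
  have hs : Function.Surjective (Ideal.Quotient.mk Q) := Ideal.Quotient.mk_surjective
  have hp₀ : (Q₀.map (Ideal.Quotient.mk Q)).IsPrime :=
    Ideal.map_isPrime_of_surjective hs (by rw [Ideal.mk_ker]; exact hQ.le.trans hPQ₀)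
  have hp₁ : ((P.map C).map (Ideal.Quotient.mk Q)).IsPrime :=
    Ideal.map_isPrime_of_surjective hs (by rw [Ideal.mk_ker]; exact hQ.le)
  have hcm : ∀ I : Ideal R[X], Q ≤ I →
      (I.map (Ideal.Quotient.mk Q)).comap (Ideal.Quotient.mk Q) = I := by
    intro I hI
    rw [Ideal.comap_map_of_surjective _ hs, ← RingHom.ker_eq_comap_bot, Ideal.mk_ker,
      sup_eq_left.2 hI]
  rw [← Nat.cast_one, Ideal.height_le_iff] at h1
  have h2 := h1 _ hp₁ (by
    refine lt_of_le_of_ne (Ideal.map_mono hPQ₀) fun he => ?_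
    have he' : P.map C = Q₀ := by
      rw [← hcm _ hQ.le, he, hcm _ (hQ.le.trans hPQ₀)]
    have hX : (X : R[X]) ∈ P.map C := he' ▸ hXQ₀
    rw [Ideal.mem_map_C_iff] at hX
    have := hX 1
    rw [coeff_X_one] at this
    exact (Ideal.IsPrime.ne_top inferInstance) ((Ideal.eq_top_iff_one P).2 this))
  have h3 : ((P.map C).map (Ideal.Quotient.mk Q)).height ≤ (0 : ℕ) :=
    Order.le_of_lt_add_one (by simpa using h2)
  rw [Ideal.height_le_iff] at h3
  refine absurd (h3 ⊥ Ideal.isPrime_bot ?_) (by simp)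
  rw [bot_lt_iff_ne_bot, Ne, Ideal.map_eq_bot_iff_le_ker, Ideal.mk_ker]
  exact hQ.not_ge

open Polynomial in
/-- **Eagon–Northcott**: a prime which is minimal among the primes containing all minors of
size `t` of a `p × q` matrix over a Noetherian ring has height at most
`(p - t + 1)(q - t + 1)`. -/
theorem height_le_of_minimal_minors {R : Type u} [CommRing R] [IsNoetherianRing R] {p q t : ℕ}
    (A : Matrix (Fin p) (Fin q) R) (P : Ideal R) [P.IsPrime] (hP : ¬ HasMinorOutside A t P)
    (hmin : ∀ Q : Ideal R, Q.IsPrime → Q < P → HasMinorOutside A t Q) :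
    P.height ≤ ((p + 1 - t) * (q + 1 - t) : ℕ) := by
  induction p generalizing R q t with
  | zero =>
    obtain _ | t := t
    · exact absurd ⟨Fin.elim0, Fin.elim0, by
        simpa using (Ideal.ne_top_iff_one P).1 (Ideal.IsPrime.ne_top inferInstance)⟩ hP
    rw [show (0 + 1 - (t + 1)) * (q + 1 - (t + 1)) = 0 by simp, Ideal.height_le_iff]
    intro Q hQ hQP
    obtain ⟨r, -⟩ := hmin Q hQ hQP
    exact (r 0).elim0
  | succ p ih =>
    obtain _ | t := t
    · exact absurd ⟨Fin.elim0, Fin.elim0, by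
        simpa using (Ideal.ne_top_iff_one P).1 (Ideal.IsPrime.ne_top inferInstance)⟩ hP
    obtain _ | q := q
    · rw [show (p + 1 + 1 - (t + 1)) * (0 + 1 - (t + 1)) = 0 by simp, Ideal.height_le_iff]
      intro Q hQ hQP
      obtain ⟨r, c, -⟩ := hmin Q hQ hQP
      exact (c 0).elim0
    rw [show p + 1 + 1 - (t + 1) = p + 1 - t by omega,
      show q + 1 + 1 - (t + 1) = q + 1 - t by omega]
    by_cases hpiv : ∃ i j, A i j ∉ P
    -- With a pivot outside `P`, the Schur complement lowers both dimensions and the size of the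
    -- minors by one, so the bound does not change.
    · obtain ⟨i, j, hij⟩ := hpiv
      refine ih (schurComplement A i j) P ?_ ?_
      · rwa [hasMinorOutside_schurComplement_iff P A i j hij]
      · intro Q hQ hQP
        rw [hasMinorOutside_schurComplement_iff Q A i j fun h => hij (hQP.le h)]
        exact hmin Q hQ hQP
    push Not at hpiv
    obtain _ | t := t
    -- Minors of size one are the entries, and Krull's height theorem bounds the height by their
    -- number.
    · have hfin : (Set.range fun ij : Fin (p + 1) × Fin (q + 1) => A ij.1 ij.2).Finite :=
        Set.finite_range _
      refine (Ideal.height_le_card_of_mem_minimalPrimes_span hfin ⟨⟨inferInstance, ?_⟩, ?_⟩).trans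
        ?_
      · rw [Ideal.span_le]
        rintro _ ⟨ij, rfl⟩
        exact hpiv _ _
      · rintro Q ⟨hQ, hle⟩ hQP
        by_contra hne
        obtain ⟨r, c, hrc⟩ := hmin Q hQ (lt_of_le_not_ge hQP hne)
        apply hrc
        rw [Matrix.det_fin_one]
        exact hle (Ideal.subset_span ⟨(r 0, c 0), rfl⟩)
      · have h := Set.ncard_image_le (f := fun ij : Fin (p + 1) × Fin (q + 1) => A ij.1 ij.2)
          (Set.toFinite Set.univ)
        rw [Set.image_univ, Set.ncard_univ, Nat.card_prod, Nat.card_fin, Nat.card_fin] at h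
        exact_mod_cast h
    -- All entries lie in `P` and the minors have size at least two. Adding a variable to the corner
    -- entry creates a pivot outside `P[X]`; modulo `P[X]` the new matrix has rank one, so the
    -- minors still vanish there.
    · have hPX := Ideal.isPrime_map_C_of_isPrime (P := P)
      let A' : Matrix (Fin (p + 1)) (Fin (q + 1)) R[X] :=
        A.map C + Matrix.vecMulVec (Pi.single 0 X) (Pi.single 0 1)
      have hA' : A' 0 0 ∉ P.map C := by
        intro h
        rw [Ideal.mem_map_C_iff] at h
        have := h 1
        simp only [A', Matrix.add_apply, Matrix.map_apply, Matrix.vecMulVec_apply,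
          Pi.single_eq_same, mul_one, coeff_add, coeff_X_one, coeff_C_succ, zero_add] at this
        exact (Ideal.IsPrime.ne_top inferInstance) ((Ideal.eq_top_iff_one P).2 this)
      refine (height_le_height_map_C P).trans (ih (schurComplement A' 0 0) (P.map C) ?_ ?_)
      · rw [hasMinorOutside_schurComplement_iff _ A' 0 0 hA',
          hasMinorOutside_congr A' (Matrix.vecMulVec (Pi.single 0 X) (Pi.single 0 1))]
        · exact not_hasMinorOutside_vecMulVec _ _ _ (by omega)
        · intro i j
          simp only [A', Matrix.add_apply, Matrix.map_apply, add_sub_cancel_right]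
          exact Ideal.mem_map_of_mem _ (hpiv i j)
      · intro Q hQ hQP
        rw [hasMinorOutside_schurComplement_iff Q A' 0 0 fun h => hA' (hQP.le h)]
        exact hasMinorOutside_add_X A P hmin Q hQP

end Minors

/-! ### Dimension shifting for left derived functors -/

section DimensionShift

open Limits

universe v w v' w'

variable {C : Type w} [Category.{v} C] [Abelian C]

/-- The augmentation of a projective resolution. -/
def augmentation {Z : C} (Q : ProjectiveResolution Z) : Q.complex.X 0 ⟶ Z := Q.π.f 0

theorem d_comp_augmentation {Z : C} (Q : ProjectiveResolution Z) :
    Q.complex.d 1 0 ≫ augmentation Q = 0 := Q.complex_d_comp_π_f_zero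

/-- The augmentation is the cokernel of the last differential. -/
def isColimitAugmentation {Z : C} (Q : ProjectiveResolution Z) :
    IsColimit (CokernelCofork.ofπ (f := Q.complex.d 1 0) (augmentation Q) (d_comp_augmentation Q)) :=
  Q.isColimitCokernelCofork

instance epi_augmentation {Z : C} (Q : ProjectiveResolution Z) : Epi (augmentation Q) :=
  inferInstanceAs (Epi (Q.π.f 0))

theorem d_comp_augmentation_comp (S : ShortComplex C) (Q : ProjectiveResolution S.X₁) :
    Q.complex.d 1 0 ≫ augmentation Q ≫ S.f = 0 := by
  rw [← Category.assoc, d_comp_augmentation, zero_comp]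

theorem augmentation_comp_comp (S : ShortComplex C) (Q : ProjectiveResolution S.X₁) :
    (augmentation Q ≫ S.f) ≫ S.g = 0 := by
  rw [Category.assoc, S.zero, comp_zero]

/-- The complex obtained by splicing a short exact sequence with a resolution of its first term. -/
abbrev spliceComplex (S : ShortComplex C) (Q : ProjectiveResolution S.X₁) : ChainComplex C ℕ :=
  Q.complex.augment (augmentation Q ≫ S.f) (d_comp_augmentation_comp S Q)

/-- Composing the augmentation with a monomorphism does not change its kernel. -/
theorem spliceComplex_exact_one (S : ShortComplex C) (hS : S.ShortExact)
    (Q : ProjectiveResolution S.X₁) :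
    (ShortComplex.mk ((spliceComplex S Q).d 2 1) ((spliceComplex S Q).d 1 0)
      (d_comp_augmentation_comp S Q)).Exact := by
  have := hS.mono_f
  have h : (ShortComplex.mk (Q.complex.d 1 0) (augmentation Q) (d_comp_augmentation Q)).Exact :=
    ShortComplex.exact_of_g_is_cokernel _ (isColimitAugmentation Q)
  let α : ShortComplex.mk (Q.complex.d 1 0) (augmentation Q) (d_comp_augmentation Q) ⟶
      ShortComplex.mk ((spliceComplex S Q).d 2 1) ((spliceComplex S Q).d 1 0)
        (d_comp_augmentation_comp S Q) :=
    { τ₁ := 𝟙 _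
      τ₂ := 𝟙 _
      τ₃ := S.f
      comm₁₂ := by
        dsimp
        exact (Category.id_comp _).trans (Category.comp_id _).symm
      comm₂₃ := by
        dsimp
        exact Category.id_comp _ }
  have h1 : Epi α.τ₁ := inferInstanceAs (Epi (𝟙 _))
  have h2 : IsIso α.τ₂ := inferInstanceAs (IsIso (𝟙 _))
  have h3 : Mono α.τ₃ := this
  exact (ShortComplex.exact_iff_of_epi_of_isIso_of_mono α).1 h

theorem spliceComplex_exact_zero (S : ShortComplex C) (hS : S.ShortExact)
    (Q : ProjectiveResolution S.X₁) :
    (ShortComplex.mk ((spliceComplex S Q).d 1 0) S.g (augmentation_comp_comp S Q)).Exact := by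
  let α : ShortComplex.mk ((spliceComplex S Q).d 1 0) S.g (augmentation_comp_comp S Q) ⟶ S :=
    { τ₁ := augmentation Q
      τ₂ := 𝟙 _
      τ₃ := 𝟙 _
      comm₁₂ := by
        dsimp
        exact (Category.comp_id _).symm
      comm₂₃ := by
        dsimp
        exact (Category.id_comp _).trans (Category.comp_id _).symm }
  have h1 : Epi α.τ₁ := inferInstanceAs (Epi (augmentation Q))
  have h2 : IsIso α.τ₂ := inferInstanceAs (IsIso (𝟙 _))
  have h3 : Mono α.τ₃ := inferInstanceAs (Mono (𝟙 _))
  exact (ShortComplex.exact_iff_of_epi_of_isIso_of_mono α).2 hS.exact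

/-- The projective resolution obtained by splicing. -/
def spliceResolution (S : ShortComplex C) (hS : S.ShortExact) [Projective S.X₂]
    (Q : ProjectiveResolution S.X₁) : ProjectiveResolution S.X₃ where
  complex := spliceComplex S Q
  projective n := by
    obtain _ | n := n
    · exact inferInstanceAs (Projective S.X₂)
    · exact Q.projective n
  π := (ChainComplex.toSingle₀Equiv _ _).symm ⟨S.g, augmentation_comp_comp S Q⟩
  quasiIso := ⟨fun n => by
    have := hS.epi_g
    cases n
    · rw [ChainComplex.quasiIsoAt₀_iff, ShortComplex.quasiIso_iff_of_zeros']
      · dsimp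
        refine (ShortComplex.exact_and_epi_g_iff_of_iso ?_).2
          ⟨spliceComplex_exact_zero S hS Q, by dsimp; infer_instance⟩
        refine ShortComplex.isoMk (Iso.refl _) (Iso.refl _) (Iso.refl _)
          ((Category.id_comp _).trans (Category.comp_id _).symm) ?_
        refine (Category.id_comp _).trans (Eq.trans ?_ (Category.comp_id _).symm)
        exact (ChainComplex.toSingle₀Equiv_symm_apply_f_zero (C := spliceComplex S Q) S.g
          (augmentation_comp_comp S Q)).symm
      all_goals rfl
    · rename_i n
      rw [quasiIsoAt_iff_exactAt']
      · rw [HomologicalComplex.exactAt_iff' _ (n + 2) (n + 1) n (by simp) (by simp)]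
        obtain _ | n := n
        · exact spliceComplex_exact_one S hS Q
        · exact Q.exact_succ n
      · apply ChainComplex.exactAt_succ_single_obj⟩

variable {D : Type w'} [Category.{v'} D] [Abelian D] [EnoughProjectives C]

/-- The spliced resolution is the resolution of `S.X₁` shifted by one, so the short complexes that
compute the two homologies coincide. -/
theorem leftDerived_succ_succ_iso (F : C ⥤ D) [F.Additive] (S : ShortComplex C)
    (hS : S.ShortExact) [Projective S.X₂] (n : ℕ) :
    Nonempty ((F.leftDerived (n + 2)).obj S.X₃ ≅ (F.leftDerived (n + 1)).obj S.X₁) := by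
  let Q := ProjectiveResolution.of S.X₁
  let P := spliceResolution S hS Q
  refine ⟨P.isoLeftDerivedObj F (n + 2) ≪≫ ?_ ≪≫ (Q.isoLeftDerivedObj F (n + 1)).symm⟩
  refine (HomologicalComplex.homologyIsoSc' _ (n + 3) (n + 2) (n + 1) (by simp) (by simp)) ≪≫ ?_ ≪≫
    (HomologicalComplex.homologyIsoSc' _ (n + 2) (n + 1) n (by simp) (by simp)).symm
  exact Iso.refl _

/-- By right exactness the opcycles are `F.obj S.X₁`, and the homology in degree one is the kernel
of the map from them to `F.obj S.X₂`. -/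
theorem leftDerived_one_iso (F : C ⥤ D) [F.Additive] [PreservesFiniteColimits F]
    (S : ShortComplex C) (hS : S.ShortExact) [Projective S.X₂] :
    Nonempty ((F.leftDerived 1).obj S.X₃ ≅ kernel (F.map S.f)) := by
  let Q := ProjectiveResolution.of S.X₁
  let P := spliceResolution S hS Q
  refine ⟨P.isoLeftDerivedObj F 1 ≪≫
    (HomologicalComplex.homologyIsoSc' _ 2 1 0 (by simp) (by simp)) ≪≫ ?_⟩
  let T : ShortComplex D := ShortComplex.mk (F.map (Q.complex.d 1 0)) (F.map (augmentation Q ≫ S.f)) (by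
    rw [← F.map_comp, d_comp_augmentation_comp, F.map_zero])
  change T.homology ≅ _
  let hc := CokernelCofork.mapIsColimit _ (isColimitAugmentation Q) F
  let e : T.opcycles ≅ F.obj S.X₁ := T.opcyclesIsCokernel.coconePointUniqueUpToIso hc
  have he : T.pOpcycles ≫ e.hom = F.map (augmentation Q) :=
    T.opcyclesIsCokernel.comp_coconePointUniqueUpToIso_hom hc WalkingParallelPair.one
  refine (T.homologyIsKernel.conePointUniqueUpToIso (kernelIsKernel _)) ≪≫
    kernel.mapIso T.fromOpcycles (F.map S.f) e (Iso.refl _) ?_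
  rw [← cancel_epi T.pOpcycles, ← Category.assoc, ShortComplex.p_fromOpcycles, ← Category.assoc, he,
    Iso.refl_hom, Category.comp_id, ← F.map_comp]

end DimensionShift

/-! ### Short exact sequences of modules -/

section ShortExact

variable {R : Type u} [CommRing R] {M M' M'' : Type u} [AddCommGroup M] [Module R M]
  [AddCommGroup M'] [Module R M'] [AddCommGroup M''] [Module R M'']

/-- The short complex of modules defined by two composable maps. -/
abbrev shortComplexOf (f : M' →ₗ[R] M) (g : M →ₗ[R] M'') (h : Function.Exact f g) :
    ShortComplex (ModuleCat.{u} R) :=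
  ShortComplex.mk (ModuleCat.ofHom f) (ModuleCat.ofHom g) (by
    ext x
    exact h.apply_apply_eq_zero x)

theorem shortExact_shortComplexOf (f : M' →ₗ[R] M) (g : M →ₗ[R] M'') (h : Function.Exact f g)
    (hf : Function.Injective f) (hg : Function.Surjective g) :
    (shortComplexOf f g h).ShortExact where
  exact := (ShortComplex.ShortExact.moduleCat_exact_iff_function_exact _).2 h
  mono_f := (ModuleCat.mono_iff_injective _).2 hf
  epi_g := (ModuleCat.epi_iff_surjective _).2 hg

end ShortExact

/-! ### Betti numbers -/

section Betti

open TensorProduct IsLocalRing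

variable (R : Type u) [CommRing R] [IsLocalRing R]

/-- The minimal number of generators of a finite module over a local ring. -/
def minGens (M : Type*) [AddCommGroup M] [Module R M] : ℕ :=
  Module.finrank (ResidueField R) (ResidueField R ⊗[R] M)

variable {M M' M'' : Type u} [AddCommGroup M] [Module R M] [AddCommGroup M'] [Module R M']
  [AddCommGroup M''] [Module R M'']

variable {R}

theorem length_residueField_tensor (M : Type u) [AddCommGroup M] [Module R M] [Module.Finite R M] :
    Module.length R (ResidueField R ⊗[R] M) = minGens R M := by
  rw [Module.length_eq_of_surjective (R := ResidueField R) (S := R)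
    IsLocalRing.residue_surjective, Module.length_eq_finrank]
  rfl

theorem betti_eq_of_iso {M N : ModuleCat.{u} R} (e : M ≅ N) (i : ℕ) : betti M i = betti N i := by
  unfold betti
  rw [(((Tor (ModuleCat.{u} R) i).obj
    (ModuleCat.of R (ResidueField R))).mapIso e).toLinearEquiv.length_eq]

instance preservesFiniteColimits_tensoringLeft (N : ModuleCat.{u} R) :
    Limits.PreservesFiniteColimits
      ((MonoidalCategory.tensoringLeft (ModuleCat.{u} R)).obj N) :=
  inferInstanceAs (Limits.PreservesFiniteColimits (MonoidalCategory.tensorLeft N))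

theorem betti_zero (M : ModuleCat.{u} R) [Module.Finite R M] : betti M 0 = minGens R M := by
  have e := (((MonoidalCategory.tensoringLeft (ModuleCat.{u} R)).obj
    (ModuleCat.of R (ResidueField R))).leftDerivedZeroIsoSelf.app M).toLinearEquiv
  have h : Module.length R (((Tor (ModuleCat.{u} R) 0).obj
      (ModuleCat.of R (ResidueField R))).obj M) = minGens R M :=
    e.length_eq.trans (length_residueField_tensor M)
  rw [betti, h, ENat.toNat_natCast]

theorem betti_succ_succ [Module.Projective R M] (f : M' →ₗ[R] M) (g : M →ₗ[R] M'')
    (h : Function.Exact f g) (hf : Function.Injective f) (hg : Function.Surjective g) (i : ℕ) :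
    betti (ModuleCat.of R M'') (i + 2) = betti (ModuleCat.of R M') (i + 1) := by
  have hS := shortExact_shortComplexOf f g h hf hg
  have : Projective (shortComplexOf f g h).X₂ :=
    (IsProjective.iff_projective _).1 (inferInstanceAs (Module.Projective R M))
  obtain ⟨e⟩ := leftDerived_succ_succ_iso ((MonoidalCategory.tensoringLeft (ModuleCat.{u} R)).obj
    (ModuleCat.of R (ResidueField R))) _ hS i
  have h : Module.length R (((Tor (ModuleCat.{u} R) (i + 2)).obj
      (ModuleCat.of R (ResidueField R))).obj (ModuleCat.of R M'')) =
      Module.length R (((Tor (ModuleCat.{u} R) (i + 1)).obj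
      (ModuleCat.of R (ResidueField R))).obj (ModuleCat.of R M')) := e.toLinearEquiv.length_eq
  rw [betti, betti, h]

theorem length_ker_add_length_range {A V W : Type*} [Ring A] [AddCommGroup V] [Module A V]
    [AddCommGroup W] [Module A W] (φ : V →ₗ[A] W) :
    Module.length A (LinearMap.ker φ) + Module.length A (LinearMap.range φ) = Module.length A V :=
  (Module.length_eq_add_of_exact (LinearMap.ker φ).subtype φ.rangeRestrict
    (Submodule.subtype_injective _) φ.surjective_rangeRestrict (by
      rw [LinearMap.exact_iff, Submodule.range_subtype]
      exact LinearMap.ker_rangeRestrict _)).symm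

theorem length_range_add_length {A V W Z : Type*} [Ring A] [AddCommGroup V] [Module A V]
    [AddCommGroup W] [Module A W] [AddCommGroup Z] [Module A Z] {φ : V →ₗ[A] W} {ψ : W →ₗ[A] Z}
    (h : Function.Exact φ ψ) (hψ : Function.Surjective ψ) :
    Module.length A (LinearMap.range φ) + Module.length A Z = Module.length A W :=
  (Module.length_eq_add_of_exact (LinearMap.range φ).subtype ψ
    (Submodule.subtype_injective _) hψ (by
      rw [LinearMap.exact_iff, Submodule.range_subtype]
      exact LinearMap.exact_iff.1 h)).symm

/-- Right exactness of the tensor product and additivity of length. Lengths live in `ℕ∞`, hence the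
form without subtraction. -/
theorem length_ker_lTensor [Module.Finite R M] [Module.Finite R M'] [Module.Finite R M'']
    (f : M' →ₗ[R] M) (g : M →ₗ[R] M'')
    (h : Function.Exact f g) (hg : Function.Surjective g) :
    Module.length R (LinearMap.ker (f.lTensor (ResidueField R))) + minGens R M =
      (minGens R M' + minGens R M'' : ℕ) := by
  have h1 := length_ker_add_length_range (f.lTensor (ResidueField R))
  have h2 := length_range_add_length (lTensor_exact (ResidueField R) h hg)
    (LinearMap.lTensor_surjective _ hg)
  rw [length_residueField_tensor] at h1
  rw [length_residueField_tensor, length_residueField_tensor] at h2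
  push_cast
  rw [← h1, ← h2, add_assoc]

/-- As the middle term is projective, `Tor₁` of the quotient is the kernel of `k ⊗ M' → k ⊗ M`. The
fibres are finite-dimensional, so the equation between lengths descends to natural numbers. -/
theorem betti_one_add [Module.Projective R M] [Module.Finite R M] [Module.Finite R M']
    [Module.Finite R M''] (f : M' →ₗ[R] M) (g : M →ₗ[R] M'')
    (h : Function.Exact f g) (hf : Function.Injective f) (hg : Function.Surjective g) :
    betti (ModuleCat.of R M'') 1 + minGens R M = minGens R M' + minGens R M'' := by
  have hS := shortExact_shortComplexOf f g h hf hg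
  have : Projective (shortComplexOf f g h).X₂ :=
    (IsProjective.iff_projective _).1 (inferInstanceAs (Module.Projective R M))
  obtain ⟨e⟩ := leftDerived_one_iso ((MonoidalCategory.tensoringLeft (ModuleCat.{u} R)).obj
    (ModuleCat.of R (ResidueField R))) _ hS
  have h1 : Module.length R (((Tor (ModuleCat.{u} R) 1).obj
      (ModuleCat.of R (ResidueField R))).obj (ModuleCat.of R M'')) =
      Module.length R (LinearMap.ker (f.lTensor (ResidueField R))) :=
    (e ≪≫ ModuleCat.kernelIsoKer _).toLinearEquiv.length_eq
  have h2 := length_ker_lTensor f g h hg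
  have h3 : Module.length R (LinearMap.ker (f.lTensor (ResidueField R))) ≠ ⊤ := by
    intro h4
    rw [h4, top_add] at h2
    exact ENat.natCast_ne_top _ h2.symm
  obtain ⟨n, hn⟩ := ENat.ne_top_iff_exists.1 h3
  rw [betti, h1, ← hn, ENat.toNat_natCast]
  rw [← hn] at h2
  exact_mod_cast h2

theorem betti_succ_of_projective [Module.Projective R M] (i : ℕ) :
    betti (ModuleCat.of R M) (i + 1) = 0 := by
  have : Projective (ModuleCat.of R M) := (IsProjective.iff_projective _).1 inferInstance
  have h := isZero_Tor_succ_of_projective _ (ModuleCat.of R (ResidueField R)) (ModuleCat.of R M) i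
  have := (ModuleCat.isZero_iff_subsingleton).1 h
  rw [betti, Module.length_eq_zero, ENat.toNat_zero]

theorem minGens_eq_of_equiv (e : M ≃ₗ[R] M') : minGens R M = minGens R M' :=
  (AlgebraTensorModule.congr (LinearEquiv.refl (ResidueField R) (ResidueField R)) e).finrank_eq

theorem minGens_le_of_surjective [Module.Finite R M] (g : M →ₗ[R] M'')
    (hg : Function.Surjective g) : minGens R M'' ≤ minGens R M :=
  LinearMap.finrank_le_finrank_of_surjective
    (f := AlgebraTensorModule.map (LinearMap.id (R := ResidueField R) (M := ResidueField R)) g)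
    (LinearMap.lTensor_surjective (ResidueField R) hg)

theorem minGens_of_free [Module.Free R M] : minGens R M = Module.finrank R M :=
  Module.finrank_baseChange

theorem minGens_pi (n : ℕ) : minGens R (Fin n → R) = n := by
  rw [minGens_of_free, Module.finrank_fin_fun]

/-- By Nakayama's lemma, lifts of a basis of the fibre generate. -/
theorem exists_surjective_of_minGens (M : Type u) [AddCommGroup M] [Module R M]
    [Module.Finite R M] : ∃ g : (Fin (minGens R M) → R) →ₗ[R] M, Function.Surjective g := by
  let b : Module.Basis (Fin (minGens R M)) _ _ :=
    Module.finBasis (ResidueField R) (ResidueField R ⊗[R] M)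
  have hs : Function.Surjective (TensorProduct.mk R (ResidueField R) M 1) :=
    TensorProduct.mk_surjective R M _ IsLocalRing.residue_surjective
  choose v hv using fun i : Fin (minGens R M) => hs (b i)
  have hspan : Submodule.span R (Set.range v) = ⊤ :=
    IsLocalRing.span_eq_top_of_tmul_eq_basis v b hv
  exact ⟨Fintype.linearCombination R v, by
    rw [← LinearMap.range_eq_top, Fintype.range_linearCombination, hspan]⟩

variable [IsNoetherianRing R]

/-- The kernel of a minimal presentation has as many generators as the first Betti number. -/
theorem minGens_ker_of_minimal [Module.Finite R M] (g : (Fin (minGens R M) → R) →ₗ[R] M)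
    (hg : Function.Surjective g) : minGens R (LinearMap.ker g) = betti (ModuleCat.of R M) 1 := by
  have h := betti_one_add (LinearMap.ker g).subtype g (LinearMap.exact_subtype_ker_map g)
    (Submodule.subtype_injective _) hg
  rw [minGens_pi] at h
  omega

/-- This is what the end of the long exact sequence of Tor yields. With `p` a minimal cover of `M`,
the kernels of `p`, `g ∘ₗ p` and `g` form an exact sequence, and the first two are counted by Betti
numbers. The module `M'` only has to surject onto `ker g`. -/
theorem betti_one_add_minGens_le [Module.Finite R M] [Module.Finite R M'] [Module.Finite R M'']
    (f : M' →ₗ[R] M) (g : M →ₗ[R] M'') (h : Function.Exact f g) (hg : Function.Surjective g) :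
    betti (ModuleCat.of R M'') 1 + minGens R M ≤
      betti (ModuleCat.of R M) 1 + minGens R M' + minGens R M'' := by
  obtain ⟨p, hp⟩ := exists_surjective_of_minGens (R := R) M
  have h1 := minGens_ker_of_minimal p hp
  have hgp : Function.Surjective (g ∘ₗ p) := hg.comp hp
  have h2 := betti_one_add (LinearMap.ker (g ∘ₗ p)).subtype (g ∘ₗ p)
    (LinearMap.exact_subtype_ker_map _) (Submodule.subtype_injective _) hgp
  rw [minGens_pi] at h2
  let i : LinearMap.ker p →ₗ[R] LinearMap.ker (g ∘ₗ p) :=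
    Submodule.inclusion (LinearMap.ker_le_ker_comp p g)
  let j : LinearMap.ker (g ∘ₗ p) →ₗ[R] LinearMap.ker g :=
    (p ∘ₗ (LinearMap.ker (g ∘ₗ p)).subtype).codRestrict _ fun x => x.2
  have hj : Function.Surjective j := by
    rintro ⟨y, hy⟩
    obtain ⟨x, rfl⟩ := hp y
    exact ⟨⟨x, hy⟩, rfl⟩
  have hij : Function.Exact i j := by
    rintro ⟨x, hx⟩
    constructor
    · intro h0
      exact ⟨⟨x, congrArg Subtype.val h0⟩, rfl⟩
    · rintro ⟨y, hy⟩
      rw [← hy]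
      exact Subtype.ext y.2
  have h3 := length_ker_lTensor i j hij hj
  have h4 : minGens R (LinearMap.ker (g ∘ₗ p)) ≤
      minGens R (LinearMap.ker p) + minGens R (LinearMap.ker g) := by
    have : (minGens R (LinearMap.ker (g ∘ₗ p)) : ℕ∞) ≤
        (minGens R (LinearMap.ker p) + minGens R (LinearMap.ker g) : ℕ) := by
      rw [← h3]
      exact le_add_self
    exact_mod_cast this
  have h5 : minGens R (LinearMap.ker g) ≤ minGens R M' := by
    refine minGens_le_of_surjective (f.codRestrict _ fun x => h.apply_apply_eq_zero x) ?_
    rintro ⟨y, hy⟩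
    obtain ⟨x, rfl⟩ := (h y).1 hy
    exact ⟨x, rfl⟩
  omega

/-- The bound comes from the exact sequence `Tor₁(k, M'') → k ⊗ M' → k ⊗ M → k ⊗ M'' → 0`.
Concretely, `M' ≅ ker g` is a quotient of the kernel of a free cover of `M''` that factors through a
minimal cover of `M`. -/
theorem minGens_add_minGens_le [Module.Finite R M] [Module.Finite R M'] [Module.Finite R M'']
    (f : M' →ₗ[R] M) (g : M →ₗ[R] M'') (h : Function.Exact f g) (hf : Function.Injective f)
    (hg : Function.Surjective g) :
    minGens R M' + minGens R M'' ≤ betti (ModuleCat.of R M'') 1 + minGens R M := by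
  obtain ⟨p, hp⟩ := exists_surjective_of_minGens (R := R) M
  have hgp : Function.Surjective (g ∘ₗ p) := hg.comp hp
  have h2 := betti_one_add (LinearMap.ker (g ∘ₗ p)).subtype (g ∘ₗ p)
    (LinearMap.exact_subtype_ker_map _) (Submodule.subtype_injective _) hgp
  rw [minGens_pi] at h2
  let j : LinearMap.ker (g ∘ₗ p) →ₗ[R] LinearMap.ker g :=
    (p ∘ₗ (LinearMap.ker (g ∘ₗ p)).subtype).codRestrict _ fun x => x.2
  have hj : Function.Surjective j := by
    rintro ⟨y, hy⟩
    obtain ⟨x, rfl⟩ := hp y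
    exact ⟨⟨x, hy⟩, rfl⟩
  have e : M' ≃ₗ[R] LinearMap.ker g :=
    LinearEquiv.ofBijective (f.codRestrict _ fun x => h.apply_apply_eq_zero x) (by
      constructor
      · intro x y hxy
        exact hf (congrArg Subtype.val hxy)
      · rintro ⟨y, hy⟩
        obtain ⟨x, rfl⟩ := (h y).1 hy
        exact ⟨x, rfl⟩)
  have h3 := minGens_le_of_surjective j hj
  rw [minGens_eq_of_equiv e]
  omega

end Betti

/-! ### Partial Euler numbers -/

section EulerNumber

open IsLocalRing

variable {R : Type u} [CommRing R] [IsLocalRing R] [IsNoetherianRing R] [IsDomain R]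
  {M M' M'' : Type u} [AddCommGroup M] [Module R M] [AddCommGroup M'] [Module R M']
  [AddCommGroup M''] [Module R M'']

theorem finrank_add_finrank_of_exact [Module.Finite R M] (f : M' →ₗ[R] M) (g : M →ₗ[R] M'')
    (h : Function.Exact f g) (hf : Function.Injective f) (hg : Function.Surjective g) :
    Module.finrank R M' + Module.finrank R M'' = Module.finrank R M := by
  have h1 := Submodule.finrank_quotient_add_finrank (LinearMap.range f)
  have e1 := (LinearEquiv.ofInjective f hf).finrank_eq
  have e2 := (h.linearEquivOfSurjective hg).finrank_eq
  omega

theorem finrank_le_minGens (M : Type u) [AddCommGroup M] [Module R M] [Module.Finite R M] :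
    Module.finrank R M ≤ minGens R M := by
  obtain ⟨g, hg⟩ := exists_surjective_of_minGens (R := R) M
  have h := LinearMap.finrank_le_finrank_of_surjective hg
  rwa [Module.finrank_fin_fun] at h

/-- The right-hand side is the excess of generators over rank of the first syzygy, i.e. the rank of
the second one. It makes the nonnegativity of `χ₂` visible, and its vanishing when the first syzygy
is free. -/
theorem betti_one_sub_minGens_add_finrank [Module.Finite R M]
    (g : (Fin (minGens R M) → R) →ₗ[R] M) (hg : Function.Surjective g) :
    (betti (ModuleCat.of R M) 1 : ℤ) - minGens R M + Module.finrank R M =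
      minGens R (LinearMap.ker g) - Module.finrank R (LinearMap.ker g) := by
  have h1 := minGens_ker_of_minimal g hg
  have h2 := finrank_add_finrank_of_exact (LinearMap.ker g).subtype g
    (LinearMap.exact_subtype_ker_map g) (Submodule.subtype_injective _) hg
  rw [Module.finrank_fin_fun] at h2
  omega

theorem betti_one_sub_minGens_add_finrank_nonneg (M : Type u) [AddCommGroup M] [Module R M]
    [Module.Finite R M] :
    0 ≤ (betti (ModuleCat.of R M) 1 : ℤ) - minGens R M + Module.finrank R M := by
  obtain ⟨g, hg⟩ := exists_surjective_of_minGens (R := R) M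
  rw [betti_one_sub_minGens_add_finrank g hg]
  have := finrank_le_minGens (R := R) (LinearMap.ker g)
  omega

theorem hasProjectiveDimensionLT_ker [Module.Projective R M] (g : M →ₗ[R] M'')
    (hg : Function.Surjective g) (n : ℕ) :
    HasProjectiveDimensionLT (ModuleCat.of R M'') (n + 2) ↔
      HasProjectiveDimensionLT (ModuleCat.of R (LinearMap.ker g)) (n + 1) :=
  (shortExact_shortComplexOf (LinearMap.ker g).subtype g (LinearMap.exact_subtype_ker_map g)
    (Submodule.subtype_injective _) hg).hasProjectiveDimensionLT_X₃_iff n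
      ((IsProjective.iff_projective _).1 (inferInstanceAs (Module.Projective R M)))

theorem free_of_hasProjectiveDimensionLT_one [Module.Finite R M]
    (h : HasProjectiveDimensionLT (ModuleCat.of R M) 1) : Module.Free R M := by
  have : Module.Projective R M :=
    (IsProjective.iff_projective _).2 (projective_iff_hasProjectiveDimensionLT_one.2 h)
  exact Module.free_of_flat_of_isLocalRing

/-- Over a Noetherian local domain, the alternating sum of the Betti numbers of a finite module
of finite projective dimension is the rank. -/
theorem sum_betti_eq_finrank (n : ℕ) (M : Type u) [AddCommGroup M] [Module R M]
    [Module.Finite R M] (h : HasProjectiveDimensionLT (ModuleCat.of R M) (n + 1)) :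
    (∀ j, n < j → betti (ModuleCat.of R M) j = 0) ∧
      ∑ j ∈ Finset.range (n + 1), (-1 : ℤ) ^ j * betti (ModuleCat.of R M) j =
        Module.finrank R M := by
  induction n generalizing M with
  | zero =>
    have := free_of_hasProjectiveDimensionLT_one h
    constructor
    · intro j hj
      obtain ⟨j, rfl⟩ := Nat.exists_eq_succ_of_ne_zero hj.ne'
      exact betti_succ_of_projective j
    · simp [betti_zero (ModuleCat.of R M), minGens_of_free]
  | succ n ih =>
    obtain ⟨g, hg⟩ := exists_surjective_of_minGens (R := R) M
    have hK := (hasProjectiveDimensionLT_ker g hg n).1 h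
    obtain ⟨h1, h2⟩ := ih _ hK
    have hs := betti_succ_succ (LinearMap.ker g).subtype g (LinearMap.exact_subtype_ker_map g)
      (Submodule.subtype_injective _) hg
    -- Passing to the syzygy shifts Betti numbers by one; from degree one to degree zero this needs
    -- the minimality of the cover.
    have hs1 : ∀ j, betti (ModuleCat.of R M) (j + 1) =
        betti (ModuleCat.of R (LinearMap.ker g)) j := by
      intro j
      obtain _ | j := j
      · rw [betti_zero, ← minGens_ker_of_minimal g hg]
      · exact hs j
    constructor
    · intro j hj
      obtain ⟨j, rfl⟩ := Nat.exists_eq_succ_of_ne_zero (Nat.ne_zero_of_lt hj)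
      rw [hs1]
      exact h1 j (by omega)
    · rw [Finset.sum_range_succ']
      have h3 := finrank_add_finrank_of_exact (LinearMap.ker g).subtype g
        (LinearMap.exact_subtype_ker_map g) (Submodule.subtype_injective _) hg
      rw [Module.finrank_fin_fun] at h3
      have h4 : ∑ k ∈ Finset.range (n + 1), (-1 : ℤ) ^ (k + 1) * betti (ModuleCat.of R M) (k + 1) =
          - Module.finrank R (LinearMap.ker g) := by
        rw [← h2, ← Finset.sum_neg_distrib]
        refine Finset.sum_congr rfl fun k _ => ?_
        rw [hs1]
        ring
      rw [h4, betti_zero]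
      simp only [pow_zero, one_mul]
      omega

/-- For finite projective dimension the full alternating sum is the rank, so removing the terms of
degrees zero and one leaves the expression of the other case. Both branches of the definition agree.
-/
theorem chiTwo_eq (M : ModuleCat.{u} R) [Module.Finite R M] :
    chiTwo M = (betti M 1 : ℤ) - minGens R M + Module.finrank R M := by
  unfold chiTwo
  split_ifs with h
  · obtain ⟨n, hn⟩ := (projectiveDimension_ne_top_iff M).1 h
    -- The bound is raised by one so that the sum always contains the terms of degrees zero and one.
    have hn' : HasProjectiveDimensionLT (ModuleCat.of R M) (n + 1 + 1) :=
      hasProjectiveDimensionLT_of_ge M (n + 1) (n + 2) (by omega)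
    obtain ⟨h1, h2⟩ := sum_betti_eq_finrank (n + 1) M hn'
    change ∀ j, n + 1 < j → betti M j = 0 at h1
    change ∑ j ∈ Finset.range (n + 1 + 1), (-1 : ℤ) ^ j * betti M j = _ at h2
    have hsub : (Function.support fun j : ℕ =>
        if 2 ≤ j then (-1 : ℤ) ^ j * (betti M j : ℤ) else 0) ⊆ Finset.range (n + 2) := by
      intro j hj
      rw [Finset.coe_range, Set.mem_Iio]
      by_contra hlt
      apply hj
      simp [h1 j (by omega)]
    rw [finsum_eq_sum_of_support_subset _ hsub, ← h2, Finset.sum_range_succ', Finset.sum_range_succ',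
      Finset.sum_range_succ', Finset.sum_range_succ', betti_zero M]
    simp
  · rw [betti_zero, genRank]

theorem chiTwo_nonneg (M : ModuleCat.{u} R) [Module.Finite R M] : 0 ≤ chiTwo M := by
  rw [chiTwo_eq]
  exact betti_one_sub_minGens_add_finrank_nonneg M

/-- The first syzygy of a minimal cover is free, so it has as many generators as its rank. -/
theorem chiTwo_eq_zero (M : ModuleCat.{u} R) [Module.Finite R M]
    (h : HasProjectiveDimensionLE M 1) : chiTwo M = 0 := by
  rw [chiTwo_eq]
  obtain ⟨g, hg⟩ := exists_surjective_of_minGens (R := R) M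
  refine (betti_one_sub_minGens_add_finrank g hg).trans ?_
  have := free_of_hasProjectiveDimensionLT_one ((hasProjectiveDimensionLT_ker g hg 0).1 h)
  rw [minGens_of_free, sub_self]

end EulerNumber

/-! ### Fitting ideals and the height bound for finite modules -/

section Fitting

open TensorProduct IsLocalRing

/-- The presentation remains right exact over `K`, and rank–nullity applies. -/
theorem finrank_tensor_add_rank {R K M : Type*} [CommRing R] [Field K] [Algebra R K]
    [AddCommGroup M] [Module R M] {p q : ℕ} (f : (Fin q → R) →ₗ[R] (Fin p → R))
    (g : (Fin p → R) →ₗ[R] M) (h : Function.Exact f g) (hg : Function.Surjective g) :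
    Module.finrank K (K ⊗[R] M) + ((LinearMap.toMatrix' f).map (algebraMap R K)).rank = p := by
  have h1 := LinearMap.finrank_range_add_finrank_ker (g.baseChange K)
  have h2 : Function.Surjective (g.baseChange K) := LinearMap.lTensor_surjective K hg
  have h3 : LinearMap.ker (g.baseChange K) = LinearMap.range (f.baseChange K) := by
    ext x
    exact (lTensor_exact K h hg) x
  rw [LinearMap.range_eq_top.2 h2, finrank_top, h3,
    Module.finrank_eq_card_basis ((Pi.basisFun R (Fin p)).baseChange K), Fintype.card_fin] at h1
  rw [Matrix.rank_eq_finrank_range_toLin _ (Algebra.TensorProduct.basis K (Pi.basisFun R (Fin p)))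
    (Algebra.TensorProduct.basis K (Pi.basisFun R (Fin q)))]
  refine Eq.trans ?_ h1
  have h4 := LinearMap.toMatrix_baseChange (A := K) f (Pi.basisFun R (Fin q)) (Pi.basisFun R (Fin p))
  have h5 : LinearMap.toMatrix (Pi.basisFun R (Fin q)) (Pi.basisFun R (Fin p)) f =
      LinearMap.toMatrix' f := by
    ext i j
    simp [LinearMap.toMatrix_apply, LinearMap.toMatrix'_apply]
  rw [h5] at h4
  rw [← h4, Matrix.toLin_toMatrix]

theorem exists_presentation (R : Type*) [CommRing R] [IsNoetherianRing R] {M : Type*}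
    [AddCommGroup M] [Module R M] {p : ℕ} (g : (Fin p → R) →ₗ[R] M) :
    ∃ (q : ℕ) (f : (Fin q → R) →ₗ[R] (Fin p → R)), Function.Exact f g := by
  obtain ⟨q, f', hf'⟩ := Module.Finite.exists_fin' R (LinearMap.ker g)
  refine ⟨q, (LinearMap.ker g).subtype ∘ₗ f', ?_⟩
  rw [LinearMap.exact_iff, LinearMap.range_comp, LinearMap.range_eq_top.2 hf', Submodule.map_top,
    Submodule.range_subtype]

/-- The dimension of a fibre only depends on the kernel of the map to the field. -/
theorem finrank_tensor_eq_of_ker_eq {R K K' M : Type*} [CommRing R] [IsNoetherianRing R] [Field K]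
    [Field K'] [Algebra R K] [Algebra R K'] [AddCommGroup M] [Module R M] [Module.Finite R M]
    (h : RingHom.ker (algebraMap R K) = RingHom.ker (algebraMap R K')) :
    Module.finrank K (K ⊗[R] M) = Module.finrank K' (K' ⊗[R] M) := by
  obtain ⟨p, g, hg⟩ := Module.Finite.exists_fin' R M
  obtain ⟨q, f, hf⟩ := exists_presentation R g
  have h1 := finrank_tensor_add_rank (K := K) f g hf hg
  have h2 := finrank_tensor_add_rank (K := K') f g hf hg
  -- The two ranks are compared through the minors that avoid the common kernel.
  have h3 : ∀ t, t ≤ ((LinearMap.toMatrix' f).map (algebraMap R K)).rank ↔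
      t ≤ ((LinearMap.toMatrix' f).map (algebraMap R K')).rank := by
    intro t
    rw [← hasMinorOutside_iff_le_rank _ h, ← hasMinorOutside_iff_le_rank _ rfl]
  have h4 := (h3 _).1 le_rfl
  have h5 := (h3 _).2 le_rfl
  omega

variable {R : Type u} [CommRing R] [IsLocalRing R]

/-- If the Fitting ideal is the unit ideal, one of its generating minors is a unit. Its `k` rows are
relations among `k + j` generators that are independent over the residue field, so the fibre has
dimension at most `j`. -/
theorem fittingIdeal_ne_top_iff (M : ModuleCat.{u} R) [Module.Finite R M] (j : ℕ) :
    fittingIdeal R M j ≠ ⊤ ↔ j < minGens R M := by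
  rw [← not_le, not_iff_not]
  constructor
  · intro h
    unfold fittingIdeal at h
    have : ∃ a ∈ {a : R | ∃ (k : ℕ) (v : Fin (k + j) → M) (e : Fin k → Fin (k + j))
        (r : Fin k → Fin (k + j) → R),
        Submodule.span R (Set.range v) = ⊤ ∧ (∀ s, ∑ j, r s j • v j = 0) ∧
        a = Matrix.det (Matrix.of fun s t => r s (e t))}, a ∉ maximalIdeal R := by
      by_contra! hno
      have := Ideal.span_le.2 hno
      rw [h] at this
      exact (maximalIdeal.isMaximal R).ne_top (top_le_iff.1 this)
    obtain ⟨a, ⟨k, v, e, r, hv, hr, ha⟩, ham⟩ := this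
    let K := ResidueField R
    let φ : (Fin (k + j) → K) →ₗ[K] K ⊗[R] M := Fintype.linearCombination K fun i => 1 ⊗ₜ v i
    have hφ : Function.Surjective φ := by
      rw [← LinearMap.range_eq_top, Fintype.range_linearCombination]
      have hb := Submodule.baseChange_span (R := R) (A := K) (Set.range v)
      rw [hv, Submodule.baseChange_top] at hb
      rw [hb, ← Set.range_comp]
      rfl
    let w : Fin k → Fin (k + j) → K := fun s i => residue R (r s i)
    have hw : ∀ s, w s ∈ LinearMap.ker φ := by
      intro s
      rw [LinearMap.mem_ker, Fintype.linearCombination_apply]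
      have h1 : ∀ i, w s i • (1 : K) ⊗ₜ[R] v i = (1 : K) ⊗ₜ[R] (r s i • v i) := by
        intro i
        rw [TensorProduct.tmul_smul, ← IsScalarTower.algebraMap_smul K]
        rfl
      simp_rw [h1]
      rw [← TensorProduct.tmul_sum, hr, TensorProduct.tmul_zero]
    have hlin : LinearIndependent K w := by
      have h1 : LinearIndependent K
          ((Matrix.of fun s t => r s (e t)).map (residue R)).row := by
        rw [Matrix.linearIndependent_rows_iff_isUnit, Matrix.isUnit_iff_isUnit_det]
        have h2 : ((Matrix.of fun s t => r s (e t)).map (residue R)).det = residue R a := by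
          rw [ha, RingHom.map_det]
          rfl
        rw [h2, isUnit_iff_ne_zero]
        rwa [Ne, residue_eq_zero_iff]
      exact LinearIndependent.of_comp (LinearMap.funLeft K K e) h1
    have h3 : k ≤ Module.finrank K (LinearMap.ker φ) := by
      have h4 : LinearIndependent K fun s => (⟨w s, hw s⟩ : LinearMap.ker φ) :=
        LinearIndependent.of_comp (LinearMap.ker φ).subtype hlin
      simpa using h4.fintype_card_le_finrank
    have h5 := LinearMap.finrank_range_add_finrank_ker φ
    rw [LinearMap.range_eq_top.2 hφ, finrank_top, Module.finrank_fin_fun] at h5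
    change Module.finrank K (K ⊗[R] M) ≤ j
    omega
  · intro h
    obtain ⟨g, hg⟩ := exists_surjective_of_minGens (R := R) M
    -- A minimal set of generators is padded with zeros to `j` elements; with `k = 0` the
    -- determinant is empty, hence `1`.
    let c : Fin (minGens R M) → Fin (0 + j) := Fin.castLE (by omega)
    let g' : (Fin (0 + j) → R) →ₗ[R] M := g ∘ₗ LinearMap.funLeft R R c
    have hg' : Function.Surjective g' :=
      hg.comp (LinearMap.funLeft_surjective_of_injective R R c (Fin.castLE_injective _))
    rw [Ideal.eq_top_iff_one]
    refine Ideal.subset_span ⟨0, fun i => g' (Pi.basisFun R _ i), Fin.elim0, Fin.elim0, ?_,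
      fun s => s.elim0, by simp⟩
    rw [show (fun i => g' (Pi.basisFun R _ i)) = g' ∘ Pi.basisFun R _ from rfl, Set.range_comp,
      ← Submodule.map_span, (Pi.basisFun R _).span_eq, Submodule.map_top,
      LinearMap.range_eq_top.2 hg']

/-- A minimal presentation matrix has `β₀` rows and `β₁` columns, and the fibre dimension exceeds
`j` exactly where all minors of size `β₀ - j` vanish. By hypothesis the maximal ideal is the only
prime of this kind, so the determinantal bound applies. -/
theorem height_maximalIdeal_le [IsNoetherianRing R] (M : ModuleCat.{u} R) [Module.Finite R M]
    {j : ℕ} (hj : j < minGens R M)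
    (h : ∀ Q : Ideal R, ∀ _ : Q.IsPrime, Q ≠ maximalIdeal R →
      Module.finrank Q.ResidueField (Q.ResidueField ⊗[R] M) ≤ j) :
    (maximalIdeal R).height ≤ ((j + 1) * (betti M 1 + j + 1 - minGens R M) : ℕ) := by
  obtain ⟨g, hg⟩ := exists_surjective_of_minGens (R := R) M
  have hK := minGens_ker_of_minimal g hg
  obtain ⟨f', hf'⟩ := exists_surjective_of_minGens (R := R) (LinearMap.ker g)
  let f := (LinearMap.ker g).subtype ∘ₗ f'
  have hfg : Function.Exact f g := by
    rw [LinearMap.exact_iff, LinearMap.range_comp, LinearMap.range_eq_top.2 hf', Submodule.map_top,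
      Submodule.range_subtype]
  have key : ∀ (Q : Ideal R) [Q.IsPrime],
      HasMinorOutside (LinearMap.toMatrix' f) (minGens R M - j) Q ↔
        Module.finrank Q.ResidueField (Q.ResidueField ⊗[R] M) ≤ j := by
    intro Q _
    rw [hasMinorOutside_iff_le_rank _ Q.ker_algebraMap_residueField]
    have := finrank_tensor_add_rank (K := Q.ResidueField) f g hfg hg
    omega
  have hmax : Module.finrank (maximalIdeal R).ResidueField
      ((maximalIdeal R).ResidueField ⊗[R] M) = minGens R M := by
    refine finrank_tensor_eq_of_ker_eq ?_
    rw [Ideal.ker_algebraMap_residueField]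
    exact IsLocalRing.ker_residue.symm
  have hb := height_le_of_minimal_minors (LinearMap.toMatrix' f) (t := minGens R M - j)
    (maximalIdeal R) (by rw [key, hmax]; omega) (by
      intro Q hQ hlt
      rw [key]
      exact h Q hQ hlt.ne)
  rw [hK] at hb
  refine hb.trans ?_
  have e1 : minGens R M + 1 - (minGens R M - j) = j + 1 := by omega
  have e2 : betti (ModuleCat.of R M) 1 + 1 - (minGens R M - j) =
    betti M 1 + j + 1 - minGens R M := by
    change betti M 1 + 1 - (minGens R M - j) = _
    omega
  rw [e1, e2]

end Fitting

/-! ### Derivations and differentials in a tower `R → A → B` -/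

section Tower

open TensorProduct KaehlerDifferential

variable (R A B : Type u) [CommRing R] [CommRing A] [CommRing B] [Algebra R A] [Algebra A B]
  [Algebra R B] [IsScalarTower R A B]

/-- The image of `B ⊗ Ω_{A/R} → Ω_{B/R}`. -/
abbrev imageKaehler : Submodule B (Ω[B⁄R]) := LinearMap.range (mapBaseChange R A B)

/-- Every derivation from `A` to `B` over `R` kills the kernel of `B ⊗ Ω_{A/R} → Ω_{B/R}`. -/
def DerivationsKillKernel : Prop :=
  ∀ (D : Derivation R A B) (z : B ⊗[A] Ω[A⁄R]), mapBaseChange R A B z = 0 →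
    D.liftKaehlerDifferential.liftBaseChange B z = 0

/-- The kernel is the image of the first cotangent homology of `B` over `A`, which vanishes for
formally smooth algebras. -/
theorem mapBaseChange_injective_of_formallySmooth [Algebra.FormallySmooth A B] :
    Function.Injective (mapBaseChange R A B) := by
  rw [injective_iff_map_eq_zero]
  intro x hx
  obtain ⟨x, rfl⟩ := (Algebra.H1Cotangent.exact_δ_mapBaseChange R A B x).mp hx
  rw [Subsingleton.elim x 0, map_zero]

variable {R A B}

theorem kaehler_hom_ext {N : Type*} [AddCommGroup N] [Module B N] {φ ψ : Ω[B⁄R] →ₗ[B] N}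
    (h : ∀ b, φ (D R B b) = ψ (D R B b)) : φ = ψ := by
  apply LinearMap.ext_on_range (span_range_derivation R B) h

theorem tensor_kaehler_hom_ext {N : Type*} [AddCommGroup N] [Module B N]
    {φ ψ : B ⊗[A] Ω[A⁄R] →ₗ[B] N} (h : ∀ a, φ (1 ⊗ₜ D R A a) = ψ (1 ⊗ₜ D R A a)) : φ = ψ := by
  have h1 := Submodule.baseChange_span (R := A) (A := B) (Set.range (D R A))
  rw [span_range_derivation, Submodule.baseChange_top, ← Set.range_comp] at h1
  exact LinearMap.ext_on_range h1.symm h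

theorem liftBaseChange_one_tmul_D (d : Derivation R A B) (a : A) :
    d.liftKaehlerDifferential.liftBaseChange B (1 ⊗ₜ D R A a) = d a := by
  rw [LinearMap.liftBaseChange_tmul, one_smul, Derivation.liftKaehlerDifferential_comp_D]

theorem mapBaseChange_one_tmul_D (a : A) :
    mapBaseChange R A B (1 ⊗ₜ D R A a) = D R B (algebraMap A B a) := by
  rw [mapBaseChange_tmul, one_smul, map_D]

/-- The kernel dies in `K ⊗ Ω_{A/R}`, because over `K` the map of differentials is injective. A
derivation to `B` induces a form on that module, and `B` embeds into `K`. With `K` a fraction field,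
this is how generic smoothness enters. -/
theorem derivationsKillKernel_of_formallySmooth (K : Type u) [CommRing K] [Algebra B K]
    [Algebra A K] [Algebra R K] [IsScalarTower A B K] [IsScalarTower R B K] [IsScalarTower R A K]
    [Algebra.FormallySmooth A K] (hK : Function.Injective (algebraMap B K)) :
    DerivationsKillKernel R A B := by
  intro d z hz
  let τ : B ⊗[A] Ω[A⁄R] →ₗ[B] K ⊗[A] Ω[A⁄R] :=
    AlgebraTensorModule.map (Algebra.linearMap B K) LinearMap.id
  have hτ : ∀ w, τ (1 ⊗ₜ w) = 1 ⊗ₜ w := by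
    intro w
    simp [τ]
  have h1 : (mapBaseChange R A K).restrictScalars B ∘ₗ τ =
      map R R B K ∘ₗ mapBaseChange R A B := by
    refine tensor_kaehler_hom_ext fun a => ?_
    simp only [LinearMap.comp_apply, LinearMap.restrictScalars_apply, hτ]
    rw [mapBaseChange_one_tmul_D, mapBaseChange_one_tmul_D, map_D,
      ← IsScalarTower.algebraMap_apply]
  let δ : K ⊗[A] Ω[A⁄R] →ₗ[K] K :=
    ((Algebra.linearMap B K).restrictScalars A ∘ₗ d.liftKaehlerDifferential).liftBaseChange K
  have h2 : δ.restrictScalars B ∘ₗ τ =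
      Algebra.linearMap B K ∘ₗ d.liftKaehlerDifferential.liftBaseChange B := by
    refine tensor_kaehler_hom_ext fun a => ?_
    simp only [LinearMap.comp_apply, LinearMap.restrictScalars_apply, hτ, δ]
    rw [LinearMap.liftBaseChange_tmul, liftBaseChange_one_tmul_D, one_smul]
    simp [Derivation.liftKaehlerDifferential_comp_D]
  have h3 : τ z = 0 := by
    apply mapBaseChange_injective_of_formallySmooth R A K
    have := LinearMap.congr_fun h1 z
    simp only [LinearMap.comp_apply, LinearMap.restrictScalars_apply, hz, map_zero] at this
    rw [this, map_zero]
  have h4 := LinearMap.congr_fun h2 z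
  simp only [LinearMap.comp_apply, h3, map_zero, Algebra.linearMap_apply] at h4
  exact hK (by rw [← h4, map_zero])

theorem D_algebraMap_mem_imageKaehler (a : A) : D R B (algebraMap A B a) ∈ imageKaehler R A B :=
  ⟨1 ⊗ₜ D R A a, mapBaseChange_one_tmul_D a⟩

/-- A linear form on the image of `B ⊗ Ω_{A/R} → Ω_{B/R}` defines a derivation. -/
def derivationOfHom {N : Type*} [AddCommGroup N] [Module A N] [Module B N] [Module R N]
    [IsScalarTower A B N] [IsScalarTower R A N] [IsScalarTower R B N] :
    (imageKaehler R A B →ₗ[B] N) →ₗ[B] Derivation R A N where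
  toFun φ :=
    { toLinearMap := (φ.restrictScalars A ∘ₗ
        ((mapBaseChange R A B).rangeRestrict.restrictScalars A ∘ₗ
          TensorProduct.mk A B (Ω[A⁄R]) 1)).restrictScalars R ∘ₗ (D R A).toLinearMap
      map_one_eq_zero' := by simp
      leibniz' := by
        intro a a'
        simp only [LinearMap.comp_apply, LinearMap.restrictScalars_apply, Derivation.coeFn_coe,
          Derivation.leibniz, map_add]
        simp only [← LinearMap.restrictScalars_apply A (mapBaseChange R A B).rangeRestrict, map_smul]
        simp only [← LinearMap.restrictScalars_apply A φ, map_smul] }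
  map_add' φ ψ := by
    ext a
    simp
  map_smul' b φ := by
    ext a
    simp

theorem derivationOfHom_apply {N : Type*} [AddCommGroup N] [Module A N] [Module B N] [Module R N]
    [IsScalarTower A B N] [IsScalarTower R A N] [IsScalarTower R B N]
    (φ : imageKaehler R A B →ₗ[B] N) (a : A) :
    derivationOfHom φ a = φ ⟨D R B (algebraMap A B a), D_algebraMap_mem_imageKaehler a⟩ := by
  have : (mapBaseChange R A B).rangeRestrict (1 ⊗ₜ D R A a) =
      ⟨D R B (algebraMap A B a), D_algebraMap_mem_imageKaehler a⟩ :=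
    Subtype.ext (mapBaseChange_one_tmul_D a)
  rw [← this]
  rfl

theorem imageKaehler_hom_ext {N : Type*} [AddCommGroup N] [Module B N]
    {φ ψ : imageKaehler R A B →ₗ[B] N}
    (h : ∀ a, φ ⟨D R B (algebraMap A B a), D_algebraMap_mem_imageKaehler a⟩ =
      ψ ⟨D R B (algebraMap A B a), D_algebraMap_mem_imageKaehler a⟩) : φ = ψ := by
  have h1 : φ ∘ₗ (mapBaseChange R A B).rangeRestrict =
      ψ ∘ₗ (mapBaseChange R A B).rangeRestrict := by
    refine tensor_kaehler_hom_ext fun a => ?_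
    have : (mapBaseChange R A B).rangeRestrict (1 ⊗ₜ D R A a) =
        ⟨D R B (algebraMap A B a), D_algebraMap_mem_imageKaehler a⟩ :=
      Subtype.ext (mapBaseChange_one_tmul_D a)
    rw [LinearMap.comp_apply, LinearMap.comp_apply, this, h]
  ext y
  obtain ⟨x, rfl⟩ := (mapBaseChange R A B).surjective_rangeRestrict y
  exact LinearMap.congr_fun h1 x

/-- A derivation is a linear form on `B ⊗ Ω_{A/R}`; since it vanishes on the kernel, it descends to
the image. -/
theorem derivationOfHom_bijective (h : DerivationsKillKernel R A B) :
    Function.Bijective (derivationOfHom (R := R) (A := A) (B := B) (N := B)) := by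
  constructor
  · intro φ ψ hφψ
    refine imageKaehler_hom_ext fun a => ?_
    rw [← derivationOfHom_apply, ← derivationOfHom_apply, hφψ]
  · intro d
    let e := (mapBaseChange R A B).quotKerEquivRange
    let φ₀ := (LinearMap.ker (mapBaseChange R A B)).liftQ
      (d.liftKaehlerDifferential.liftBaseChange B) fun z hz => h d z hz
    refine ⟨φ₀ ∘ₗ e.symm.toLinearMap, ?_⟩
    ext a
    have h1 : (⟨D R B (algebraMap A B a), D_algebraMap_mem_imageKaehler a⟩ : imageKaehler R A B) =
        e (Submodule.Quotient.mk (1 ⊗ₜ D R A a)) :=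
      Subtype.ext (mapBaseChange_one_tmul_D a).symm
    rw [derivationOfHom_apply, LinearMap.comp_apply, h1, LinearEquiv.coe_coe,
      LinearEquiv.symm_apply_apply]
    exact liftBaseChange_one_tmul_D d a

/-- Derivations from `A` to `B` are the linear forms on the image of `B ⊗ Ω_{A/R} → Ω_{B/R}`. -/
def homEquivDerivation (h : DerivationsKillKernel R A B) :
    (imageKaehler R A B →ₗ[B] B) ≃ₗ[B] Derivation R A B :=
  LinearEquiv.ofBijective derivationOfHom (derivationOfHom_bijective h)

variable (R A B) in
/-- The restriction of linear forms on `Ω_{B/R}` to the image of `B ⊗ Ω_{A/R}`. -/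
def restrictHom : (Ω[B⁄R] →ₗ[B] B) →ₗ[B] (imageKaehler R A B →ₗ[B] B) :=
  LinearMap.lcomp B B (imageKaehler R A B).subtype

/-- This turns the tangent map into a map between duals, whose image and cokernel localize when the
modules are finitely presented. -/
theorem homEquivDerivation_restrictHom (h : DerivationsKillKernel R A B) (φ : Ω[B⁄R] →ₗ[B] B) :
    homEquivDerivation h (restrictHom R A B φ) =
      Derivation.compAlgebraMapL R A B B (linearMapEquivDerivation R B φ) := by
  ext a
  exact derivationOfHom_apply _ a

theorem map_homEquivDerivation (h : DerivationsKillKernel R A B) :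
    (LinearMap.range (restrictHom R A B)).map (homEquivDerivation h).toLinearMap =
      LinearMap.range (Derivation.compAlgebraMapL R A B B) := by
  rw [← LinearMap.range_comp]
  apply le_antisymm
  · rintro _ ⟨φ, rfl⟩
    exact ⟨_, (homEquivDerivation_restrictHom h φ).symm⟩
  · rintro _ ⟨d, rfl⟩
    refine ⟨d.liftKaehlerDifferential, ?_⟩
    refine (homEquivDerivation_restrictHom h _).trans ?_
    congr 1
    exact (linearMapEquivDerivation R B).apply_symm_apply d

/-- The image of the tangent map, as a module of linear forms. -/
def rangeEquiv (h : DerivationsKillKernel R A B) :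
    LinearMap.range (restrictHom R A B) ≃ₗ[B]
      LinearMap.range (Derivation.compAlgebraMapL R A B B) :=
  (homEquivDerivation h).submoduleMap _ ≪≫ₗ LinearEquiv.ofEq _ _ (map_homEquivDerivation h)

/-- The cokernel of the tangent map, as a quotient of a module of linear forms. -/
def cokernelEquiv (h : DerivationsKillKernel R A B) :
    ((imageKaehler R A B →ₗ[B] B) ⧸ LinearMap.range (restrictHom R A B)) ≃ₗ[B]
      (Derivation R A B ⧸ LinearMap.range (Derivation.compAlgebraMapL R A B B)) :=
  Submodule.Quotient.equiv _ _ (homEquivDerivation h) (map_homEquivDerivation h)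

/-- If the sequence of differentials splits, then derivations extend. -/
theorem exists_derivation_extension (h : DerivationsKillKernel R A B)
    [Module.Projective B (Ω[B⁄A])] (d : Derivation R A B) :
    ∃ e : Derivation R B B, ∀ a, e (algebraMap A B a) = d a := by
  obtain ⟨s, hs⟩ := (KaehlerDifferential.map R A B B).exists_rightInverse_of_surjective
    (LinearMap.range_eq_top.2 (KaehlerDifferential.map_surjective R A B))
  have hs' : ∀ y, KaehlerDifferential.map R A B B (s y) = y := LinearMap.congr_fun hs
  -- The section gives a retraction onto the image, along which linear forms extend.
  let ρ : Ω[B⁄R] →ₗ[B] imageKaehler R A B :=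
    (LinearMap.id - s ∘ₗ KaehlerDifferential.map R A B B).codRestrict _ fun x => by
      rw [imageKaehler, range_mapBaseChange, LinearMap.mem_ker]
      simp [hs']
  have hρ : ∀ x : imageKaehler R A B, ρ x = x := by
    rintro ⟨x, hx⟩
    have hx' : KaehlerDifferential.map R A B B x = 0 := by
      rwa [imageKaehler, range_mapBaseChange, LinearMap.mem_ker] at hx
    apply Subtype.ext
    simp [ρ, hx']
  refine ⟨linearMapEquivDerivation R B ((homEquivDerivation h).symm d ∘ₗ ρ), fun a => ?_⟩
  have h1 := hρ ⟨D R B (algebraMap A B a), D_algebraMap_mem_imageKaehler a⟩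
  change (homEquivDerivation h).symm d (ρ (D R B (algebraMap A B a))) = d a
  rw [h1, ← derivationOfHom_apply]
  exact congrArg (fun d : Derivation R A B => d a) ((homEquivDerivation h).apply_symm_apply d)

/-- If derivations extend and `Ω_{B/R}` and the image of `B ⊗ Ω_{A/R}` are projective, then
`Ω_{B/A}` is projective. -/
theorem projective_of_derivation_extension [Module.Projective B (Ω[B⁄R])]
    [Module.Free B (imageKaehler R A B)] [Module.Finite B (imageKaehler R A B)]
    (h : ∀ d : Derivation R A B, ∃ e : Derivation R B B, ∀ a, e (algebraMap A B a) = d a) :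
    Module.Projective B (Ω[B⁄A]) := by
  let b := Module.Free.chooseBasis B (imageKaehler R A B)
  -- Each coordinate form of the image corresponds to a derivation, which extends by hypothesis. The
  -- extended forms assemble to a retraction.
  have h1 : ∀ i, ∃ φ : Ω[B⁄R] →ₗ[B] B, φ ∘ₗ (imageKaehler R A B).subtype = b.coord i := by
    intro i
    obtain ⟨e, he⟩ := h (derivationOfHom (b.coord i))
    refine ⟨e.liftKaehlerDifferential, imageKaehler_hom_ext fun a => ?_⟩
    rw [← derivationOfHom_apply (b.coord i), ← he a, LinearMap.comp_apply, Submodule.subtype_apply,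
      Derivation.liftKaehlerDifferential_comp_D]
  choose φ hφ using h1
  let ρ : Ω[B⁄R] →ₗ[B] imageKaehler R A B := ∑ i, (φ i).smulRight (b i)
  have hρ : ∀ x : imageKaehler R A B, ρ x = x := by
    intro x
    have h2 : ∀ i, φ i x = b.repr x i := fun i => LinearMap.congr_fun (hφ i) x
    simp only [ρ, LinearMap.sum_apply, LinearMap.smulRight_apply, h2]
    exact b.sum_repr x
  have hker : LinearMap.ker (KaehlerDifferential.map R A B B) ≤
      LinearMap.ker (LinearMap.id - (imageKaehler R A B).subtype ∘ₗ ρ) := by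
    intro x hx
    rw [← range_mapBaseChange] at hx
    have := congrArg Subtype.val (hρ ⟨x, hx⟩)
    simp only [LinearMap.mem_ker, LinearMap.sub_apply, LinearMap.id_apply, LinearMap.comp_apply,
      Submodule.subtype_apply]
    exact sub_eq_zero.2 this.symm
  let q := (KaehlerDifferential.map R A B B).quotKerEquivOfSurjective (KaehlerDifferential.map_surjective R A B)
  let s : Ω[B⁄A] →ₗ[B] Ω[B⁄R] := (LinearMap.ker (KaehlerDifferential.map R A B B)).liftQ _ hker ∘ₗ
    q.symm.toLinearMap
  refine Module.Projective.of_split s (KaehlerDifferential.map R A B B) ?_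
  refine LinearMap.ext fun y => ?_
  obtain ⟨x, rfl⟩ := KaehlerDifferential.map_surjective R A B y
  have h3 : q.symm (KaehlerDifferential.map R A B B x) = Submodule.Quotient.mk x := by
    rw [LinearEquiv.symm_apply_eq]
    rfl
  have h4 : KaehlerDifferential.map R A B B (ρ x : Ω[B⁄R]) = 0 :=
    ((exact_mapBaseChange_map R A B) _).2 (ρ x).2
  simp [s, h3, h4]

/-- If `Ω_{A/R}` is free and derivations kill the kernel of `B ⊗ Ω_{A/R} → Ω_{B/R}`,
then this map is injective. -/
theorem mapBaseChange_injective (h : DerivationsKillKernel R A B) [Module.Free A (Ω[A⁄R])] :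
    Function.Injective (mapBaseChange R A B) := by
  rw [injective_iff_map_eq_zero]
  intro z hz
  let b := (Module.Free.chooseBasis A (Ω[A⁄R])).baseChange B
  apply b.ext_elem
  intro i
  rw [map_zero, Finsupp.zero_apply, ← Module.Basis.coord_apply]
  -- A coordinate of the base-changed basis is itself given by a derivation, so it vanishes on the
  -- kernel.
  let d : Derivation R A B :=
    ((b.coord i).restrictScalars A ∘ₗ TensorProduct.mk A B (Ω[A⁄R]) 1).compDer (D R A)
  have : d.liftKaehlerDifferential.liftBaseChange B = b.coord i := by
    refine tensor_kaehler_hom_ext fun a => ?_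
    rw [liftBaseChange_one_tmul_D]
    rfl
  rw [← this]
  exact h d z hz

end Tower

/-! ### Localization of kernels, images and cokernels -/

section LocalizedSquare

variable {B B' : Type*} [CommRing B] [CommRing B'] [Algebra B B'] (b : Submonoid B)
  [IsLocalization b B'] {M N M' N' : Type*} [AddCommGroup M] [AddCommGroup N] [AddCommGroup M']
  [AddCommGroup N'] [Module B M] [Module B N] [Module B M'] [Module B N'] [Module B' M']
  [Module B' N'] [IsScalarTower B B' M'] [IsScalarTower B B' N'] (l : M →ₗ[B] M')
  (m : N →ₗ[B] N') [IsLocalizedModule b l] [IsLocalizedModule b m] (g : M →ₗ[B] N)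
  (g' : M' →ₗ[B'] N')

include b in
theorem extendScalars_map_eq (h : ∀ x, g' (l x) = m (g x)) :
    (IsLocalizedModule.map b l m g).extendScalarsOfIsLocalization b B' = g' := by
  have : IsLocalizedModule.map b l m g = g'.restrictScalars B := by
    apply IsLocalizedModule.ext b l (IsLocalizedModule.map_units m)
    ext x
    simp [h]
  ext x
  exact LinearMap.congr_fun this x

theorem exists_isLocalizedModule_ker (h : ∀ x, g' (l x) = m (g x)) :
    ∃ k : LinearMap.ker g →ₗ[B] LinearMap.ker g', IsLocalizedModule b k ∧
      ∀ x, (k x : M') = l x := by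
  have h1 : (LinearMap.ker g).localized' B' b l = LinearMap.ker g' := by
    rw [LinearMap.localized'_ker_eq_ker_localizedMap B' b l m g,
      extendScalars_map_eq b l m g g' h]
  exact ⟨((LinearEquiv.ofEq _ _ h1).restrictScalars B).toLinearMap ∘ₗ
    Submodule.toLocalized' B' b l (LinearMap.ker g), IsLocalizedModule.of_linearEquiv b _ _,
    fun x => rfl⟩

theorem exists_isLocalizedModule_range (h : ∀ x, g' (l x) = m (g x)) :
    ∃ k : LinearMap.range g →ₗ[B] LinearMap.range g', IsLocalizedModule b k ∧
      ∀ x, (k x : N') = m x := by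
  have h1 : (LinearMap.range g).localized' B' b m = LinearMap.range g' := by
    rw [LinearMap.localized'_range_eq_range_localizedMap B' b l m g,
      extendScalars_map_eq b l m g g' h]
  exact ⟨((LinearEquiv.ofEq _ _ h1).restrictScalars B).toLinearMap ∘ₗ
    Submodule.toLocalized' B' b m (LinearMap.range g), IsLocalizedModule.of_linearEquiv b _ _,
    fun x => rfl⟩

theorem exists_isLocalizedModule_cokernel (h : ∀ x, g' (l x) = m (g x)) :
    ∃ k : (N ⧸ LinearMap.range g) →ₗ[B] (N' ⧸ LinearMap.range g'), IsLocalizedModule b k ∧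
      ∀ x, k (Submodule.Quotient.mk x) = Submodule.Quotient.mk (m x) := by
  have h1 : (LinearMap.range g).localized' B' b m = LinearMap.range g' := by
    rw [LinearMap.localized'_range_eq_range_localizedMap B' b l m g,
      extendScalars_map_eq b l m g g' h]
  exact ⟨((Submodule.quotEquivOfEq _ _ h1).restrictScalars B).toLinearMap ∘ₗ
    Submodule.toLocalizedQuotient' B' b m (LinearMap.range g),
    IsLocalizedModule.of_linearEquiv b _ _, fun x => rfl⟩

-- Finite presentation makes the formation of the dual commute with localization.
include b in
theorem exists_isLocalizedModule_hom [Module.FinitePresentation B M] :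
    ∃ H : (M →ₗ[B] B) →ₗ[B] (M' →ₗ[B'] B'), IsLocalizedModule b H ∧
      ∀ φ x, H φ (l x) = algebraMap B B' (φ x) :=
  have hB : IsLocalizedModule b (Algebra.linearMap B B') := inferInstance
  ⟨IsLocalizedModule.mapExtendScalars b l (Algebra.linearMap B B') B', inferInstance,
    fun φ x => by simp⟩

end LocalizedSquare

/-! ### Localization of differentials and of their duals in a tower -/

section LocalizedTower

open TensorProduct KaehlerDifferential

section Base

variable (R R' B B' : Type u) [CommRing R] [CommRing R'] [CommRing B] [CommRing B'] [Algebra R B]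
  [Algebra R' B'] [Algebra R R'] [Algebra B B'] [Algebra R B'] [IsScalarTower R B B']
  [IsScalarTower R R' B'] (b : Submonoid B) [IsLocalization b B']

/-- Differentials commute with localization, also of the base ring. -/
theorem isLocalizedModule_kaehler [Algebra.FormallyUnramified R R'] :
    IsLocalizedModule b (map R R' B B') := by
  -- The kernel comes from `Ω_{R'/R}`, which vanishes because `R'` is formally unramified over `R`.
  -- Hence replacing the base `R` by `R'` does not change the differentials of `B'`.
  have hinj : Function.Injective (map R R' B' B') := by
    rw [injective_iff_map_eq_zero]
    intro x hx
    obtain ⟨z, rfl⟩ := (exact_mapBaseChange_map R R' B' x).1 hx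
    rw [Subsingleton.elim z 0, map_zero]
  let e := LinearEquiv.ofBijective (map R R' B' B')
    ⟨hinj, KaehlerDifferential.map_surjective R R' B'⟩
  have h1 : IsLocalizedModule b (map R R B B') := inferInstance
  have h2 : (e.restrictScalars B).toLinearMap ∘ₗ map R R B B' = map R R' B B' :=
    kaehler_hom_ext fun x => by
      have h3 : e (map R R B B' (D R B x)) = map R R' B' B' (map R R B B' (D R B x)) := rfl
      rw [map_D, map_D, Algebra.algebraMap_self_apply] at h3
      exact (congrArg e (map_D R R B B' x)).trans (h3.trans (map_D R R' B B' x).symm)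
  rw [← h2]
  exact IsLocalizedModule.of_linearEquiv b _ _

include b in
/-- Derivations extend to localizations. -/
theorem exists_derivation_localization [Algebra.FormallyUnramified R R'] (d : Derivation R B B) :
    ∃ d' : Derivation R' B' B', ∀ x, d' (algebraMap B B' x) = algebraMap B B' (d x) := by
  have := isLocalizedModule_kaehler R R' B B' b
  have hB : IsLocalizedModule b (Algebra.linearMap B B') := inferInstance
  let φ := IsLocalizedModule.mapExtendScalars b (map R R' B B') (Algebra.linearMap B B') B'
    d.liftKaehlerDifferential
  refine ⟨linearMapEquivDerivation R' B' φ, fun x => ?_⟩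
  have h1 : φ (D R' B' (algebraMap B B' x)) = Algebra.linearMap B B' (d x) := by
    have h2 : φ (map R R' B B' (D R B x)) =
        Algebra.linearMap B B' (d.liftKaehlerDifferential (D R B x)) :=
      IsLocalizedModule.map_apply b (map R R' B B') (Algebra.linearMap B B') _ _
    rwa [map_D, Derivation.liftKaehlerDifferential_comp_D] at h2
  exact h1

end Base

variable (R R' A A' B B' : Type u) [CommRing R] [CommRing R'] [CommRing A] [CommRing A']
  [CommRing B] [CommRing B'] [Algebra R A] [Algebra A B] [Algebra R B] [IsScalarTower R A B]
  [Algebra R' A'] [Algebra A' B'] [Algebra R' B'] [IsScalarTower R' A' B'] [Algebra R R']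
  [Algebra A A'] [Algebra B B'] [Algebra R A'] [IsScalarTower R A A'] [IsScalarTower R R' A']
  [Algebra R B'] [IsScalarTower R B B'] [IsScalarTower R R' B'] [Algebra A B']
  [IsScalarTower A B B'] [IsScalarTower A A' B'] (b : Submonoid B) [IsLocalization b B']
  [Algebra.FormallyUnramified R R'] [Algebra.FormallyUnramified A A']

/-- The image is the kernel of `Ω_{B/R} → Ω_{B/A}`, and both of these modules localize; the module
`Ω_{A/R}` need not be considered. -/
theorem exists_isLocalizedModule_imageKaehler :
    ∃ k : imageKaehler R A B →ₗ[B] imageKaehler R' A' B', IsLocalizedModule b k ∧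
      ∀ x, (k x : Ω[B'⁄R']) = map R R' B B' x := by
  have h1 := isLocalizedModule_kaehler R R' B B' b
  have h2 := isLocalizedModule_kaehler A A' B B' b
  obtain ⟨k, hk, hk'⟩ := exists_isLocalizedModule_ker b (map R R' B B') (map A A' B B')
    (map R A B B) (map R' A' B' B') (fun x => by
      have : (map R' A' B' B').restrictScalars B ∘ₗ map R R' B B' =
          map A A' B B' ∘ₗ map R A B B := kaehler_hom_ext fun x => by simp
      exact LinearMap.congr_fun this x)
  let e := LinearEquiv.ofEq _ _ (range_mapBaseChange R A B)
  let e' := LinearEquiv.ofEq _ _ (range_mapBaseChange R' A' B').symm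
  exact ⟨(e'.restrictScalars B).toLinearMap ∘ₗ k ∘ₗ e.toLinearMap,
    haveI := IsLocalizedModule.of_linearEquiv_right b k e
    IsLocalizedModule.of_linearEquiv b (k ∘ₗ e.toLinearMap) (e'.restrictScalars B),
    fun x => hk' _⟩

/-- The restriction of linear forms to the image of `B ⊗ Ω_{A/R}` commutes with localization. -/
theorem exists_isLocalizedModule_restrictHom [IsNoetherianRing B] [Module.Finite B (Ω[B⁄R])] :
    ∃ (H : (Ω[B⁄R] →ₗ[B] B) →ₗ[B] (Ω[B'⁄R'] →ₗ[B'] B'))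
      (k : imageKaehler R A B →ₗ[B] imageKaehler R' A' B')
      (G : (imageKaehler R A B →ₗ[B] B) →ₗ[B] (imageKaehler R' A' B' →ₗ[B'] B')),
      IsLocalizedModule b H ∧ IsLocalizedModule b k ∧ IsLocalizedModule b G ∧
      (∀ x, (k x : Ω[B'⁄R']) = map R R' B B' x) ∧
      (∀ φ x, G φ (k x) = algebraMap B B' (φ x)) ∧
      ∀ φ, restrictHom R' A' B' (H φ) = G (restrictHom R A B φ) := by
  have h1 := isLocalizedModule_kaehler R R' B B' b
  obtain ⟨k, hk, hk'⟩ := exists_isLocalizedModule_imageKaehler R R' A A' B B' b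
  have := Module.finitePresentation_of_finite B (Ω[B⁄R])
  -- The image is finite as a submodule of `Ω_{B/R}` over a Noetherian ring.
  have := Module.finitePresentation_of_finite B (imageKaehler R A B)
  obtain ⟨H, hH, hH'⟩ := exists_isLocalizedModule_hom b (B' := B') (map R R' B B')
  obtain ⟨G, hG, hG'⟩ := exists_isLocalizedModule_hom b (B' := B') k
  refine ⟨H, k, G, hH, hk, hG, hk', hG', fun φ => ?_⟩
  have h2 : ((restrictHom R' A' B' (H φ)).restrictScalars B) ∘ₗ k =
      (G (restrictHom R A B φ)).restrictScalars B ∘ₗ k := by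
    ext x
    rw [LinearMap.comp_apply, LinearMap.comp_apply, LinearMap.restrictScalars_apply,
      LinearMap.restrictScalars_apply, hG']
    change H φ (k x : Ω[B'⁄R']) = algebraMap B B' (φ x)
    rw [hk', hH']
  have h3 := IsLocalizedModule.ext b k
    (IsLocalizedModule.map_units (Algebra.linearMap B B')) h2
  ext x
  exact LinearMap.congr_fun h3 x

end LocalizedTower

/-! ### Localizing charts at points -/

section Charts

variable {X Y S : Scheme.{u}}

attribute [local instance] stalkAlg stalkAlgOver stalkTower

theorem exists_chart_le (π : X ⟶ Y) (f : Y ⟶ S) (x : X) (O : X.Opens) (hO : x ∈ O) :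
    ∃ c : Chart π f, x ∈ c.U ∧ c.U ≤ O := by
  obtain ⟨W, hW, hxW, -⟩ := exists_isAffineOpen_mem_and_subset (U := ⊤) (x := f (π x)) trivial
  obtain ⟨V, hV, hxV, hVW⟩ := exists_isAffineOpen_mem_and_subset (U := f ⁻¹ᵁ W) (x := π x) hxW
  obtain ⟨U, hU, hxU, hUV⟩ := exists_isAffineOpen_mem_and_subset (U := π ⁻¹ᵁ V ⊓ O) (x := x)
    ⟨hxV, hO⟩
  exact ⟨⟨U, V, W, hU, hV, hW, fun y hy => (hUV hy).1, hVW⟩, hxU, fun y hy => (hUV hy).2⟩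

theorem exists_chart (π : X ⟶ Y) (f : Y ⟶ S) (x : X) : ∃ c : Chart π f, x ∈ c.U := by
  obtain ⟨c, hc, -⟩ := exists_chart_le π f x ⊤ trivial
  exact ⟨c, hc⟩

namespace Chart

variable {π : X ⟶ Y} {f : Y ⟶ S} (c : Chart π f)

/-- The prime ideal of a point of the chart. -/
abbrev prime (x : c.U) : Ideal c.B := (c.affineU.primeIdealOf x).asIdeal

instance algStalkB (x : c.U) : Algebra c.B (Loc X x.1) :=
  (X.presheaf.germ c.U x.1 x.2).hom.toAlgebra

instance algStalkA (x : c.U) : Algebra c.A (Loc Y (π x.1)) :=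
  (Y.presheaf.germ c.V (π x.1) (c.leUV x.2)).hom.toAlgebra

instance algStalkR (x : c.U) : Algebra c.R (Loc S (f (π x.1))) :=
  (S.presheaf.germ c.W (f (π x.1)) (c.leVW (c.leUV x.2))).hom.toAlgebra

instance algStalkRA (x : c.U) : Algebra c.R (Loc Y (π x.1)) :=
  ((algebraMap c.A (Loc Y (π x.1))).comp (algebraMap c.R c.A)).toAlgebra

instance algStalkAB (x : c.U) : Algebra c.A (Loc X x.1) :=
  ((algebraMap c.B (Loc X x.1)).comp (algebraMap c.A c.B)).toAlgebra

instance algStalkRB (x : c.U) : Algebra c.R (Loc X x.1) :=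
  ((algebraMap c.B (Loc X x.1)).comp (algebraMap c.R c.B)).toAlgebra

instance (x : c.U) : IsScalarTower c.R c.A (Loc Y (π x.1)) :=
  IsScalarTower.of_algebraMap_eq fun _ => rfl

instance (x : c.U) : IsScalarTower c.A c.B (Loc X x.1) :=
  IsScalarTower.of_algebraMap_eq fun _ => rfl

instance (x : c.U) : IsScalarTower c.R c.B (Loc X x.1) :=
  IsScalarTower.of_algebraMap_eq fun _ => rfl

theorem germ_appLE_comm {X Y : Scheme.{u}} (π : X ⟶ Y) {V : Y.Opens} {U : X.Opens}
    (h : U ≤ π ⁻¹ᵁ V) (x : X) (hx : x ∈ U) (a : Γ(Y, V)) :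
    X.presheaf.germ U x hx (π.appLE V U h a) = π.stalkMap x (Y.presheaf.germ V (π x) (h hx) a) := by
  refine Eq.trans ?_ (Scheme.Hom.germ_stalkMap_apply π V x (h hx) a).symm
  rw [Scheme.Hom.appLE, CommRingCat.comp_apply]
  exact TopCat.Presheaf.germ_res_apply X.presheaf (homOfLE h) x hx _

instance towerStalkRRA (x : c.U) : IsScalarTower c.R (Loc S (f (π x.1))) (Loc Y (π x.1)) :=
  IsScalarTower.of_algebraMap_eq fun r => germ_appLE_comm f c.leVW (π x.1) (c.leUV x.2) r

instance towerStalkAAB (x : c.U) : IsScalarTower c.A (Loc Y (π x.1)) (Loc X x.1) :=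
  IsScalarTower.of_algebraMap_eq fun a => germ_appLE_comm π c.leUV x.1 x.2 a

instance towerStalkRRB (x : c.U) : IsScalarTower c.R (Loc S (f (π x.1))) (Loc X x.1) :=
  IsScalarTower.of_algebraMap_eq fun r => by
    rw [IsScalarTower.algebraMap_apply c.R c.B (Loc X x.1),
      IsScalarTower.algebraMap_apply c.R c.A c.B,
      ← IsScalarTower.algebraMap_apply c.A c.B (Loc X x.1),
      IsScalarTower.algebraMap_apply c.A (Loc Y (π x.1)) (Loc X x.1),
      ← IsScalarTower.algebraMap_apply c.R c.A (Loc Y (π x.1)),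
      IsScalarTower.algebraMap_apply c.R (Loc S (f (π x.1))) (Loc Y (π x.1)),
      ← IsScalarTower.algebraMap_apply (Loc S (f (π x.1))) (Loc Y (π x.1)) (Loc X x.1)]

instance isLocalizationB' (x : c.U) : IsLocalization (c.prime x).primeCompl (Loc X x.1) :=
  c.affineU.isLocalization_stalk x

instance isLocalizationA (x : c.U) :
    IsLocalization (c.affineV.primeIdealOf ⟨π x.1, c.leUV x.2⟩).asIdeal.primeCompl
      (Loc Y (π x.1)) :=
  c.affineV.isLocalization_stalk ⟨π x.1, c.leUV x.2⟩

instance isLocalizationR (x : c.U) :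
    IsLocalization (c.affineW.primeIdealOf ⟨f (π x.1), c.leVW (c.leUV x.2)⟩).asIdeal.primeCompl
      (Loc S (f (π x.1))) :=
  c.affineW.isLocalization_stalk ⟨f (π x.1), c.leVW (c.leUV x.2)⟩

instance unramifiedA (x : c.U) : Algebra.FormallyUnramified c.A (Loc Y (π x.1)) :=
  Algebra.FormallyUnramified.of_isLocalization
    (c.affineV.primeIdealOf ⟨π x.1, c.leUV x.2⟩).asIdeal.primeCompl

instance unramifiedR (x : c.U) : Algebra.FormallyUnramified c.R (Loc S (f (π x.1))) :=
  Algebra.FormallyUnramified.of_isLocalization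
    (c.affineW.primeIdealOf ⟨f (π x.1), c.leVW (c.leUV x.2)⟩).asIdeal.primeCompl

instance noetherianB [IsLocallyNoetherian X] : IsNoetherianRing c.B :=
  IsLocallyNoetherian.component_noetherian ⟨c.U, c.affineU⟩

theorem finite_kaehler [LocallyOfFiniteType π] : Module.Finite c.B (Ω[c.B⁄c.A]) := by
  have h : (algebraMap c.A c.B).FiniteType := π.finiteType_appLE c.affineV c.affineU c.leUV
  rw [RingHom.finiteType_algebraMap] at h
  infer_instance

theorem algebraMap_eq_appLE :
    algebraMap c.R c.B = ((π ≫ f).appLE c.W c.U (c.leUV.trans (fun _ hx => c.leVW hx))).hom := by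
  rw [← Scheme.Hom.appLE_comp_appLE (U := c.W) (V := c.V) (W := c.U) (e₁ := c.leVW) (e₂ := c.leUV)]
  rfl

theorem isDomain [IsIntegral X] (x : c.U) : IsDomain c.B :=
  haveI : Nonempty c.U := ⟨x⟩
  inferInstance

end Chart

theorem coherentDifferentials_of_locallyOfFiniteType (π : X ⟶ Y) (f : Y ⟶ S)
    [LocallyOfFiniteType (π ≫ f)] : CoherentDifferentials π f := by
  intro c
  have h : (algebraMap c.R c.B).FiniteType := by
    rw [c.algebraMap_eq_appLE]
    exact (π ≫ f).finiteType_appLE c.affineW c.affineU _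
  rw [RingHom.finiteType_algebraMap] at h
  infer_instance

end Charts

/-! ### Formal smoothness at the generic point -/

section GenericSmoothness

attribute [local instance] stalkAlg stalkAlgOver stalkTower

/-- `B₁` stands for the sections over a smaller open set where smoothness is known. Its fraction
ring is a localization of it, and any two fraction rings of `B` are isomorphic over `B`. -/
theorem formallySmooth_of_isFractionRing {A B B₁ K K' : Type*} [CommRing A] [CommRing B]
    [CommRing B₁] [CommRing K] [CommRing K'] [Algebra A B] [Algebra A B₁] [Algebra A K]
    [Algebra A K'] [Algebra B B₁] [Algebra B K] [Algebra B K'] [Algebra B₁ K]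
    [IsScalarTower A B K'] [IsScalarTower A B K] [IsScalarTower A B₁ K]
    [IsScalarTower B B₁ K] [IsFractionRing B K'] [IsFractionRing B K] [IsFractionRing B₁ K]
    [Algebra.FormallySmooth A B₁] : Algebra.FormallySmooth A K' := by
  have h1 : Algebra.FormallySmooth B₁ K :=
    Algebra.FormallySmooth.of_isLocalization (nonZeroDivisors B₁)
  have h2 : Algebra.FormallySmooth A K := Algebra.FormallySmooth.comp A B₁ K
  let e : K ≃ₐ[B] K' := IsLocalization.algEquiv (nonZeroDivisors B) K K'
  exact Algebra.FormallySmooth.of_equiv (e.restrictScalars A)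

variable {X Y S : Scheme.{u}} {π : X ⟶ Y} {f : Y ⟶ S}

theorem isIso_presheaf_map_of_eq {D D' : X.Opens} (h : D' = D) (i : D' ⟶ D) :
    IsIso (X.presheaf.map i.op) := by
  subst h
  rw [Subsingleton.elim i (𝟙 D')]
  infer_instance

theorem GenericallySmooth.exists_basicOpen [IsIntegral X] (hπ : GenericallySmooth π)
    (c : Chart π f) (x : c.U) :
    ∃ s : c.B, genericPoint X ∈ X.basicOpen s ∧
      (π.appLE c.V (X.basicOpen s) ((X.basicOpen_le s).trans c.leUV)).hom.Smooth := by
  obtain ⟨U, hU, hs⟩ := hπ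
  have hξ : genericPoint X ∈ c.U :=
    ((genericPoint_spec X).mem_open_set_iff c.U.isOpen).mpr ⟨x.1, trivial, x.2⟩
  obtain ⟨s, hsU, hξs⟩ := c.affineU.exists_basicOpen_le (V := U) ⟨genericPoint X, hU⟩ hξ
  refine ⟨s, hξs, ?_⟩
  set D := X.basicOpen s
  have hD : D ≤ π ⁻¹ᵁ c.V := (X.basicOpen_le s).trans c.leUV
  have h1 : Smooth (D.ι ≫ π) := by
    rw [← X.homOfLE_ι hsU, Category.assoc]
    infer_instance
  have hDa : IsAffineOpen D := c.affineU.basicOpen s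
  have : IsAffine D := hDa
  have h2 := (D.ι ≫ π).smooth_appLE c.affineV (isAffineOpen_top (D : Scheme.{u}))
    (by rw [← Scheme.Opens.ι_preimage_self]; exact fun y hy => hD hy)
  -- The ring map of `D.ι ≫ π` differs from that of `π` only by the isomorphism between sections of
  -- `X` over `D` and global sections of `D`.
  have e1 : (⊤ : (D : Scheme.{u}).Opens) ≤ D.ι ⁻¹ᵁ D := by rw [Scheme.Opens.ι_preimage_self]
  have h3 : IsIso (D.ι.appLE D ⊤ e1) := by
    rw [Scheme.Opens.ι_appLE]
    exact isIso_presheaf_map_of_eq (by simp) _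
  rw [← Scheme.Hom.appLE_comp_appLE (U := c.V) (V := D) (W := ⊤) (e₁ := hD) (e₂ := e1),
    CommRingCat.hom_comp, RingHom.Smooth.respectsIso.cancel_right_isIso] at h2
  exact h2

theorem GenericallySmooth.formallySmooth_chart [IsIntegral X] (hπ : GenericallySmooth π)
    (c : Chart π f) (x : c.U) (K : Type*) [CommRing K] [Algebra c.A K] [Algebra c.B K]
    [IsScalarTower c.A c.B K] [IsFractionRing c.B K] : Algebra.FormallySmooth c.A K := by
  obtain ⟨s, hs, hsm⟩ := hπ.exists_basicOpen c x
  have : Nonempty c.U := ⟨x⟩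
  have : Nonempty (X.basicOpen s) := ⟨_, hs⟩
  have := functionField_isFractionRing_of_isAffineOpen X c.U c.affineU
  have := functionField_isFractionRing_of_isAffineOpen X (X.basicOpen s) (c.affineU.basicOpen s)
  let B₁ : Type u := Γ(X, X.basicOpen s)
  let : Algebra c.B B₁ := (X.presheaf.map (homOfLE (X.basicOpen_le s)).op).hom.toAlgebra
  let : Algebra c.A B₁ :=
    (π.appLE c.V (X.basicOpen s) ((X.basicOpen_le s).trans c.leUV)).hom.toAlgebra
  have hsm' : Algebra.FormallySmooth c.A B₁ := hsm.formallySmooth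
  let : Algebra c.A X.functionField :=
    ((algebraMap c.B X.functionField).comp (algebraMap c.A c.B)).toAlgebra
  have : IsScalarTower c.A c.B X.functionField := IsScalarTower.of_algebraMap_eq fun _ => rfl
  have : IsScalarTower c.B B₁ X.functionField := IsScalarTower.of_algebraMap_eq fun b =>
    (TopCat.Presheaf.germ_res_apply X.presheaf (homOfLE (X.basicOpen_le s)) _ hs b).symm
  have : IsScalarTower c.A c.B B₁ := IsScalarTower.of_algebraMap_eq fun a => by
    change π.appLE c.V (X.basicOpen s) _ a =
      X.presheaf.map (homOfLE (X.basicOpen_le s)).op (π.appLE c.V c.U c.leUV a)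
    rw [← CommRingCat.comp_apply, Scheme.Hom.appLE_map]
  have : IsScalarTower c.A B₁ X.functionField := IsScalarTower.of_algebraMap_eq fun a => by
    rw [IsScalarTower.algebraMap_apply c.A c.B X.functionField,
      IsScalarTower.algebraMap_apply c.A c.B B₁,
      ← IsScalarTower.algebraMap_apply c.B B₁ X.functionField]
  exact formallySmooth_of_isFractionRing (B := c.B) (B₁ := B₁) (K := X.functionField)

theorem GenericallySmooth.derivationsKillKernel_chart [IsIntegral X] (hπ : GenericallySmooth π)
    (c : Chart π f) (x : c.U) : DerivationsKillKernel c.R c.A c.B := by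
  have := c.isDomain x
  have := hπ.formallySmooth_chart c x (FractionRing c.B)
  exact derivationsKillKernel_of_formallySmooth (FractionRing c.B)
    (IsFractionRing.injective c.B (FractionRing c.B))

/-- A fraction ring of the stalk is also one of the chart ring, and formal smoothness persists when
the base is replaced by its localization at `π x`. -/
theorem GenericallySmooth.formallySmooth_stalk [IsIntegral X] (hπ : GenericallySmooth π)
    (x : X) (K : Type*) [CommRing K] [Algebra (Loc Y (π x)) K] [Algebra (Loc X x) K]
    [IsScalarTower (Loc Y (π x)) (Loc X x) K] [IsFractionRing (Loc X x) K] :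
    Algebra.FormallySmooth (Loc Y (π x)) K := by
  obtain ⟨c, hc⟩ := exists_chart π (𝟙 Y) x
  obtain ⟨x', rfl⟩ : ∃ x' : c.U, x'.1 = x := ⟨⟨x, hc⟩, rfl⟩
  have := c.isDomain x'
  let : Algebra c.B K := ((algebraMap (Loc X x'.1) K).comp (algebraMap c.B (Loc X x'.1))).toAlgebra
  have t1 : IsScalarTower c.B (Loc X x'.1) K := IsScalarTower.of_algebraMap_eq fun _ => rfl
  let : Algebra c.A K := ((algebraMap c.B K).comp (algebraMap c.A c.B)).toAlgebra
  have t2 : IsScalarTower c.A c.B K := IsScalarTower.of_algebraMap_eq fun _ => rfl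
  have t3 : IsScalarTower c.A (Loc Y (π x'.1)) K := IsScalarTower.of_algebraMap_eq fun a => by
    rw [IsScalarTower.algebraMap_apply (Loc Y (π x'.1)) (Loc X x'.1) K, ← IsScalarTower.algebraMap_apply c.A (Loc Y (π x'.1)) (Loc X x'.1),
      IsScalarTower.algebraMap_apply c.A c.B (Loc X x'.1), ← IsScalarTower.algebraMap_apply c.B (Loc X x'.1) K,
      ← IsScalarTower.algebraMap_apply c.A c.B K]
  have : Nonempty c.U := ⟨x'⟩
  have := functionField_isFractionRing_of_isAffineOpen X c.U c.affineU
  have h1 : IsFractionRing c.B K :=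
    IsLocalization.isLocalization_of_algEquiv (nonZeroDivisors c.B)
      ((IsLocalization.algEquiv (nonZeroDivisors (Loc X x'.1)) X.functionField K).restrictScalars
        c.B)
  have := hπ.formallySmooth_chart c x' K
  exact Algebra.FormallySmooth.localization_base
    (c.affineV.primeIdealOf ⟨π x'.1, c.leUV x'.2⟩).asIdeal.primeCompl

theorem GenericallySmooth.derivationsKillKernel_stalk [IsIntegral X] (hπ : GenericallySmooth π)
    (f : Y ⟶ S) (x : X) : DerivationsKillKernel (Loc S (f (π x))) (Loc Y (π x)) (Loc X x) := by
  have := hπ.formallySmooth_stalk x (FractionRing (Loc X x))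
  exact derivationsKillKernel_of_formallySmooth (FractionRing (Loc X x))
    (IsFractionRing.injective (Loc X x) (FractionRing (Loc X x)))

end GenericSmoothness

/-! ### Coherent families of modules over the local rings -/

section Coherent

open TensorProduct IsLocalRing

/-- By right exactness a presentation stays one after any base change, so its two sizes bound the
Betti numbers of all stalks over a chart at once. -/
theorem betti_one_baseChange_le {R O N : Type u} [CommRing R] [CommRing O] [IsLocalRing O]
    [IsNoetherianRing O] [Algebra R O] [AddCommGroup N] [Module R N] {p q : ℕ}
    (f : (Fin q → R) →ₗ[R] (Fin p → R)) (g : (Fin p → R) →ₗ[R] N) (h : Function.Exact f g)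
    (hg : Function.Surjective g) :
    minGens O (O ⊗[R] N) ≤ p ∧ betti (ModuleCat.of O (O ⊗[R] N)) 1 ≤ q := by
  have hp : ∀ n : ℕ, minGens O (O ⊗[R] (Fin n → R)) = n := by
    intro n
    rw [minGens_of_free]
    rcases subsingleton_or_nontrivial R with hR | hR
    · have : Subsingleton O := RingHom.codomain_trivial (algebraMap R O)
      exact absurd ‹IsLocalRing O›.toNontrivial (not_nontrivial O)
    rw [Module.finrank_baseChange, Module.finrank_fin_fun]
  have hg' : Function.Surjective (g.baseChange O) := LinearMap.lTensor_surjective O hg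
  have hfg : Function.Exact (f.baseChange O) (g.baseChange O) := lTensor_exact O h hg
  have : Module.Finite R N := Module.Finite.of_surjective g hg
  have h1 := betti_one_add_minGens_le _ _ hfg hg'
  have h2 := minGens_le_of_surjective _ hg'
  rw [betti_succ_of_projective (M := O ⊗[R] (Fin p → R)), hp, hp] at h1
  rw [hp] at h2
  omega

variable {X : Scheme.{u}}

/-- The algebra structure on a local ring over the sections on a neighbourhood. -/
abbrev sectionsAlg (U : X.Opens) (x : U) : Algebra Γ(X, U) (Loc X x.1) :=
  (X.presheaf.germ U x.1 x.2).hom.toAlgebra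

attribute [local instance] sectionsAlg

/-- The modules `M x` are the stalks of a coherent module in a neighbourhood of each point. -/
def IsCoherentFamily (M : ∀ x : X, ModuleCat.{u} (Loc X x)) : Prop :=
  ∀ x : X, ∃ U : X.Opens, IsAffineOpen U ∧ x ∈ U ∧ ∃ N : ModuleCat.{u} Γ(X, U),
    Module.Finite Γ(X, U) N ∧
      ∀ x' : U, Nonempty (M x'.1 ≃ₗ[Loc X x'.1] Loc X x'.1 ⊗[Γ(X, U)] N)

variable {M : ∀ x : X, ModuleCat.{u} (Loc X x)}

theorem IsCoherentFamily.finite (hM : IsCoherentFamily M) (x : X) :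
    Module.Finite (Loc X x) (M x) := by
  obtain ⟨U, hU, hx, N, hN, h⟩ := hM x
  obtain ⟨e⟩ := h ⟨x, hx⟩
  exact Module.Finite.equiv e.symm

theorem IsCoherentFamily.exists_bound [IsNoetherian X] (hM : IsCoherentFamily M) :
    ∃ n : ℕ, ∀ x, minGens (Loc X x) (M x) ≤ n ∧ betti (M x) 1 ≤ n := by
  choose U hU hx N hN h using hM
  have h1 : ∀ x, ∃ n : ℕ, ∀ x' : U x, minGens (Loc X x'.1) (M x'.1) ≤ n ∧
      betti (M x'.1) 1 ≤ n := by
    intro x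
    have : IsNoetherianRing Γ(X, U x) := IsLocallyNoetherian.component_noetherian ⟨U x, hU x⟩
    have := hN x
    obtain ⟨p, g, hg⟩ := Module.Finite.exists_fin' Γ(X, U x) (N x)
    obtain ⟨q, f, hf⟩ := exists_presentation Γ(X, U x) g
    refine ⟨max p q, fun x' => ?_⟩
    obtain ⟨e⟩ := h x x'
    have h2 := betti_one_baseChange_le (O := Loc X x'.1) f g hf hg
    rw [minGens_eq_of_equiv e]
    have h3 : betti (M x'.1) 1 = _ := betti_eq_of_iso e.toModuleIso 1
    rw [h3]
    exact ⟨h2.1.trans (le_max_left _ _), h2.2.trans (le_max_right _ _)⟩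
  choose n hn using h1
  -- Quasi-compactness leaves finitely many charts, and the largest of their bounds is uniform.
  obtain ⟨t, ht⟩ := CompactSpace.isCompact_univ.elim_finite_subcover
    (fun x : X => (U x : Set X)) (fun x => (U x).isOpen)
    (fun x _ => Set.mem_iUnion.2 ⟨x, hx x⟩)
  refine ⟨t.sup n, fun x => ?_⟩
  obtain ⟨y, hy⟩ := Set.mem_iUnion.1 (ht (Set.mem_univ x))
  obtain ⟨hyt, hxy⟩ := Set.mem_iUnion.1 hy
  have := hn y ⟨x, hxy⟩
  exact ⟨this.1.trans (Finset.le_sup hyt), this.2.trans (Finset.le_sup hyt)⟩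

theorem finrank_tensor_of_isLocalization {R O N : Type*} [CommRing R] [CommRing O] [Algebra R O]
    (S : Submonoid R) (hS : S ≤ nonZeroDivisors R) [IsLocalization S O] [AddCommGroup N]
    [Module R N] : Module.finrank O (O ⊗[R] N) = Module.finrank R N :=
  (congrArg Cardinal.toNat (IsLocalization.rank_eq O S hS)).trans
    (IsLocalizedModule.finrank_eq S (TensorProduct.mk R O N 1) hS)

/-- A neighbourhood of `x` contains the generic point, and localizing a module over a domain
preserves its rank. -/
theorem IsCoherentFamily.genRank_eq [IsIntegral X] (hM : IsCoherentFamily M) (x : X) :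
    genRank (M x) = genRank (M (genericPoint X)) := by
  obtain ⟨U, hU, hx, N, hN, h⟩ := hM x
  have hξ : genericPoint X ∈ U :=
    ((genericPoint_spec X).mem_open_set_iff U.isOpen).mpr ⟨x, trivial, hx⟩
  have : Nonempty U := ⟨⟨x, hx⟩⟩
  have key : ∀ x' : U, genRank (M x'.1) = Module.finrank Γ(X, U) N := by
    intro x'
    obtain ⟨e⟩ := h x'
    have : IsLocalization (hU.primeIdealOf x').asIdeal.primeCompl (Loc X x'.1) :=
      hU.isLocalization_stalk x'
    rw [genRank, e.finrank_eq, finrank_tensor_of_isLocalization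
      (hU.primeIdealOf x').asIdeal.primeCompl (Ideal.primeCompl_le_nonZeroDivisors _)]
  exact (key ⟨x, hx⟩).trans (key ⟨_, hξ⟩).symm

/-- Away from the closed point the fibres of the stalk at a maximal point of the locus where the
fibre dimension jumps are small. -/
theorem IsCoherentFamily.finrank_residue_le [IsNoetherian X] (hM : IsCoherentFamily M) (j : ℕ)
    (x : X) (hx : x ∈ maxPoints {x | j < minGens (Loc X x) (M x)}) (Q : Ideal (Loc X x))
    [hQ : Q.IsPrime] (hQm : Q ≠ maximalIdeal (Loc X x)) :
    Module.finrank Q.ResidueField (Q.ResidueField ⊗[Loc X x] M x) ≤ j := by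
  obtain ⟨U, hU, hxU, N, hN, h⟩ := hM x
  have hnoeth : IsNoetherianRing Γ(X, U) := IsLocallyNoetherian.component_noetherian ⟨U, hU⟩
  obtain ⟨x₀, rfl⟩ : ∃ x₀ : U, x₀.1 = x := ⟨⟨x, hxU⟩, rfl⟩
  have hloc : IsLocalization (hU.primeIdealOf x₀).asIdeal.primeCompl (Loc X x₀.1) :=
    hU.isLocalization_stalk x₀
  obtain ⟨e⟩ := h x₀
  -- `Q` corresponds to a generization `y` of the point, different from it because `Q` is not
  -- maximal. As the point is maximal in the locus, `y` lies outside the locus.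
  let P : PrimeSpectrum Γ(X, U) := ⟨Q.comap (algebraMap Γ(X, U) (Loc X x₀.1)), inferInstance⟩
  have hPU : hU.fromSpec P ∈ U := by
    have := Set.mem_range_self (f := hU.fromSpec) P
    rwa [hU.range_fromSpec] at this
  obtain ⟨y, hyf⟩ : ∃ y : U, y.1 = hU.fromSpec P := ⟨⟨_, hPU⟩, rfl⟩
  have hyP : hU.primeIdealOf y = P := by
    apply hU.fromSpec.isOpenEmbedding.injective
    exact (hU.fromSpec_primeIdealOf y).trans hyf
  have hle : P ≤ hU.primeIdealOf x₀ := by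
    have := (IsLocalization.AtPrime.under_maximalIdeal (Loc X x₀.1) (hU.primeIdealOf x₀).asIdeal)
    change P.asIdeal ≤ _
    rw [← this]
    exact Ideal.comap_mono (IsLocalRing.le_maximalIdeal hQ.ne_top)
  have hspec : y.1 ⤳ x₀.1 := by
    have := ((PrimeSpectrum.le_iff_specializes _ _).1 hle).map hU.fromSpec.continuous
    rwa [hU.fromSpec_primeIdealOf, ← hyf] at this
  have hne : y.1 ≠ x₀.1 := by
    intro heq
    have : y = x₀ := Subtype.ext heq
    apply hQm
    rw [this] at hyP
    have h3 : Q.under Γ(X, U) = (maximalIdeal (Loc X x₀.1)).under Γ(X, U) := by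
      rw [IsLocalization.AtPrime.under_maximalIdeal (Loc X x₀.1) (hU.primeIdealOf x₀).asIdeal, hyP]
    rw [← IsLocalization.map_under (hU.primeIdealOf x₀).asIdeal.primeCompl (Loc X x₀.1) Q, h3,
      IsLocalization.map_under (hU.primeIdealOf x₀).asIdeal.primeCompl (Loc X x₀.1)]
  have hy : minGens (Loc X y.1) (M y.1) ≤ j := by
    by_contra! hlt
    exact hne (hx.2 _ hlt hspec)
  obtain ⟨e'⟩ := h y
  rw [minGens_eq_of_equiv e'] at hy
  have hloc' : IsLocalization.AtPrime (Loc X y.1) (hU.primeIdealOf y).asIdeal :=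
    hU.isLocalization_stalk y
  have e1 : ResidueField (Loc X y.1) ⊗[Loc X y.1] (Loc X y.1 ⊗[Γ(X, U)] N) ≃ₗ[ResidueField (Loc X y.1)]
      ResidueField (Loc X y.1) ⊗[Γ(X, U)] N :=
    AlgebraTensorModule.cancelBaseChange _ _ _ _ _
  have e2 : Q.ResidueField ⊗[Loc X x₀.1] (Loc X x₀.1 ⊗[Γ(X, U)] N) ≃ₗ[Q.ResidueField]
      Q.ResidueField ⊗[Γ(X, U)] N :=
    AlgebraTensorModule.cancelBaseChange _ _ _ _ _
  have e3 : Q.ResidueField ⊗[Loc X x₀.1] (M x₀.1) ≃ₗ[Q.ResidueField]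
      Q.ResidueField ⊗[Loc X x₀.1] (Loc X x₀.1 ⊗[Γ(X, U)] N) :=
    AlgebraTensorModule.congr (LinearEquiv.refl _ _) e
  rw [minGens, e1.finrank_eq] at hy
  rw [e3.finrank_eq, e2.finrank_eq]
  -- The residue fields of `Q` and of `y` belong to the same prime of the chart ring, so the fibres
  -- have equal dimension.
  refine le_trans (le_of_eq (finrank_tensor_eq_of_ker_eq ?_)) hy
  rw [IsScalarTower.algebraMap_eq Γ(X, U) (Loc X x₀.1) Q.ResidueField,
    IsScalarTower.algebraMap_eq Γ(X, U) (Loc X y.1) (ResidueField (Loc X y.1)),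
    ← RingHom.comap_ker, ← RingHom.comap_ker, Ideal.ker_algebraMap_residueField]
  change P.asIdeal = _
  rw [← hyP]
  have h4 : RingHom.ker (algebraMap (Loc X y.1) (ResidueField (Loc X y.1))) =
      maximalIdeal (Loc X y.1) := IsLocalRing.ker_residue
  rw [h4]
  exact (IsLocalization.AtPrime.under_maximalIdeal (Loc X y.1) (hU.primeIdealOf y).asIdeal).symm

/-- A bound for the height of a maximal point of the locus where the fibre dimension jumps. -/
theorem IsCoherentFamily.height_le [IsNoetherian X] (hM : IsCoherentFamily M) (j : ℕ) (x : X)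
    (hx : x ∈ maxPoints {x | j < minGens (Loc X x) (M x)}) :
    height x ≤ ((j + 1) * (betti (M x) 1 + j + 1 - minGens (Loc X x) (M x)) : ℕ) := by
  have hfin := hM.finite x
  have h1 := height_maximalIdeal_le (M x) hx.1
  have h2 : height x = (maximalIdeal (Loc X x)).height := by
    have := IsLocalRing.maximalIdeal_height_eq_ringKrullDim (R := Loc X x)
    rw [height, ← this]
    rfl
  rw [h2]
  exact h1 fun Q _ hQm => hM.finrank_residue_le j x hx Q hQm

end Coherent

/-! ### Coherence of the modules of differentials and derivations -/

section CoherentStalks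

open TensorProduct IsLocalRing

attribute [local instance] sectionsAlg stalkAlg stalkAlgOver stalkTower

theorem nonempty_equiv_tensor {B B' N N' : Type*} [CommRing B] [CommRing B'] [Algebra B B']
    (b : Submonoid B) [IsLocalization b B'] [AddCommGroup N] [AddCommGroup N'] [Module B N]
    [Module B N'] [Module B' N'] [IsScalarTower B B' N'] (l : N →ₗ[B] N')
    (hl : IsLocalizedModule b l) : Nonempty (N' ≃ₗ[B'] B' ⊗[B] N) :=
  ⟨(IsLocalizedModule.isBaseChange b B' l).equiv.symm⟩

theorem nonempty_equiv_tensor_range {B B' M N M' N' : Type*} [CommRing B] [CommRing B']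
    [Algebra B B'] (b : Submonoid B) [IsLocalization b B'] [AddCommGroup M] [AddCommGroup N]
    [AddCommGroup M'] [AddCommGroup N'] [Module B M] [Module B N] [Module B M'] [Module B N']
    [Module B' M'] [Module B' N'] [IsScalarTower B B' M'] [IsScalarTower B B' N'] (l : M →ₗ[B] M')
    (m : N →ₗ[B] N') (hl : IsLocalizedModule b l) (hm : IsLocalizedModule b m) (g : M →ₗ[B] N)
    (g' : M' →ₗ[B'] N') (h : ∀ x, g' (l x) = m (g x)) :
    Nonempty (LinearMap.range g' ≃ₗ[B'] B' ⊗[B] LinearMap.range g) := by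
  obtain ⟨k, hk, -⟩ := exists_isLocalizedModule_range b l m g g' h
  exact nonempty_equiv_tensor b k hk

variable {X Y S : Scheme.{u}}

theorem IsCoherentFamily.of_chart {π : X ⟶ Y} {f : Y ⟶ S} (M : ∀ x : X, ModuleCat.{u} (Loc X x))
    (h : ∀ c : Chart π f, ∃ (N : Type u) (_ : AddCommGroup N) (_ : Module c.B N),
      Module.Finite c.B N ∧ ∀ x : c.U, Nonempty (M x.1 ≃ₗ[Loc X x.1] Loc X x.1 ⊗[c.B] N)) :
    IsCoherentFamily M := by
  intro x
  obtain ⟨c, hc⟩ := exists_chart π f x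
  obtain ⟨N, _, _, hN, hx⟩ := h c
  exact ⟨c.U, c.affineU, hc, ModuleCat.of c.B N, hN, hx⟩

theorem isCoherentFamily_Omega (π : X ⟶ Y) [LocallyOfFiniteType π] :
    IsCoherentFamily (Omega π) := by
  refine IsCoherentFamily.of_chart (π := π) (f := 𝟙 Y) _ fun c =>
    ⟨Ω[c.B⁄c.A], inferInstance, inferInstance, c.finite_kaehler, fun x => ?_⟩
  have h := nonempty_equiv_tensor (B' := Loc X x.1) (c.prime x).primeCompl _
    (isLocalizedModule_kaehler c.A (Loc Y (π x.1)) c.B (Loc X x.1) (c.prime x).primeCompl)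
  exact h

variable {π : X ⟶ Y} {f : Y ⟶ S}

theorem CoherentDifferentials.isCoherentFamily_OmegaOver (hc : CoherentDifferentials π f) :
    IsCoherentFamily (OmegaOver π f) := by
  refine IsCoherentFamily.of_chart (π := π) (f := f) _ fun c =>
    ⟨Ω[c.B⁄c.R], inferInstance, inferInstance, hc c, fun x => ?_⟩
  have h := nonempty_equiv_tensor (B' := Loc X x.1) (c.prime x).primeCompl _
    (isLocalizedModule_kaehler c.R (Loc S (f (π x.1))) c.B (Loc X x.1) (c.prime x).primeCompl)
  exact h

variable [IsLocallyNoetherian X]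

theorem CoherentDifferentials.isCoherentFamily_ImageOmega (hc : CoherentDifferentials π f) :
    IsCoherentFamily (ImageOmega π f) := by
  refine IsCoherentFamily.of_chart (π := π) (f := f) _ fun c =>
    ⟨imageKaehler c.R c.A c.B, inferInstance, inferInstance, ?_, fun x => ?_⟩
  · have := hc c
    infer_instance
  · obtain ⟨k, hk, -⟩ := exists_isLocalizedModule_imageKaehler c.R (Loc S (f (π x.1))) c.A
      (Loc Y (π x.1)) c.B (Loc X x.1) (c.prime x).primeCompl
    have h := nonempty_equiv_tensor (B' := Loc X x.1) (c.prime x).primeCompl k hk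
    exact h

theorem CoherentDifferentials.isCoherentFamily_TangentOver (hc : CoherentDifferentials π f) :
    IsCoherentFamily (TangentOver π f) := by
  refine IsCoherentFamily.of_chart (π := π) (f := f) _ fun c =>
    ⟨Ω[c.B⁄c.R] →ₗ[c.B] c.B, inferInstance, inferInstance, ?_, fun x => ?_⟩
  · have := hc c
    infer_instance
  · have := hc c
    obtain ⟨H, k, G, hH, -⟩ := exists_isLocalizedModule_restrictHom c.R (Loc S (f (π x.1))) c.A
      (Loc Y (π x.1)) c.B (Loc X x.1) (c.prime x).primeCompl
    obtain ⟨e⟩ := nonempty_equiv_tensor (B' := Loc X x.1) (c.prime x).primeCompl H hH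
    exact ⟨(KaehlerDifferential.linearMapEquivDerivation (Loc S (f (π x.1))) (Loc X x.1)).symm ≪≫ₗ
      e⟩

variable [IsIntegral X]

/-- The local model is the dual of the image of `B ⊗ Ω_{A/R}`, which is finite as a submodule of
`Ω_{B/R}`, whatever `Ω_{A/R}` is. -/
theorem CoherentDifferentials.isCoherentFamily_TangentAlong (hc : CoherentDifferentials π f)
    (hπ : GenericallySmooth π) : IsCoherentFamily (TangentAlong π f) := by
  refine IsCoherentFamily.of_chart (π := π) (f := f) _ fun c =>
    ⟨imageKaehler c.R c.A c.B →ₗ[c.B] c.B, inferInstance, inferInstance, ?_, fun x => ?_⟩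
  · have := hc c
    infer_instance
  · have := hc c
    obtain ⟨H, k, G, -, -, hG, -⟩ := exists_isLocalizedModule_restrictHom c.R
      (Loc S (f (π x.1))) c.A (Loc Y (π x.1)) c.B (Loc X x.1) (c.prime x).primeCompl
    obtain ⟨e⟩ := nonempty_equiv_tensor (B' := Loc X x.1) (c.prime x).primeCompl G hG
    exact ⟨(homEquivDerivation (hπ.derivationsKillKernel_stalk f x.1)).symm ≪≫ₗ e⟩

theorem CoherentDifferentials.isCoherentFamily_TangentImage (hc : CoherentDifferentials π f)
    (hπ : GenericallySmooth π) : IsCoherentFamily (TangentImage π f) := by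
  refine IsCoherentFamily.of_chart (π := π) (f := f) _ fun c =>
    ⟨LinearMap.range (restrictHom c.R c.A c.B), inferInstance, inferInstance, ?_, fun x => ?_⟩
  · have := hc c
    infer_instance
  · have := hc c
    obtain ⟨H, k, G, hH, -, hG, -, -, hHG⟩ := exists_isLocalizedModule_restrictHom c.R
      (Loc S (f (π x.1))) c.A (Loc Y (π x.1)) c.B (Loc X x.1) (c.prime x).primeCompl
    obtain ⟨e⟩ := nonempty_equiv_tensor_range (B' := Loc X x.1) (c.prime x).primeCompl H G hH hG
      _ _ hHG
    exact ⟨(rangeEquiv (hπ.derivationsKillKernel_stalk f x.1)).symm ≪≫ₗ e⟩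

theorem CoherentDifferentials.isCoherentFamily_Critical (hc : CoherentDifferentials π f)
    (hπ : GenericallySmooth π) : IsCoherentFamily (Critical π f) := by
  refine IsCoherentFamily.of_chart (π := π) (f := f) _ fun c =>
    ⟨(imageKaehler c.R c.A c.B →ₗ[c.B] c.B) ⧸ LinearMap.range (restrictHom c.R c.A c.B),
      inferInstance, inferInstance, ?_, fun x => ?_⟩
  · have := hc c
    infer_instance
  · have := hc c
    obtain ⟨H, k, G, hH, -, hG, -, -, hHG⟩ := exists_isLocalizedModule_restrictHom c.R
      (Loc S (f (π x.1))) c.A (Loc Y (π x.1)) c.B (Loc X x.1) (c.prime x).primeCompl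
    obtain ⟨k, hk, -⟩ := exists_isLocalizedModule_cokernel (c.prime x).primeCompl H G _ _ hHG
    obtain ⟨e⟩ := nonempty_equiv_tensor (B' := Loc X x.1) (c.prime x).primeCompl k hk
    exact ⟨(cokernelEquiv (hπ.derivationsKillKernel_stalk f x.1)).symm ≪≫ₗ e⟩

end CoherentStalks

/-! ### Inequalities between Betti numbers at a point -/

section TowerInequalities

open TensorProduct IsLocalRing KaehlerDifferential

/-- For a local homomorphism the closed fibre over `B` is obtained from the one over `A` by
extending the residue field. -/
theorem minGens_baseChange {A B N : Type*} [CommRing A] [CommRing B] [IsLocalRing A]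
    [IsLocalRing B] [IsNoetherianRing A] [Algebra A B] [IsLocalHom (algebraMap A B)]
    [AddCommGroup N] [Module A N] [Module.Finite A N] :
    minGens B (B ⊗[A] N) = minGens A N := by
  have e1 : ResidueField B ⊗[B] (B ⊗[A] N) ≃ₗ[ResidueField B] ResidueField B ⊗[A] N :=
    AlgebraTensorModule.cancelBaseChange _ _ _ _ _
  rw [minGens, e1.finrank_eq]
  refine finrank_tensor_eq_of_ker_eq ?_
  rw [IsScalarTower.algebraMap_eq A B (ResidueField B), ← RingHom.comap_ker]
  have h4 : RingHom.ker (algebraMap B (ResidueField B)) = maximalIdeal B := IsLocalRing.ker_residue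
  have h5 : RingHom.ker (algebraMap A (ResidueField A)) = maximalIdeal A := IsLocalRing.ker_residue
  rw [h4, h5]
  exact ((local_hom_TFAE (algebraMap A B)).out 0 4).1 ‹IsLocalHom (algebraMap A B)›

variable {R A B : Type u} [CommRing R] [CommRing A] [CommRing B] [Algebra R A] [Algebra A B]
  [Algebra R B] [IsScalarTower R A B]

theorem exact_imageKaehler_subtype_map :
    Function.Exact (imageKaehler R A B).subtype (map R A B B) := by
  rw [LinearMap.exact_iff, Submodule.range_subtype]
  exact (range_mapBaseChange R A B).symm

variable (R A B) in
/-- The kernel of the tangent map. -/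
def kerTangentEquiv :
    Derivation A B B ≃ₗ[B] LinearMap.ker (Derivation.compAlgebraMapL R A B B) where
  toFun d := ⟨d.restrictScalars R, Derivation.ext fun a => d.map_algebraMap a⟩
  map_add' _ _ := rfl
  map_smul' _ _ := rfl
  invFun d :=
    have hd : ∀ a, d.1 (algebraMap A B a) = 0 := fun a => Derivation.congr_fun d.2 a
    { toFun := d.1
      map_add' := map_add d.1
      map_smul' := fun a b => by
        rw [RingHom.id_apply, Algebra.smul_def, d.1.leibniz, hd, smul_zero, add_zero,
          algebraMap_smul]
      map_one_eq_zero' := d.1.map_one_eq_zero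
      leibniz' := d.1.leibniz }
  left_inv _ := rfl
  right_inv _ := rfl

theorem minGens_range_add_minGens_ker_le {O M N : Type u} [CommRing O] [IsLocalRing O]
    [IsNoetherianRing O] [AddCommGroup M] [AddCommGroup N] [Module O M] [Module O N]
    [Module.Finite O M] (g : M →ₗ[O] N) :
    minGens O (LinearMap.range g) + minGens O (LinearMap.ker g) ≤
      betti (ModuleCat.of O (LinearMap.range g)) 1 + minGens O M := by
  rw [add_comm]
  exact minGens_add_minGens_le (LinearMap.ker g).subtype g.rangeRestrict
    (by
      rw [LinearMap.exact_iff, Submodule.range_subtype]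
      exact LinearMap.ker_rangeRestrict _)
    (Submodule.subtype_injective _) (LinearMap.surjective_rangeRestrict _)

theorem betti_one_cokernel_add_le {O M N : Type u} [CommRing O] [IsLocalRing O]
    [IsNoetherianRing O] [AddCommGroup M] [AddCommGroup N] [Module O M] [Module O N]
    [Module.Finite O N] (g : M →ₗ[O] N) :
    betti (ModuleCat.of O (N ⧸ LinearMap.range g)) 1 + minGens O N ≤
      betti (ModuleCat.of O N) 1 + minGens O (LinearMap.range g) +
        minGens O (N ⧸ LinearMap.range g) :=
  betti_one_add_minGens_le (LinearMap.range g).subtype (LinearMap.range g).mkQ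
    (LinearMap.exact_subtype_mkQ _) (Submodule.mkQ_surjective _)

theorem betti_one_kaehler_add_le [IsLocalRing B] [IsNoetherianRing B] [Module.Finite B (Ω[B⁄R])] :
    betti (ModuleCat.of B (Ω[B⁄A])) 1 + minGens B (Ω[B⁄R]) ≤
      betti (ModuleCat.of B (Ω[B⁄R])) 1 + minGens B (imageKaehler R A B) + minGens B (Ω[B⁄A]) :=
  have : Module.Finite B (Ω[B⁄A]) := Module.Finite.of_surjective _ (KaehlerDifferential.map_surjective R A B)
  betti_one_add_minGens_le _ _ exact_imageKaehler_subtype_map (KaehlerDifferential.map_surjective R A B)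

theorem finrank_imageKaehler_add [IsLocalRing B] [IsNoetherianRing B] [IsDomain B]
    [Module.Finite B (Ω[B⁄R])] :
    Module.finrank B (imageKaehler R A B) + Module.finrank B (Ω[B⁄A]) =
      Module.finrank B (Ω[B⁄R]) :=
  finrank_add_finrank_of_exact _ _ exact_imageKaehler_subtype_map (Submodule.subtype_injective _)
    (KaehlerDifferential.map_surjective R A B)

end TowerInequalities

/-! ### Generic ranks -/

section Ranks

open TensorProduct IsLocalRing

attribute [local instance] sectionsAlg stalkAlg stalkAlgOver stalkTower

variable {X Y S : Scheme.{u}}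

theorem map_genericPoint [IsIntegral X] [IsIntegral Y] (π : X ⟶ Y) [IsDominant π] :
    π (genericPoint X) = genericPoint Y := by
  apply ((genericPoint_spec Y).eq _).symm
  have := (genericPoint_spec X).image π.continuous
  rwa [Set.image_univ, π.denseRange.closure_range] at this

theorem isField_stalk_map_genericPoint [IsIntegral X] [IsIntegral Y] (π : X ⟶ Y) [IsDominant π] :
    IsField (Loc Y (π (genericPoint X))) := by
  rw [map_genericPoint π]
  exact Field.toIsField Y.functionField

theorem genRank_Omega_map_genericPoint [IsIntegral X] [IsIntegral Y] (π : X ⟶ Y) [IsDominant π]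
    (f : Y ⟶ S) : genRank (Omega f (π (genericPoint X))) = relDim f := by
  rw [map_genericPoint π, relDim]

theorem free_of_isField {K M : Type*} [CommRing K] (hK : IsField K) [AddCommGroup M] [Module K M] :
    Module.Free K M := by
  let := hK.toField
  exact Module.Free.of_divisionRing K M

variable {π : X ⟶ Y} {f : Y ⟶ S} [IsIntegral X]

theorem GenericallySmooth.formallySmooth_genericPoint (hπ : GenericallySmooth π) :
    Algebra.FormallySmooth (Loc Y (π (genericPoint X))) (Loc X (genericPoint X)) := by
  have : IsFractionRing (Loc X (genericPoint X)) (Loc X (genericPoint X)) :=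
    inferInstanceAs (IsFractionRing X.functionField X.functionField)
  exact hπ.formallySmooth_stalk (genericPoint X) (Loc X (genericPoint X))

theorem isField_stalk_genericPoint (X : Scheme.{u}) [IsIntegral X] :
    IsField (Loc X (genericPoint X)) :=
  Field.toIsField X.functionField

theorem GenericallySmooth.canMap_injective (hπ : GenericallySmooth π) (f : Y ⟶ S) :
    Function.Injective (canMap π f (genericPoint X)) := by
  have := hπ.formallySmooth_genericPoint
  exact mapBaseChange_injective_of_formallySmooth _ _ _

/-- The local ring is a field, so `Ω_{X/Y}` is free at the generic point and derivations extend. -/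
theorem GenericallySmooth.range_tangentMap (hπ : GenericallySmooth π) (f : Y ⟶ S) :
    LinearMap.range (tangentMap π f (genericPoint X)) = ⊤ := by
  rw [LinearMap.range_eq_top]
  intro d
  have := free_of_isField (isField_stalk_genericPoint X)
    (M := Ω[Loc X (genericPoint X)⁄Loc Y (π (genericPoint X))])
  obtain ⟨e, he⟩ := exists_derivation_extension (hπ.derivationsKillKernel_stalk f (genericPoint X)) d
  exact ⟨e, Derivation.ext he⟩

variable [IsIntegral Y] [IsDominant π] [IsLocallyNoetherian X]

/-- At the generic point the image is isomorphic to the pullback of `Ω_{Y/S}`, and the local ring of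
`Y` there is a field, so base change preserves the rank. -/
theorem GenericallySmooth.genRank_ImageOmega (hπ : GenericallySmooth π) (f : Y ⟶ S) :
    genRank (ImageOmega π f (genericPoint X)) = relDim f := by
  have h1 := free_of_isField (isField_stalk_map_genericPoint π)
    (M := Ω[Loc Y (π (genericPoint X))⁄Loc S (f (π (genericPoint X)))])
  rw [← genRank_Omega_map_genericPoint π f]
  exact (LinearEquiv.ofInjective _ (hπ.canMap_injective f)).finrank_eq.symm.trans
    Module.finrank_baseChange

/-- Ranks add up along `0 → 𝒱 → Ω_{X/S} → Ω_{X/Y} → 0`. This identity compares the first two bounds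
for the branch loci. -/
theorem CoherentDifferentials.relDimOver_eq (hc : CoherentDifferentials π f)
    (hπ : GenericallySmooth π) : relDimOver π f = relDim π + relDim f := by
  rw [← hπ.genRank_ImageOmega f, add_comm]
  have : Module.Finite (Loc X (genericPoint X))
      (Ω[Loc X (genericPoint X)⁄Loc S (f (π (genericPoint X)))]) :=
    hc.isCoherentFamily_OmegaOver.finite (genericPoint X)
  exact (finrank_imageKaehler_add (R := Loc S (f (π (genericPoint X))))
    (A := Loc Y (π (genericPoint X))) (B := Loc X (genericPoint X))).symm

/-- The module is the dual of the image of the differentials, and over a field the dual has the same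
dimension. -/
theorem GenericallySmooth.genRank_TangentAlong (hπ : GenericallySmooth π) (f : Y ⟶ S) :
    genRank (TangentAlong π f (genericPoint X)) = relDim f := by
  rw [← hπ.genRank_ImageOmega f]
  refine (homEquivDerivation
    (hπ.derivationsKillKernel_stalk f (genericPoint X))).finrank_eq.symm.trans ?_
  let : Field (Loc X (genericPoint X)) := (isField_stalk_genericPoint X).toField
  exact Subspace.dual_finrank_eq

theorem GenericallySmooth.genRank_Critical (hπ : GenericallySmooth π) (f : Y ⟶ S) :
    genRank (Critical π f (genericPoint X)) = 0 := by
  have : Subsingleton (Critical π f (genericPoint X)) :=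
    Submodule.Quotient.subsingleton_iff.2 (hπ.range_tangentMap f)
  exact Module.finrank_zero_of_subsingleton

end Ranks


/-! ### Estimates of partial Euler numbers and of numbers of generators -/

section Inequalities

open TensorProduct IsLocalRing

attribute [local instance] sectionsAlg stalkAlg stalkAlgOver stalkTower

variable {X Y S : Scheme.{u}} {π : X ⟶ Y} {f : Y ⟶ S} [IsIntegral X] [IsLocallyNoetherian X]

theorem finite_Omega (π : X ⟶ Y) [LocallyOfFiniteType π] (x : X) :
    Module.Finite (Loc X x) (Omega π x) :=
  (isCoherentFamily_Omega π).finite x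

/-- Tor along `0 → 𝒱 → Ω_{X/S} → Ω_{X/Y} → 0`, together with `β₀(Ω_{X/S,x}) ≥ d_{X/S}`. -/
theorem chiTwo_Omega_le [LocallyOfFiniteType π] (hc : CoherentDifferentials π f) (x : X) :
    chiTwo (Omega π x) ≤ (betti (ImageOmega π f x) 0 : ℤ) + betti (OmegaOver π f x) 1
      - relDimOver π f + relDim π := by
  have h1 := hc.isCoherentFamily_OmegaOver.finite x
  have h2 := finite_Omega π x
  have h3 := hc.isCoherentFamily_ImageOmega.finite x
  have h1' : Module.Finite (Loc X x) (Ω[Loc X x⁄Loc S (f (π x))]) := h1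
  have h4 : betti (Omega π x) 1 + minGens (Loc X x) (OmegaOver π f x) ≤
      betti (OmegaOver π f x) 1 + minGens (Loc X x) (ImageOmega π f x) +
        minGens (Loc X x) (Omega π x) :=
    betti_one_kaehler_add_le (R := Loc S (f (π x))) (A := Loc Y (π x)) (B := Loc X x)
  have h5 := finrank_le_minGens (R := Loc X x) (OmegaOver π f x)
  have h6 := hc.isCoherentFamily_OmegaOver.genRank_eq x
  have h7 := (isCoherentFamily_Omega π).genRank_eq x
  have h8 : Module.finrank (Loc X x) (OmegaOver π f x) = relDimOver π f := h6
  have h9 : Module.finrank (Loc X x) (Omega π x) = relDim π := h7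
  rw [chiTwo_eq, betti_zero]
  omega

/-- Tor along `0 → Γ → π^*Ω_{Y/S} → 𝒱 → 0`; pullback preserves the number of generators at a point.
-/
theorem betti_ImageOmega_add_le [IsLocallyNoetherian Y] [LocallyOfFiniteType f]
    (hc : CoherentDifferentials π f) (x : X) :
    betti (ImageOmega π f x) 0 + betti (Imperfection π f x) 0 ≤
      betti (ImageOmega π f x) 1 + betti (Omega f (π x)) 0 := by
  have h1 : Module.Finite (Loc Y (π x)) (Omega f (π x)) := (isCoherentFamily_Omega f).finite (π x)
  have h1' : Module.Finite (Loc Y (π x)) (Ω[Loc Y (π x)⁄Loc S (f (π x))]) := h1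
  have h3 := hc.isCoherentFamily_ImageOmega.finite x
  have h5 : Module.Finite (Loc X x) (Imperfection π f x) :=
    inferInstanceAs (Module.Finite (Loc X x) (LinearMap.ker (canMap π f x)))
  have h6 : IsLocalHom (algebraMap (Loc Y (π x)) (Loc X x)) :=
    inferInstanceAs (IsLocalHom (π.stalkMap x).hom)
  have h4 : minGens (Loc X x) (ImageOmega π f x) + minGens (Loc X x) (Imperfection π f x) ≤
      betti (ImageOmega π f x) 1 + minGens (Loc X x)
        (Loc X x ⊗[Loc Y (π x)] (Ω[Loc Y (π x)⁄Loc S (f (π x))])) :=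
    minGens_range_add_minGens_ker_le (canMap π f x)
  rw [minGens_baseChange] at h4
  rw [betti_zero, betti_zero, betti_zero]
  exact h4

/-- Tor along the sequence from the image of `dπ` to `T_{X/S→Y/S}` and its cokernel. The middle term
needs at least `d_{Y/S}` generators, and the cokernel has rank zero. -/
theorem chiTwo_Critical_le [IsIntegral Y] [IsDominant π] (hc : CoherentDifferentials π f)
    (hπ : GenericallySmooth π) (x : X) :
    chiTwo (Critical π f x) ≤ (betti (TangentImage π f x) 0 : ℤ) + betti (TangentAlong π f x) 1
      - relDim f := by
  have h1 := (hc.isCoherentFamily_TangentAlong hπ).finite x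
  have h2 := (hc.isCoherentFamily_Critical hπ).finite x
  have h3 := (hc.isCoherentFamily_TangentImage hπ).finite x
  have h1' : Module.Finite (Loc X x)
      (Derivation (Loc S (f (π x))) (Loc Y (π x)) (Loc X x)) := h1
  have h4 : betti (Critical π f x) 1 + minGens (Loc X x) (TangentAlong π f x) ≤
      betti (TangentAlong π f x) 1 + minGens (Loc X x) (TangentImage π f x) +
        minGens (Loc X x) (Critical π f x) :=
    betti_one_cokernel_add_le (tangentMap π f x)
  have h5 := finrank_le_minGens (R := Loc X x) (TangentAlong π f x)
  have h6 := (hc.isCoherentFamily_TangentAlong hπ).genRank_eq x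
  have h7 := (hc.isCoherentFamily_Critical hπ).genRank_eq x
  rw [hπ.genRank_TangentAlong] at h6
  rw [hπ.genRank_Critical] at h7
  have h8 : Module.finrank (Loc X x) (TangentAlong π f x) = relDim f := h6
  have h9 : Module.finrank (Loc X x) (Critical π f x) = 0 := h7
  rw [chiTwo_eq, betti_zero]
  omega

/-- Tor along `T_{X/S}` and the image of `dπ`, where `T_{X/Y}` is the kernel. -/
theorem betti_TangentImage_add_le [LocallyOfFiniteType π] (hc : CoherentDifferentials π f)
    (hπ : GenericallySmooth π) (x : X) :
    betti (TangentImage π f x) 0 + betti (Tangent π x) 0 ≤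
      betti (TangentImage π f x) 1 + betti (TangentOver π f x) 0 := by
  have h1 := hc.isCoherentFamily_TangentOver.finite x
  have h2 := finite_Omega π x
  have h2' : Module.Finite (Loc X x) (Ω[Loc X x⁄Loc Y (π x)]) := h2
  have h3 := (hc.isCoherentFamily_TangentImage hπ).finite x
  have h5 : Module.Finite (Loc X x) (Tangent π x) :=
    Module.Finite.equiv (KaehlerDifferential.linearMapEquivDerivation (Loc Y (π x)) (Loc X x))
  have h1' : Module.Finite (Loc X x)
      (Derivation (Loc S (f (π x))) (Loc X x) (Loc X x)) := h1
  have h4 : minGens (Loc X x) (TangentImage π f x) +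
      minGens (Loc X x) (LinearMap.ker (tangentMap π f x)) ≤
      betti (TangentImage π f x) 1 + minGens (Loc X x) (TangentOver π f x) :=
    minGens_range_add_minGens_ker_le (tangentMap π f x)
  have h6 : minGens (Loc X x) (Tangent π x) =
      minGens (Loc X x) (LinearMap.ker (tangentMap π f x)) :=
    minGens_eq_of_equiv (kerTangentEquiv (Loc S (f (π x))) (Loc Y (π x)) (Loc X x))
  rw [betti_zero, betti_zero, betti_zero, h6]
  exact h4

end Inequalities

/-! ### Bounds for the codimension of the loci -/

section Bounds

attribute [local instance] sectionsAlg stalkAlg stalkAlgOver stalkTower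

variable {X Y S : Scheme.{u}}

theorem heightE_le_toE {x : X} {n : ℕ} (h : height x ≤ n) {z : ℤ} (hz : (n : ℤ) ≤ z) :
    heightE x ≤ toE z := by
  have h1 : heightE x ≤ (((n : ℕ∞) : ENNReal) : EReal) := by
    unfold heightE
    exact EReal.coe_ennreal_le_coe_ennreal_iff.2 (ENat.toENNReal_le.2 h)
  refine h1.trans ?_
  have h2 : (((n : ℕ∞) : ENNReal) : EReal) = ((n : ℝ) : EReal) := by
    rw [ENat.toENNReal_coe, ← ENNReal.ofReal_natCast, EReal.coe_ennreal_ofReal,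
      max_eq_left (by positivity)]
  rw [h2]
  exact EReal.coe_le_coe_iff.2 (by exact_mod_cast hz)

theorem toE_le_toE {a b : ℤ} (h : a ≤ b) : toE a ≤ toE b :=
  EReal.coe_le_coe_iff.2 (by exact_mod_cast h)

/-- Nonnegativity of `z` takes care of the value `-1` at the empty set. -/
theorem codimPlus_le {T : Set X} {z : ℤ} (hz : 0 ≤ z) (h : ∀ x ∈ maxPoints T, heightE x ≤ toE z) :
    codimPlus T ≤ toE z := by
  refine max_le ?_ (iSup₂_le h)
  have : (-1 : EReal) = toE (-1) := by
    simp [toE]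
  rw [this]
  exact toE_le_toE (by omega)

variable {M : ∀ x : X, ModuleCat.{u} (Loc X x)}

theorem IsCoherentFamily.fittingLocus_eq (hM : IsCoherentFamily M) (j : ℕ) :
    {x : X | fittingIdeal (Loc X x) (M x) j ≠ ⊤} = {x | j < minGens (Loc X x) (M x)} := by
  ext x
  have := hM.finite x
  exact fittingIdeal_ne_top_iff (M x) j

variable [IsIntegral X] [IsNoetherian X]

/-- The determinantal bound with `j = d + i`, where `d` is the generic rank; the formula for `χ₂`
rewrites its second factor. -/
theorem IsCoherentFamily.heightE_le (hM : IsCoherentFamily M) (i : ℕ) {x : X}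
    (hx : x ∈ maxPoints {x : X | fittingIdeal (Loc X x) (M x) (genRank (M (genericPoint X)) + i) ≠
      ⊤}) :
    heightE x ≤ toE ((genRank (M (genericPoint X)) + i + 1) * (i + 1 + chiTwo (M x))) := by
  have hfin := hM.finite x
  rw [hM.fittingLocus_eq] at hx
  refine heightE_le_toE (hM.height_le _ x hx) ?_
  have h1 : Module.finrank (Loc X x) (M x) = genRank (M (genericPoint X)) := hM.genRank_eq x
  have h2 := chiTwo_nonneg (M x)
  rw [chiTwo_eq, h1] at h2 ⊢
  set d := genRank (M (genericPoint X))
  -- As `χ₂` is nonnegative, the natural subtraction is not truncated.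
  have h3 : ((betti (M x) 1 + (d + i) + 1 - minGens (Loc X x) (M x) : ℕ) : ℤ) =
      i + 1 + ((betti (M x) 1 : ℤ) - minGens (Loc X x) (M x) + d) := by
    omega
  rw [Nat.cast_mul, h3]
  push_cast
  exact le_of_eq (by ring)

theorem IsCoherentFamily.codimPlus_le (hM : IsCoherentFamily M) (i : ℕ) {z : ℤ}
    (hz : ∀ x, chiTwo (M x) ≤ z) :
    codimPlus {x : X | fittingIdeal (Loc X x) (M x) (genRank (M (genericPoint X)) + i) ≠ ⊤} ≤
      toE ((genRank (M (genericPoint X)) + i + 1) * (i + 1 + z)) := by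
  have h0 : 0 ≤ z := by
    have := hM.finite (genericPoint X)
    exact (chiTwo_nonneg _).trans (hz (genericPoint X))
  refine PurityLoci.codimPlus_le (by positivity) fun x hx => (hM.heightE_le i hx).trans ?_
  refine toE_le_toE (mul_le_mul_of_nonneg_left ?_ (by positivity))
  have := hz x
  omega

theorem IsCoherentFamily.bddAbove_betti_zero (hM : IsCoherentFamily M) :
    BddAbove (Set.range fun x => betti (M x) 0) := by
  obtain ⟨n, hn⟩ := hM.exists_bound
  refine ⟨n, ?_⟩
  rintro _ ⟨x, rfl⟩
  have := hM.finite x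
  change betti (M x) 0 ≤ n
  rw [betti_zero]
  exact (hn x).1

theorem IsCoherentFamily.bddAbove_betti_one (hM : IsCoherentFamily M) :
    BddAbove (Set.range fun x => betti (M x) 1) := by
  obtain ⟨n, hn⟩ := hM.exists_bound
  refine ⟨n, ?_⟩
  rintro _ ⟨x, rfl⟩
  exact (hn x).2

theorem IsCoherentFamily.bddAbove_chiTwo (hM : IsCoherentFamily M) :
    BddAbove (Set.range fun x => chiTwo (M x)) := by
  obtain ⟨n, hn⟩ := hM.exists_bound
  refine ⟨n, ?_⟩
  rintro _ ⟨x, rfl⟩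
  have := hM.finite x
  change chiTwo (M x) ≤ n
  rw [chiTwo_eq]
  have h1 := (hn x).2
  have h2 := finrank_le_minGens (R := Loc X x) (M x)
  omega

variable {π : X ⟶ Y} {f : Y ⟶ S}

theorem codimPlus_branchLocusHigher_le [LocallyOfFiniteType π] (i : ℕ) {z : ℤ}
    (hz : ∀ x, chiTwo (Omega π x) ≤ z) :
    codimPlus (branchLocusHigher π i) ≤ toE ((relDim π + i + 1) * (i + 1 + z)) :=
  (isCoherentFamily_Omega π).codimPlus_le i hz

theorem heightE_le_of_mem_maxPoints_branchLocusHigher [LocallyOfFiniteType π] (i : ℕ) {x : X}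
    (hx : x ∈ maxPoints (branchLocusHigher π i)) :
    heightE x ≤ toE ((relDim π + i + 1) * (i + 1 + chiTwo (Omega π x))) :=
  (isCoherentFamily_Omega π).heightE_le i hx

theorem codimPlus_branchLocusHigher_le_of_isDCI [LocallyOfFiniteType π] (h : IsDCI π) (i : ℕ) :
    codimPlus (branchLocusHigher π i) ≤ toE ((relDim π + i + 1) * (i + 1)) := by
  have h1 : ∀ x, chiTwo (Omega π x) ≤ 0 := fun x =>
    have := finite_Omega π x
    (chiTwo_eq_zero _ (h x)).le
  simpa using codimPlus_branchLocusHigher_le i h1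

variable [IsIntegral Y] [IsDominant π]

theorem codimPlus_criticalLocusHigher_le (hc : CoherentDifferentials π f)
    (hπ : GenericallySmooth π) (i : ℕ) {z : ℤ} (hz : ∀ x, chiTwo (Critical π f x) ≤ z) :
    codimPlus (criticalLocusHigher π f i) ≤ toE ((i + 1) * (i + 1 + z)) := by
  have := (hc.isCoherentFamily_Critical hπ).codimPlus_le i hz
  rw [hπ.genRank_Critical f] at this
  simpa [criticalLocusHigher] using this

theorem heightE_le_of_mem_maxPoints_criticalLocusHigher (hc : CoherentDifferentials π f)
    (hπ : GenericallySmooth π) (i : ℕ) {x : X} (hx : x ∈ maxPoints (criticalLocusHigher π f i)) :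
    heightE x ≤ toE ((i + 1) * (i + 1 + chiTwo (Critical π f x))) := by
  have := (hc.isCoherentFamily_Critical hπ).heightE_le i (x := x)
  rw [hπ.genRank_Critical f] at this
  simp only [zero_add, Nat.cast_zero] at this
  exact this hx

end Bounds

/-! ### The chains of bounds for the branch and critical loci -/

section BoundTheorems

variable {X Y S : Scheme.{u}} [IsIntegral X] [IsIntegral Y]
    [IsNoetherian X] [IsNoetherian Y] {π : X ⟶ Y} {f : Y ⟶ S}
    [LocallyOfFiniteType π] [IsDominant π]

theorem branchLocusHigher_bounds (hπ : GenericallySmooth π) (hf : LocallyOfFiniteType f)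
    (hc : CoherentDifferentials π f) :
      (BddAbove (Set.range fun x : X => chiTwo (Omega π x)) ∧
        BddAbove (Set.range fun x : X => betti (ImageOmega π f x) 0) ∧
        BddAbove (Set.range fun x : X => betti (OmegaOver π f x) 1) ∧
        BddAbove (Set.range fun y : Y => betti (Omega f y) 0)) ∧
      ∀ i : ℕ,
        codimPlus (branchLocusHigher π i) ≤
          toE ((relDim π + i + 1) * (i + 1 + ⨆ x : X, chiTwo (Omega π x))) ∧
        codimPlus (branchLocusHigher π i) ≤
          toE ((relDim π + i + 1) * (relDim π - relDimOver π f + i + 1 +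
            (⨆ x : X, betti (ImageOmega π f x) 0 : ℕ) +
            (⨆ x : X, betti (OmegaOver π f x) 1 : ℕ))) ∧
        ((relDim π + i + 1 : ℤ) * (relDim π - relDimOver π f + i + 1 +
            (⨆ x : X, betti (ImageOmega π f x) 0 : ℕ) +
            (⨆ x : X, betti (OmegaOver π f x) 1 : ℕ)) ≤
          (relDim π + i + 1) * (i + 1 +
            (⨆ x : X, betti (ImageOmega π f x) 0 : ℕ) +
            (⨆ x : X, betti (OmegaOver π f x) 1 : ℕ) - relDim f)) ∧
        (GenericallySmooth (π ≫ f) →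
          (relDim π + i + 1 : ℤ) * (relDim π - relDimOver π f + i + 1 +
            (⨆ x : X, betti (ImageOmega π f x) 0 : ℕ) +
            (⨆ x : X, betti (OmegaOver π f x) 1 : ℕ)) =
          (relDim π + i + 1) * (i + 1 +
            (⨆ x : X, betti (ImageOmega π f x) 0 : ℕ) +
            (⨆ x : X, betti (OmegaOver π f x) 1 : ℕ) - relDim f)) ∧
        (∀ x ∈ maxPoints (branchLocusHigher π i),
          heightE x ≤ toE ((relDim π + i + 1) * (relDim π - relDimOver π f + i + 1 +
            betti (ImageOmega π f x) 0 + betti (OmegaOver π f x) 1))) ∧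
        (∀ x : X,
          (relDim π + i + 1 : ℤ) * (relDim π - relDimOver π f + i + 1 +
              betti (ImageOmega π f x) 0 + betti (OmegaOver π f x) 1) ≤
            (relDim π + i + 1) * (i + 1 +
              betti (ImageOmega π f x) 0 + betti (OmegaOver π f x) 1 - relDim f) ∧
          (relDim π + i + 1 : ℤ) * (i + 1 +
              betti (ImageOmega π f x) 0 + betti (OmegaOver π f x) 1 - relDim f) ≤
            (relDim π + i + 1) * (smoothDefectAt f (π x) - betti (Imperfection π f x) 0 +
              betti (ImageOmega π f x) 1 + betti (OmegaOver π f x) 1 + i + 1) ∧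
          (relDim π + i + 1 : ℤ) * (smoothDefectAt f (π x) - betti (Imperfection π f x) 0 +
              betti (ImageOmega π f x) 1 + betti (OmegaOver π f x) 1 + i + 1) ≤
            (relDim π + i + 1) * (smoothDefect f - betti (Imperfection π f x) 0 +
              betti (ImageOmega π f x) 1 + betti (OmegaOver π f x) 1 + i + 1)) := by
  have hb1 := (isCoherentFamily_Omega π).bddAbove_chiTwo
  have hb2 := hc.isCoherentFamily_ImageOmega.bddAbove_betti_zero
  have hb3 := hc.isCoherentFamily_OmegaOver.bddAbove_betti_one
  have hb4 := (isCoherentFamily_Omega f).bddAbove_betti_zero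
  have hd := hc.relDimOver_eq hπ
  have hχ : ∀ x, chiTwo (Omega π x) ≤ relDim π - relDimOver π f +
      (⨆ x : X, betti (ImageOmega π f x) 0 : ℕ) + (⨆ x : X, betti (OmegaOver π f x) 1 : ℕ) := by
    intro x
    have h1 := chiTwo_Omega_le hc x
    have h2 := le_ciSup hb2 x
    have h3 := le_ciSup hb3 x
    omega
  have hx0 : ∀ i : ℕ, (0 : ℤ) ≤ relDim π + i + 1 := fun i => by positivity
  refine ⟨⟨hb1, hb2, hb3, hb4⟩, fun i => ⟨codimPlus_branchLocusHigher_le i (le_ciSup hb1),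
    ?_, ?_, fun _ => ?_, fun x hx => ?_, fun x => ⟨?_, ?_, ?_⟩⟩⟩
  · refine (codimPlus_branchLocusHigher_le i hχ).trans (toE_le_toE (le_of_eq ?_))
    ring
  -- Additivity of the relative dimensions makes both sides equal.
  · rw [hd]
    push_cast
    exact le_of_eq (by ring)
  · rw [hd]
    push_cast
    ring
  · refine (heightE_le_of_mem_maxPoints_branchLocusHigher i hx).trans (toE_le_toE
      (mul_le_mul_of_nonneg_left ?_ (hx0 i)))
    have h1 := chiTwo_Omega_le hc x
    omega
  · rw [hd]
    push_cast
    exact le_of_eq (by ring)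
  · refine mul_le_mul_of_nonneg_left ?_ (hx0 i)
    have h1 := betti_ImageOmega_add_le hc x
    rw [smoothDefectAt]
    omega
  · refine mul_le_mul_of_nonneg_left ?_ (hx0 i)
    have h1 := le_ciSup hb4 (π x)
    rw [smoothDefectAt, smoothDefect]
    omega

theorem criticalLocusHigher_bounds (hπ : GenericallySmooth π) (hc : CoherentDifferentials π f) :
      (BddAbove (Set.range fun x : X => chiTwo (Critical π f x)) ∧
        BddAbove (Set.range fun x : X => betti (TangentImage π f x) 0) ∧
        BddAbove (Set.range fun x : X => betti (TangentAlong π f x) 1) ∧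
        BddAbove (Set.range fun x : X => betti (TangentOver π f x) 0)) ∧
      ∀ i : ℕ,
        codimPlus (criticalLocusHigher π f i) ≤
          toE ((relDim π + i + 1) * (i + 1 + ⨆ x : X, chiTwo (Critical π f x))) ∧
        codimPlus (criticalLocusHigher π f i) ≤
          toE ((i + 1) * ((⨆ x : X, betti (TangentImage π f x) 0 : ℕ) +
            (⨆ x : X, betti (TangentAlong π f x) 1 : ℕ) -
            genRank (TangentAlong π f (genericPoint X)) + i + 1)) ∧
        ((i + 1 : ℤ) * ((⨆ x : X, betti (TangentImage π f x) 0 : ℕ) +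
            (⨆ x : X, betti (TangentAlong π f x) 1 : ℕ) -
            genRank (TangentAlong π f (genericPoint X)) + i + 1) ≤
          (i + 1) * ((⨆ x : X, betti (TangentImage π f x) 0 : ℕ) +
            (⨆ x : X, betti (TangentAlong π f x) 1 : ℕ) - relDim f + i + 1)) ∧
        (GenericallySmooth f →
          (i + 1 : ℤ) * ((⨆ x : X, betti (TangentImage π f x) 0 : ℕ) +
            (⨆ x : X, betti (TangentAlong π f x) 1 : ℕ) -
            genRank (TangentAlong π f (genericPoint X)) + i + 1) =
          (i + 1) * ((⨆ x : X, betti (TangentImage π f x) 0 : ℕ) +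
            (⨆ x : X, betti (TangentAlong π f x) 1 : ℕ) - relDim f + i + 1)) ∧
        (∀ x ∈ maxPoints (criticalLocusHigher π f i),
          heightE x ≤ toE ((i + 1) * (betti (TangentImage π f x) 0 +
            betti (TangentAlong π f x) 1 -
            genRank (TangentAlong π f (genericPoint X)) + i + 1))) ∧
        (∀ x : X,
          (i + 1 : ℤ) * (betti (TangentImage π f x) 0 + betti (TangentAlong π f x) 1 -
              genRank (TangentAlong π f (genericPoint X)) + i + 1) ≤
            (i + 1) * (betti (TangentImage π f x) 0 + betti (TangentAlong π f x) 1 -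
              relDim f + i + 1) ∧
          (i + 1 : ℤ) * (betti (TangentImage π f x) 0 + betti (TangentAlong π f x) 1 -
              relDim f + i + 1) ≤
            (i + 1) * (tangentDefectOverAt π f x - tangentDefectAt π x +
              betti (TangentImage π f x) 1 + betti (TangentAlong π f x) 1 + i + 1) ∧
          (i + 1 : ℤ) * (tangentDefectOverAt π f x - tangentDefectAt π x +
              betti (TangentImage π f x) 1 + betti (TangentAlong π f x) 1 + i + 1) ≤
            (i + 1) * (tangentDefectOver π f - tangentDefectAt π x +
              betti (TangentImage π f x) 1 + betti (TangentAlong π f x) 1 + i + 1)) := by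
  have hb1 := (hc.isCoherentFamily_Critical hπ).bddAbove_chiTwo
  have hb2 := (hc.isCoherentFamily_TangentImage hπ).bddAbove_betti_zero
  have hb3 := (hc.isCoherentFamily_TangentAlong hπ).bddAbove_betti_one
  have hb4 := hc.isCoherentFamily_TangentOver.bddAbove_betti_zero
  have hd := hc.relDimOver_eq hπ
  have hχ : ∀ x, chiTwo (Critical π f x) ≤ (⨆ x : X, betti (TangentImage π f x) 0 : ℕ) +
      (⨆ x : X, betti (TangentAlong π f x) 1 : ℕ) - relDim f := by
    intro x
    have h1 := chiTwo_Critical_le hc hπ x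
    have h2 := le_ciSup hb2 x
    have h3 := le_ciSup hb3 x
    omega
  -- The generic rank is `d_{Y/S}`, so the middle inequalities become identities.
  rw [hπ.genRank_TangentAlong f]
  have hx0 : ∀ i : ℕ, (0 : ℤ) ≤ i + 1 := fun i => by positivity
  refine ⟨⟨hb1, hb2, hb3, hb4⟩, fun i => ⟨?_, ?_, le_rfl, fun _ => rfl, fun x hx => ?_,
    fun x => ⟨le_rfl, ?_, ?_⟩⟩⟩
  -- The critical module has rank zero, which gives the factor `i + 1`. Enlarging it by `d_{X/Y}`
  -- requires the other factor to be nonnegative.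
  · refine (codimPlus_criticalLocusHigher_le hc hπ i (le_ciSup hb1)).trans (toE_le_toE
      (mul_le_mul_of_nonneg_right (by omega) ?_))
    have := (hc.isCoherentFamily_Critical hπ).finite (genericPoint X)
    have h1 := (chiTwo_nonneg (Critical π f (genericPoint X))).trans
      (le_ciSup hb1 (genericPoint X))
    omega
  · refine (codimPlus_criticalLocusHigher_le hc hπ i hχ).trans (toE_le_toE (le_of_eq ?_))
    ring
  · refine (heightE_le_of_mem_maxPoints_criticalLocusHigher hc hπ i hx).trans (toE_le_toE
      (mul_le_mul_of_nonneg_left ?_ (hx0 i)))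
    have h1 := chiTwo_Critical_le hc hπ x
    omega
  · refine mul_le_mul_of_nonneg_left ?_ (hx0 i)
    have h1 := betti_TangentImage_add_le hc hπ x
    rw [tangentDefectOverAt, tangentDefectAt]
    omega
  · refine mul_le_mul_of_nonneg_left ?_ (hx0 i)
    have h1 := le_ciSup hb4 x
    rw [tangentDefectOverAt, tangentDefectOver]
    omega

end BoundTheorems

/-! ### Submersive points -/

section ExtensionAlgebra

open TensorProduct KaehlerDifferential

theorem free_of_free_localizedModule_away {B B₁ M N : Type*} [CommRing B] [CommRing B₁]
    [Algebra B B₁] [AddCommGroup M] [AddCommGroup N] [Module B M] [Module B N] [Module B₁ N]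
    [IsScalarTower B B₁ N] (r : B) [IsLocalization.Away r B₁] (l : M →ₗ[B] N)
    [IsLocalizedModule (Submonoid.powers r) l]
    [Module.Free (Localization (Submonoid.powers r)) (LocalizedModule.Away r M)] :
    Module.Free B₁ N := by
  let L := Localization (Submonoid.powers r)
  let ε : L ≃ₐ[B] B₁ := IsLocalization.algEquiv (Submonoid.powers r) L B₁
  let : Algebra L B₁ := ε.toRingHom.toAlgebra
  have : IsScalarTower B L B₁ := IsScalarTower.of_algebraMap_eq fun b => (ε.commutes b).symm
  have e1 : LocalizedModule.Away r M ≃ₗ[L] L ⊗[B] M :=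
    (IsLocalizedModule.isBaseChange (Submonoid.powers r) L
      (LocalizedModule.mkLinearMap (Submonoid.powers r) M)).equiv.symm
  have e2 : N ≃ₗ[B₁] B₁ ⊗[B] M :=
    (IsLocalizedModule.isBaseChange (Submonoid.powers r) B₁ l).equiv.symm
  have e3 : B₁ ⊗[L] (L ⊗[B] M) ≃ₗ[B₁] B₁ ⊗[B] M := AlgebraTensorModule.cancelBaseChange _ _ _ _ _
  have : Module.Free L (L ⊗[B] M) := Module.Free.of_equiv e1
  exact Module.Free.of_equiv (e3.trans e2.symm)

section Restrict

variable {R A B B₁ : Type u} [CommRing R] [CommRing A] [CommRing B] [CommRing B₁]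
  [Algebra R A] [Algebra A B] [Algebra R B] [IsScalarTower R A B] [Algebra B B₁] [Algebra A B₁]
  [Algebra R B₁] [IsScalarTower A B B₁] [IsScalarTower R B B₁] [IsScalarTower R A B₁]

theorem exists_derivation_extension_restrict (h : DerivationsKillKernel R A B₁)
    [Module.Projective B₁ (Ω[B₁⁄A])] (d : Derivation R A B) :
    ∃ e : Derivation R B₁ B₁, ∀ a, e (algebraMap A B₁ a) = algebraMap B B₁ (d a) := by
  obtain ⟨e, he⟩ := exists_derivation_extension h
    ((IsScalarTower.toAlgHom A B B₁).toLinearMap.compDer d)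
  exact ⟨e, he⟩

end Restrict

variable {R R' A A' B B' : Type u} [CommRing R] [CommRing R'] [CommRing A] [CommRing A']
  [CommRing B] [CommRing B'] [Algebra R A] [Algebra A B] [Algebra R B] [IsScalarTower R A B]
  [Algebra R' A'] [Algebra A' B'] [Algebra R' B'] [IsScalarTower R' A' B'] [Algebra R R']
  [Algebra A A'] [Algebra B B'] [Algebra R A'] [IsScalarTower R A A'] [IsScalarTower R R' A']
  [Algebra R B'] [IsScalarTower R B B'] [IsScalarTower R R' B'] [Algebra A B']
  [IsScalarTower A B B'] [IsScalarTower A A' B'] (b : Submonoid B) [IsLocalization b B']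
  [Algebra.FormallyUnramified R R'] [Algebra.FormallyUnramified A A']
  [IsNoetherianRing B] [Module.Finite B (Ω[B⁄R])]

-- Surjectivity after localization kills the localized cokernel, so an element of `b` kills the
-- class of `d`. This spreads liftability from a stalk to a neighbourhood.
include b in
theorem exists_smul_derivation_extension (h : DerivationsKillKernel R A B)
    (h' : DerivationsKillKernel R' A' B')
    (htop : LinearMap.range (Derivation.compAlgebraMapL R' A' B' B') = ⊤) (d : Derivation R A B) :
    ∃ s ∈ b, ∃ e : Derivation R B B, ∀ a, e (algebraMap A B a) = s * d a := by
  obtain ⟨H, k, G, hH, -, hG, -, -, hHG⟩ :=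
    exists_isLocalizedModule_restrictHom R R' A A' B B' b
  obtain ⟨q, hq, hq'⟩ := exists_isLocalizedModule_cokernel b H G _ _ hHG
  have hsub : Subsingleton ((imageKaehler R' A' B' →ₗ[B'] B') ⧸
      LinearMap.range (restrictHom R' A' B')) := by
    have : Subsingleton (Derivation R' A' B' ⧸
        LinearMap.range (Derivation.compAlgebraMapL R' A' B' B')) :=
      Submodule.Quotient.subsingleton_iff.2 htop
    exact (cokernelEquiv h').toEquiv.subsingleton
  let φ := (homEquivDerivation h).symm d
  obtain ⟨s, hs⟩ := (IsLocalizedModule.eq_zero_iff b q).1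
    (Subsingleton.elim (q (Submodule.Quotient.mk φ)) 0)
  obtain ⟨ψ, hψ⟩ := (Submodule.Quotient.mk_eq_zero _).1 hs
  refine ⟨s, s.2, linearMapEquivDerivation R B ψ, fun a => ?_⟩
  have h1 := congrArg (homEquivDerivation h) hψ
  rw [homEquivDerivation_restrictHom] at h1
  have h2 : homEquivDerivation h ((s : B) • φ) = (s : B) • d := by
    rw [map_smul, LinearEquiv.apply_symm_apply]
  exact congrArg (fun D : Derivation R A B => D a) (h1.trans h2)

-- Up to a unit, every linear form on the localized image comes from a form over `B`, and the
-- corresponding derivation lifts by hypothesis.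
include b in
theorem range_compAlgebraMapL_eq_top (h' : DerivationsKillKernel R' A' B')
    (hext : ∀ d : Derivation R A B, ∃ e : Derivation R' B' B', ∀ a,
      e (algebraMap A B' a) = algebraMap B B' (d a)) :
    LinearMap.range (Derivation.compAlgebraMapL R' A' B' B') = ⊤ := by
  obtain ⟨H, k, G, hH, hk, hG, hkx, hGx, hHG⟩ :=
    exists_isLocalizedModule_restrictHom R R' A A' B B' b
  suffices h : LinearMap.range (restrictHom R' A' B') = ⊤ by
    rw [← map_homEquivDerivation h', h, Submodule.map_top, LinearEquiv.range]
  have hG' : ∀ φ, G φ ∈ LinearMap.range (restrictHom R' A' B') := by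
    intro φ
    obtain ⟨e, he⟩ := hext (derivationOfHom φ)
    refine ⟨e.liftKaehlerDifferential, ?_⟩
    have h2 : ((restrictHom R' A' B' e.liftKaehlerDifferential).restrictScalars B) ∘ₗ k =
        (G φ).restrictScalars B ∘ₗ k := by
      refine imageKaehler_hom_ext fun a => ?_
      rw [LinearMap.comp_apply, LinearMap.comp_apply, LinearMap.restrictScalars_apply,
        LinearMap.restrictScalars_apply, hGx, ← derivationOfHom_apply φ, ← he]
      change e.liftKaehlerDifferential (k _ : Ω[B'⁄R']) = _
      rw [hkx, map_D, Derivation.liftKaehlerDifferential_comp_D, ← IsScalarTower.algebraMap_apply]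
    have h3 := IsLocalizedModule.ext b k
      (IsLocalizedModule.map_units (Algebra.linearMap B B')) h2
    ext x
    exact LinearMap.congr_fun h3 x
  rw [eq_top_iff]
  intro ψ _
  obtain ⟨⟨φ, s⟩, hs⟩ := IsLocalizedModule.surj b G ψ
  have hu : IsUnit (algebraMap B B' s) := IsLocalization.map_units B' s
  have h4 : algebraMap B B' s • ψ = G φ := by
    rw [algebraMap_smul]
    exact hs
  have h5 := hG' φ
  rw [← h4] at h5
  exact (Submodule.smul_mem_iff_of_isUnit _ hu).1 h5

end ExtensionAlgebra

/-! ### Submersivity compared with surjectivity on stalks -/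

section Submersive

variable {X Y S : Scheme.{u}} {π : X ⟶ Y} {f : Y ⟶ S}

attribute [local instance] stalkAlg stalkAlgOver stalkTower

theorem exists_basicOpen_shrink (c : Chart π f) (x : c.U) {s : c.B} (hs : s ∈ (c.prime x).primeCompl) :
    x.1 ∈ X.basicOpen s := by
  rw [X.mem_basicOpen s x.1 x.2]
  exact IsLocalization.map_units (M := (c.prime x).primeCompl) (Loc X x.1) ⟨s, hs⟩

/-- The critical locus lies in the branch locus. -/
theorem criticalLocus_subset_branchLocus [IsIntegral X] [IsLocallyNoetherian X]
    [LocallyOfFiniteType π] (hπ : GenericallySmooth π) (f : Y ⟶ S) :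
    criticalLocus π f ⊆ branchLocus π := by
  intro x hx hfree
  refine hx fun c hxc D => ?_
  obtain ⟨x, rfl⟩ : ∃ x' : c.U, x'.1 = x := ⟨⟨x, hxc⟩, rfl⟩
  have := c.finite_kaehler
  have := Module.finitePresentation_of_finite c.B (Ω[c.B⁄c.A])
  have hl := isLocalizedModule_kaehler c.A (Loc Y (π x.1)) c.B (Loc X x.1) (c.prime x).primeCompl
  have hfree' : Module.Free (Loc X x.1) (Ω[Loc X x.1⁄Loc Y (π x.1)]) := hfree
  -- Freeness at the stalk spreads to a basic open set, over which the sequence of differentials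
  -- splits.
  obtain ⟨s, hs, hs', -⟩ := Module.FinitePresentation.exists_free_localizedModule_powers
    (c.prime x).primeCompl
    (KaehlerDifferential.map c.A (Loc Y (π x.1)) c.B (Loc X x.1)) (Loc X x.1)
  have hxs := exists_basicOpen_shrink c x hs
  refine ⟨X.basicOpen s, c.affineU.basicOpen s, X.basicOpen_le s, hxs, ?_⟩
  let c' := c.shrink (X.basicOpen s) (c.affineU.basicOpen s) (X.basicOpen_le s)
  let : Algebra c.B c'.B := (X.presheaf.map (homOfLE (X.basicOpen_le s)).op).hom.toAlgebra
  let : Algebra c.A c'.B := c'.algAB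
  let : Algebra c.R c'.B := c'.algRB
  have : IsScalarTower c.R c.A c'.B := c'.towerRAB
  have t1 : IsScalarTower c.A c.B c'.B := IsScalarTower.of_algebraMap_eq fun a => by
    change π.appLE c.V (X.basicOpen s) _ a =
      X.presheaf.map (homOfLE (X.basicOpen_le s)).op (π.appLE c.V c.U c.leUV a)
    rw [← CommRingCat.comp_apply, Scheme.Hom.appLE_map]
  have : IsScalarTower c.R c.B c'.B := IsScalarTower.of_algebraMap_eq fun a => by
    rw [IsScalarTower.algebraMap_apply c.R c.A c'.B, IsScalarTower.algebraMap_apply c.A c.B c'.B,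
      ← IsScalarTower.algebraMap_apply c.R c.A c.B]
  have : IsLocalization.Away s c'.B := c.affineU.isLocalization_basicOpen s
  have : IsLocalizedModule (Submonoid.powers s) (KaehlerDifferential.map c.A c.A c.B c'.B) :=
    isLocalizedModule_kaehler c.A c.A c.B c'.B (Submonoid.powers s)
  have : Module.Free c'.B (Ω[c'.B⁄c.A]) := free_of_free_localizedModule_away s
    (KaehlerDifferential.map c.A c.A c.B c'.B)
  have hk : DerivationsKillKernel c.R c.A c'.B := hπ.derivationsKillKernel_chart c' ⟨x.1, hxs⟩
  exact exists_derivation_extension_restrict hk D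

/-- Some multiple `s • D` lifts over the chart; on the basic open set of `s` the lift can be divided
by `s`. -/
theorem isSubmersiveAt_of_range_eq_top [IsIntegral X] [IsLocallyNoetherian X]
    (hc : CoherentDifferentials π f) (hπ : GenericallySmooth π) (x : X)
    (htop : LinearMap.range (tangentMap π f x) = ⊤) : IsSubmersiveAt π f x := by
  intro c hxc D
  obtain ⟨x, rfl⟩ : ∃ x' : c.U, x'.1 = x := ⟨⟨x, hxc⟩, rfl⟩
  have := hc c
  obtain ⟨s, hs, e, he⟩ := exists_smul_derivation_extension (R' := Loc S (f (π x.1)))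
    (A' := Loc Y (π x.1)) (B' := Loc X x.1) (c.prime x).primeCompl
    (hπ.derivationsKillKernel_chart c x) (hπ.derivationsKillKernel_stalk f x.1) htop D
  have hxs := exists_basicOpen_shrink c x hs
  refine ⟨X.basicOpen s, c.affineU.basicOpen s, X.basicOpen_le s, hxs, ?_⟩
  let c' := c.shrink (X.basicOpen s) (c.affineU.basicOpen s) (X.basicOpen_le s)
  let : Algebra c.B c'.B := (X.presheaf.map (homOfLE (X.basicOpen_le s)).op).hom.toAlgebra
  let : Algebra c.A c'.B := c'.algAB
  let : Algebra c.R c'.B := c'.algRB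
  have : IsScalarTower c.R c.A c'.B := c'.towerRAB
  have t1 : IsScalarTower c.A c.B c'.B := IsScalarTower.of_algebraMap_eq fun a => by
    change π.appLE c.V (X.basicOpen s) _ a =
      X.presheaf.map (homOfLE (X.basicOpen_le s)).op (π.appLE c.V c.U c.leUV a)
    rw [← CommRingCat.comp_apply, Scheme.Hom.appLE_map]
  have : IsScalarTower c.R c.B c'.B := IsScalarTower.of_algebraMap_eq fun a => by
    rw [IsScalarTower.algebraMap_apply c.R c.A c'.B, IsScalarTower.algebraMap_apply c.A c.B c'.B,
      ← IsScalarTower.algebraMap_apply c.R c.A c.B]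
  have : IsLocalization.Away s c'.B := c.affineU.isLocalization_basicOpen s
  obtain ⟨e', he'⟩ := exists_derivation_localization c.R c.R c.B c'.B (Submonoid.powers s) e
  obtain ⟨t, ht⟩ := (IsLocalization.Away.algebraMap_isUnit (S := c'.B) s).exists_left_inv
  have key : ∀ a, (t • e') (algebraMap c.A c'.B a) = algebraMap c.B c'.B (D a) := by
    intro a
    rw [IsScalarTower.algebraMap_apply c.A c.B c'.B, Derivation.smul_apply, he', he, map_mul,
      smul_eq_mul, ← mul_assoc, ht, one_mul]
  exact ⟨t • e', key⟩

/-- A lift near the point localizes to the stalk, and derivations over the chart give all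
derivations at the stalk up to units. -/
theorem IsSubmersiveAt.range_eq_top [IsIntegral X] [IsLocallyNoetherian X]
    (hc : CoherentDifferentials π f) (hπ : GenericallySmooth π) {x : X}
    (hx : IsSubmersiveAt π f x) : LinearMap.range (tangentMap π f x) = ⊤ := by
  obtain ⟨c, hxc⟩ := exists_chart π f x
  obtain ⟨x, rfl⟩ : ∃ x' : c.U, x'.1 = x := ⟨⟨x, hxc⟩, rfl⟩
  have := hc c
  refine range_compAlgebraMapL_eq_top (R := c.R) (A := c.A) (B := c.B) (c.prime x).primeCompl
    (hπ.derivationsKillKernel_stalk f x.1) fun D => ?_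
  obtain ⟨U', hU', hle, hxU', e, he⟩ := hx c hxc D
  let c' := c.shrink U' hU' hle
  let x' : c'.U := ⟨x.1, hxU'⟩
  obtain ⟨e', he'⟩ := exists_derivation_localization c'.R (Loc S (f (π x'.1))) c'.B (Loc X x'.1)
    (c'.prime x').primeCompl e
  refine ⟨e', fun a => ?_⟩
  have h1 : algebraMap c.A (Loc X x.1) a =
      algebraMap c'.B (Loc X x'.1) (algebraMap c'.A c'.B a) := by
    have h2 := IsScalarTower.algebraMap_apply c.A (Loc Y (π x.1)) (Loc X x.1) a
    have h3 := IsScalarTower.algebraMap_apply c'.A (Loc Y (π x'.1)) (Loc X x'.1) a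
    have h4 := IsScalarTower.algebraMap_apply c'.A c'.B (Loc X x'.1) a
    exact h2.trans (h3.symm.trans h4)
  rw [h1]
  refine (he' _).trans ?_
  rw [he a]
  exact TopCat.Presheaf.germ_res_apply X.presheaf (homOfLE hle) _ hxU' _

end Submersive

/-! ### Purity -/

section PurityAlgebra

open TensorProduct IsLocalRing

theorem isTorsionFree_derivation {R A B : Type*} [CommRing R] [CommRing A] [CommRing B]
    [Algebra R A] [Algebra A B] [Algebra R B] [IsDomain B] {b : B} (hb : b ≠ 0)
    {d : Derivation R A B} (h : b • d = 0) : d = 0 := by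
  ext a
  exact (mul_eq_zero.1 (congrArg (fun D : Derivation R A B => D a) h)).resolve_left hb

variable {O T : Type u} [CommRing O] [IsLocalRing O] [IsNoetherianRing O] [IsDomain O]
  [AddCommGroup T] [Module O T]

/-- A nonzero torsion-free module has zero annihilator. -/
theorem supportDim_eq_ringKrullDim_of_torsionFree [Module.Finite O T]
    (hT : ∀ (a : O) (t : T), a ≠ 0 → a • t = 0 → t = 0) [Nontrivial T] :
    Module.supportDim O T = ringKrullDim O := by
  have h : Module.annihilator O T = ⊥ := by
    obtain ⟨t, ht⟩ := exists_ne (0 : T)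
    rw [eq_bot_iff]
    intro a ha
    by_contra ha0
    exact ht (hT a t ha0 (Module.mem_annihilator.1 ha t))
  rw [Module.supportDim_eq_ringKrullDim_quotient_annihilator, h]
  exact ringKrullDim_eq_of_ringEquiv (RingEquiv.quotientBot O)

theorem minGens_pos_iff {O T : Type*} [CommRing O] [IsLocalRing O] [AddCommGroup T] [Module O T]
    [Module.Finite O T] : 0 < minGens O T ↔ Nontrivial T := by
  rw [minGens, Module.finrank_pos_iff, ← not_subsingleton_iff_nontrivial,
    ← not_subsingleton_iff_nontrivial, IsLocalRing.subsingleton_tensorProduct]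

/-- A submodule of depth two whose cokernel is supported at the closed point is everything. -/
theorem eq_top_of_serreAt_two [Module.Finite O T]
    (hT : ∀ (a : O) (t : T), a ≠ 0 → a • t = 0 → t = 0) (N : Submodule O T)
    (hN : SerreAt 2 (ModuleCat.of O N)) (hdim : 2 ≤ ringKrullDim O)
    (h : ∀ Q : Ideal O, ∀ _ : Q.IsPrime, Q ≠ maximalIdeal O →
      Module.finrank Q.ResidueField (Q.ResidueField ⊗[O] (T ⧸ N)) ≤ 0) : N = ⊤ := by
  -- Vanishing fibres mean that the quotient has no support away from the closed point.
  have hQ : ∀ Q : Ideal O, ∀ _ : Q.IsPrime, Q ≠ maximalIdeal O → ∀ z : T ⧸ N,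
      ∃ a ∉ Q, a • z = 0 := by
    intro Q hQ hQm z
    by_contra! hz
    have h1 : (⟨Q, hQ⟩ : PrimeSpectrum O) ∈ Module.support O (T ⧸ N) := by
      rw [Module.mem_support_iff_exists_annihilator]
      refine ⟨z, fun a ha => ?_⟩
      by_contra haQ
      exact hz a haQ (Submodule.mem_annihilator_span_singleton _ _ |>.1 ha)
    rw [Module.mem_support_iff_nontrivial_residueField_tensorProduct] at h1
    have h2 := Module.finrank_pos (R := Q.ResidueField) (M := Q.ResidueField ⊗[O] (T ⧸ N))
    have := h Q hQ hQm
    omega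
  have hm : (⊥ : Ideal O) ≠ maximalIdeal O := by
    intro h0
    have : ringKrullDim O = 0 :=
      ringKrullDim_eq_zero_of_isField (isField_iff_maximalIdeal_eq.2 h0.symm)
    rw [this] at hdim
    exact absurd hdim (by decide)
  by_contra hne
  have : Nontrivial (T ⧸ N) := Submodule.Quotient.nontrivial_iff.2 hne
  -- If `N` were zero, all of `T` would be torsion. Hence `N` has full dimension, and the Serre
  -- condition provides a regular sequence of length two.
  have hN0 : Nontrivial N := by
    rw [Submodule.nontrivial_iff_ne_bot]
    rintro rfl
    apply hne
    rw [eq_top_iff]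
    intro t _
    obtain ⟨a, ha, hat⟩ := hQ ⊥ Ideal.isPrime_bot hm (Submodule.Quotient.mk t)
    have h3 : a • t ∈ (⊥ : Submodule O T) := (Submodule.Quotient.mk_eq_zero _).1 hat
    exact hT a t ha h3
  have hd : Module.supportDim O N = ringKrullDim O :=
    supportDim_eq_ringKrullDim_of_torsionFree fun a t ha hat =>
      Subtype.ext (hT a t ha (congrArg Subtype.val hat))
  obtain ⟨rs, hlen, hrs, hreg⟩ := hN 2 le_rfl (hd.symm ▸ hdim)
  obtain ⟨a, b, rfl⟩ := List.length_eq_two.1 hlen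
  have hw := (RingTheory.Sequence.isWeaklyRegular_cons_iff _ a [b]).1 hreg.toIsWeaklyRegular
  have ha : IsSMulRegular N a := hw.1
  have hb : IsSMulRegular (QuotSMulTop a N) b :=
    ((RingTheory.Sequence.isWeaklyRegular_cons_iff _ b []).1 hw.2).1
  have ham := hrs a (by simp)
  have hbm := hrs b (by simp)
  have ha0 : a ≠ 0 := by
    rintro rfl
    obtain ⟨n, hn⟩ := exists_ne (0 : N)
    exact hn (ha (by simp))
  -- An associated prime of the quotient can only be the maximal ideal. This yields `z ∉ N` with `c
  -- • z ∈ N` for all `c` in the maximal ideal.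
  obtain ⟨P, hP⟩ := associatedPrimes.nonempty O (T ⧸ N)
  have hPp : P.IsPrime := hP.isPrime
  obtain ⟨z, hz⟩ := (isAssociatedPrime_iff.1 hP).2
  have hPm : P = maximalIdeal O := by
    by_contra hPm
    obtain ⟨c, hc, hcz⟩ := hQ P hPp hPm z
    apply hc
    rw [hz]
    exact Submodule.mem_colon_singleton.2 ((Submodule.mem_bot _).2 hcz)
  obtain ⟨z, rfl⟩ := Submodule.Quotient.mk_surjective _ z
  have hzm : ∀ c ∈ maximalIdeal O, c • z ∈ N := by
    intro c hc
    rw [← hPm, hz] at hc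
    exact (Submodule.Quotient.mk_eq_zero _).1
      ((Submodule.mem_bot _).1 (Submodule.mem_colon_singleton.1 hc))
  have hzN : z ∉ N := by
    intro hzN
    apply hPp.ne_top
    rw [hz, (Submodule.Quotient.mk_eq_zero _).2 hzN]
    simp
  let az : N := ⟨a • z, hzm a ham⟩
  let bz : N := ⟨b • z, hzm b hbm⟩
  -- As `b • (a • z) = a • (b • z)` lies in `a N`, regularity of `b` modulo `a` puts `a • z` in `a
  -- N`. Cancelling `a` in the torsion-free module gives `z ∈ N`.
  have h1 : (Submodule.Quotient.mk az : QuotSMulTop a N) = 0 := by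
    apply hb
    change (Submodule.Quotient.mk (b • az) : QuotSMulTop a N) = b • 0
    rw [smul_zero]
    refine (Submodule.Quotient.mk_eq_zero _).2 ?_
    have : b • az = a • bz := Subtype.ext (smul_comm b a z)
    rw [this]
    exact Submodule.smul_mem_pointwise_smul _ _ _ trivial
  obtain ⟨w, -, hw⟩ := (Submodule.Quotient.mk_eq_zero _).1 h1
  have h2 : a • (z - w.1) = 0 := by
    rw [smul_sub, sub_eq_zero]
    exact (congrArg Subtype.val hw).symm
  have h3 := hT a _ ha0 h2
  rw [sub_eq_zero] at h3
  exact hzN (h3 ▸ w.2)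

end PurityAlgebra

/-! ### Purity of the critical and branch loci -/

section Purity

variable {X Y S : Scheme.{u}} {π : X ⟶ Y} {f : Y ⟶ S}

attribute [local instance] stalkAlg stalkAlgOver stalkTower

/-- The sheaf-theoretic support becomes a degeneracy locus of a coherent family, so the fibre bound
at maximal points applies with `j = 0`. -/
theorem criticalLocus_eq [IsIntegral X] [IsLocallyNoetherian X]
    (hc : CoherentDifferentials π f) (hπ : GenericallySmooth π) :
    criticalLocus π f = {x | 0 < minGens (Loc X x) (Critical π f x)} := by
  ext x
  have hfin := (hc.isCoherentFamily_Critical hπ).finite x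
  have h1 : x ∈ criticalLocus π f ↔ LinearMap.range (tangentMap π f x) ≠ ⊤ :=
    not_congr ⟨fun h => h.range_eq_top hc hπ, isSubmersiveAt_of_range_eq_top hc hπ x⟩
  have h2 : Nontrivial (Critical π f x) ↔ LinearMap.range (tangentMap π f x) ≠ ⊤ :=
    Submodule.Quotient.nontrivial_iff
  rw [h1, ← h2]
  exact minGens_pos_iff.symm

theorem coe_height (x : X) : (height x : WithBot ℕ∞) = ringKrullDim (Loc X x) := by
  rw [height, ringKrullDim_stalk_eq_coheight]
  rfl

theorem height_eq_coheight (x : X) : height x = Order.coheight x :=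
  WithBot.coe_injective ((coe_height x).trans (ringKrullDim_stalk_eq_coheight x))

theorem mem_maxPoints_of_height_eq_one [IsIntegral X] {T : Set X} (hξ : genericPoint X ∉ T) {x : X}
    (hxT : x ∈ T) (hx : height x = 1) : x ∈ maxPoints T := by
  refine ⟨hxT, fun y hy hyx => ?_⟩
  by_contra hne
  -- In this order `x < y` means that `y` is a proper generization of `x`, so the chain from `x`
  -- through `y` to the generic point has length two.
  have h1 : x < y := ⟨hyx, fun h => hne (Specializes.antisymm hyx h).eq⟩
  have h2 : y < genericPoint X :=
    ⟨genericPoint_specializes y,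
      fun h => hξ ((Specializes.antisymm (genericPoint_specializes y) h).eq ▸ hy)⟩
  have h3 := Order.coheight_add_one_le h1
  have h4 := Order.coheight_add_one_le h2
  rw [height_eq_coheight] at hx
  rw [hx] at h3
  have h5 : (1 : ℕ∞) + 1 ≤ 1 := (add_le_add_left (le_add_self.trans h4) 1).trans h3
  exact absurd h5 (by decide)

theorem codimPlus_le_one {T : Set X} (h : ∀ x ∈ maxPoints T, height x ≤ 1) : codimPlus T ≤ 1 := by
  have h1 : toE 1 = 1 := by simp [toE]
  rw [← h1]
  exact codimPlus_le zero_le_one fun x hx => heightE_le_toE (n := 1) (h x hx) le_rfl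

/-- Purity of the critical locus. -/
theorem codimPlus_criticalLocus_le_one [IsIntegral X] [IsNoetherian X]
    (hc : CoherentDifferentials π f) (hπ : GenericallySmooth π)
    (hS : ∀ x : X, SerreAt 2 (TangentImage π f x)) : codimPlus (criticalLocus π f) ≤ 1 := by
  refine codimPlus_le_one fun x hx => ?_
  by_contra! hlt
  have hfib := (hc.isCoherentFamily_Critical hπ).finrank_residue_le 0 x
    (by rwa [← criticalLocus_eq hc hπ])
  have hfin : Module.Finite (Loc X x) (Derivation (Loc S (f (π x))) (Loc Y (π x)) (Loc X x)) :=
    (hc.isCoherentFamily_TangentAlong hπ).finite x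
  refine hx.1 (isSubmersiveAt_of_range_eq_top hc hπ x ?_)
  refine eq_top_of_serreAt_two (fun a t ha => isTorsionFree_derivation ha) _ (hS x) ?_
    fun Q hQ hQm => hfib Q hQm
  rw [← coe_height, ← one_add_one_eq_two]
  exact WithBot.coe_le_coe.2 (Order.add_one_le_of_lt hlt)

theorem genericPoint_notMem_branchLocus [IsIntegral X] (π : X ⟶ Y) :
    genericPoint X ∉ branchLocus π :=
  fun h => h (free_of_isField (isField_stalk_genericPoint X))

/-- Regularity in dimension one makes the maximal ideal principal, and then every ideal of the
Noetherian local domain is principal. -/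
theorem isPrincipalIdealRing_of_isRegularLocalRing {O : Type*} [CommRing O] [IsDomain O]
    [IsRegularLocalRing O] (h : ringKrullDim O = 1) : IsPrincipalIdealRing O := by
  have h1 := IsRegularLocalRing.spanFinrank_maximalIdeal (R := O)
  rw [h] at h1
  have h2 : (IsLocalRing.maximalIdeal O).spanFinrank = 1 := by exact_mod_cast h1
  exact ((tfae_of_isNoetherianRing_of_isLocalRing_of_isDomain O).out 4 0).1
    ((Submodule.spanFinrank_eq_one_iff _).1 h2).1

theorem free_kaehler_of_derivation_extension {R A B : Type u} [CommRing R] [CommRing A]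
    [CommRing B] [Algebra R A] [Algebra A B] [Algebra R B] [IsScalarTower R A B] [IsLocalRing B]
    [Module.Finite B (Ω[B⁄R])] [Module.Free B (Ω[B⁄R])] [Module.Finite B (imageKaehler R A B)]
    [Module.Free B (imageKaehler R A B)]
    (h : LinearMap.range (Derivation.compAlgebraMapL R A B B) = ⊤) : Module.Free B (Ω[B⁄A]) := by
  have h1 : Module.Projective B (Ω[B⁄A]) := projective_of_derivation_extension (R := R) fun d => by
    obtain ⟨e, he⟩ := LinearMap.range_eq_top.1 h d
    exact ⟨e, fun a => congrArg (fun D : Derivation R A B => D a) he⟩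
  have : Module.Finite B (Ω[B⁄A]) :=
    Module.Finite.of_surjective _ (KaehlerDifferential.map_surjective R A B)
  exact Module.free_of_flat_of_isLocalRing

/-- The image is a submodule of a finite free module over a principal ideal domain, hence free. -/
theorem free_kaehler_of_isPrincipalIdealRing {R A B : Type u} [CommRing R] [CommRing A]
    [CommRing B] [Algebra R A] [Algebra A B] [Algebra R B] [IsScalarTower R A B] [IsLocalRing B]
    [IsDomain B] [IsPrincipalIdealRing B] [Module.Finite B (Ω[B⁄R])] [Module.Free B (Ω[B⁄R])]
    (h : LinearMap.range (Derivation.compAlgebraMapL R A B B) = ⊤) : Module.Free B (Ω[B⁄A]) := by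
  have : Module.Free B (imageKaehler R A B) := inferInstance
  exact free_kaehler_of_derivation_extension h

/-- When `Ω_{A/R}` is free, the image is isomorphic to `B ⊗ Ω_{A/R}` and therefore free. -/
theorem free_kaehler_of_free {R A B : Type u} [CommRing R] [CommRing A]
    [CommRing B] [Algebra R A] [Algebra A B] [Algebra R B] [IsScalarTower R A B] [IsLocalRing B]
    [Module.Finite B (Ω[B⁄R])] [Module.Free B (Ω[B⁄R])] [Module.Finite A (Ω[A⁄R])]
    [Module.Free A (Ω[A⁄R])] (hk : DerivationsKillKernel R A B)
    (h : LinearMap.range (Derivation.compAlgebraMapL R A B B) = ⊤) : Module.Free B (Ω[B⁄A]) := by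
  let e := LinearEquiv.ofInjective _ (mapBaseChange_injective hk)
  have : Module.Finite B (imageKaehler R A B) := Module.Finite.equiv e
  have : Module.Free B (imageKaehler R A B) := Module.Free.of_equiv e
  exact free_kaehler_of_derivation_extension h

theorem mem_criticalLocus_of_mem_branchLocus [IsIntegral X] [IsNoetherian X]
    (hc : CoherentDifferentials π f) (hπ : GenericallySmooth π) {x : X} (hx : height x = 1)
    (hreg : IsRegularLocalRing (Loc X x)) (hfree : Module.Free (Loc X x) (OmegaOver π f x))
    (hxB : x ∈ branchLocus π) : x ∈ criticalLocus π f := by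
  intro hxs
  have htop := hxs.range_eq_top hc hπ
  have hdim : ringKrullDim (Loc X x) = 1 := by
    rw [← coe_height, hx]
    rfl
  have := isPrincipalIdealRing_of_isRegularLocalRing hdim
  have h1 : Module.Finite (Loc X x) (Ω[Loc X x⁄Loc S (f (π x))]) :=
    hc.isCoherentFamily_OmegaOver.finite x
  have h2 : Module.Free (Loc X x) (Ω[Loc X x⁄Loc S (f (π x))]) := hfree
  have h3 : Module.Free (Loc X x) (Ω[Loc X x⁄Loc Y (π x)]) :=
    free_kaehler_of_isPrincipalIdealRing (R := Loc S (f (π x))) htop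
  exact hxB h3

/-- In the regular case the maximal points of height one of the critical locus and of the branch
locus coincide. -/
theorem maxPoints_height_one_eq [IsIntegral X] [IsNoetherian X] [LocallyOfFiniteType π]
    (hc : CoherentDifferentials π f) (hπ : GenericallySmooth π)
    (hreg : ∀ x : X, height x ≤ 1 → IsRegularLocalRing (Loc X x))
    (hfree : ∀ x : X, height x ≤ 1 → Module.Free (Loc X x) (OmegaOver π f x)) :
    {x | x ∈ maxPoints (criticalLocus π f) ∧ height x = 1} =
      {x | x ∈ maxPoints (branchLocus π) ∧ height x = 1} := by
  have hsub := criticalLocus_subset_branchLocus hπ f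
  have hξ := genericPoint_notMem_branchLocus π
  ext x
  constructor
  · rintro ⟨h1, h2⟩
    exact ⟨mem_maxPoints_of_height_eq_one hξ (hsub h1.1) h2, h2⟩
  · rintro ⟨h1, h2⟩
    exact ⟨mem_maxPoints_of_height_eq_one (fun h => hξ (hsub h))
      (mem_criticalLocus_of_mem_branchLocus hc hπ h2 (hreg x h2.le) (hfree x h2.le) h1.1) h2, h2⟩

theorem free_localization_of_projective {B B' M M' : Type*} [CommRing B] [CommRing B'] [Algebra B B']
    [IsLocalRing B'] (b : Submonoid B) [IsLocalization b B'] [AddCommGroup M] [AddCommGroup M']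
    [Module B M] [Module B M'] [Module B' M'] [IsScalarTower B B' M'] (l : M →ₗ[B] M')
    [IsLocalizedModule b l] [Module.Projective B M] [Module.Finite B M] : Module.Free B' M' := by
  have : Module.Free B' (TensorProduct B B' M) := Module.free_of_flat_of_isLocalRing
  exact Module.Free.of_equiv (IsLocalizedModule.isBaseChange b B' l).equiv

theorem free_OmegaOver_of_smooth [Smooth (π ≫ f)] (x : X) :
    Module.Free (Loc X x) (OmegaOver π f x) := by
  obtain ⟨c, hxc⟩ := exists_chart π f x
  obtain ⟨x, rfl⟩ : ∃ x' : c.U, x'.1 = x := ⟨⟨x, hxc⟩, rfl⟩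
  have h : (algebraMap c.R c.B).Smooth := by
    rw [c.algebraMap_eq_appLE]
    exact (π ≫ f).smooth_appLE c.affineW c.affineU _
  rw [RingHom.smooth_algebraMap] at h
  have h1 := isLocalizedModule_kaehler c.R (Loc S (f (π x.1))) c.B (Loc X x.1)
    (c.prime x).primeCompl
  have h2 : Module.Free (Loc X x.1) (Ω[Loc X x.1⁄Loc S (f (π x.1))]) :=
    free_localization_of_projective (c.prime x).primeCompl
      (KaehlerDifferential.map c.R (Loc S (f (π x.1))) c.B (Loc X x.1))
  exact h2

theorem free_Omega_of_smooth [Smooth π] (x : X) : Module.Free (Loc X x) (Omega π x) := by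
  obtain ⟨c, hxc⟩ := exists_chart π (𝟙 Y) x
  obtain ⟨x, rfl⟩ : ∃ x' : c.U, x'.1 = x := ⟨⟨x, hxc⟩, rfl⟩
  have h : (algebraMap c.A c.B).Smooth := π.smooth_appLE c.affineV c.affineU _
  rw [RingHom.smooth_algebraMap] at h
  have h1 := isLocalizedModule_kaehler c.A (Loc Y (π x.1)) c.B (Loc X x.1)
    (c.prime x).primeCompl
  have h2 : Module.Free (Loc X x.1) (Ω[Loc X x.1⁄Loc Y (π x.1)]) :=
    free_localization_of_projective (c.prime x).primeCompl
      (KaehlerDifferential.map c.A (Loc Y (π x.1)) c.B (Loc X x.1))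
  exact h2

/-- Purity of the branch locus for smooth `X` and `Y`. -/
theorem codimPlus_branchLocus_le_one [IsIntegral X] [IsNoetherian X] [LocallyOfFiniteType π]
    [Smooth (π ≫ f)] [Smooth f] (hπ : GenericallySmooth π)
    (hS : ∀ x : X, SerreAt 2 (TangentImage π f x)) : codimPlus (branchLocus π) ≤ 1 := by
  have hc := coherentDifferentials_of_locallyOfFiniteType π f
  have heq : branchLocus π = criticalLocus π f := by
    refine subset_antisymm (fun x hxB hxs => hxB ?_) (criticalLocus_subset_branchLocus hπ f)
    have htop := hxs.range_eq_top hc hπ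
    have h1 : Module.Finite (Loc X x) (Ω[Loc X x⁄Loc S (f (π x))]) :=
      hc.isCoherentFamily_OmegaOver.finite x
    have h2 : Module.Free (Loc X x) (Ω[Loc X x⁄Loc S (f (π x))]) := free_OmegaOver_of_smooth x
    have h3 : Module.Finite (Loc Y (π x)) (Ω[Loc Y (π x)⁄Loc S (f (π x))]) :=
      (isCoherentFamily_Omega f).finite (π x)
    have h4 : Module.Free (Loc Y (π x)) (Ω[Loc Y (π x)⁄Loc S (f (π x))]) :=
      free_Omega_of_smooth (π x)
    exact free_kaehler_of_free (hπ.derivationsKillKernel_stalk f x) htop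
  rw [heq]
  exact codimPlus_criticalLocus_le_one hc hπ hS

end Purity

/-! ### Extensions of differentials -/

section Extensions

variable {B M' M M'' N : Type u} [CommRing B] [AddCommGroup M'] [AddCommGroup M]
  [AddCommGroup M''] [AddCommGroup N] [Module B M'] [Module B M] [Module B M''] [Module B N]
  {i : M' →ₗ[B] M} {g : M →ₗ[B] M''} (h : Function.Exact i g) (hi : Function.Injective i)
  (hg : Function.Surjective g)

/-- A linear map defined on the kernel of an extension pushes the extension out. -/
theorem exists_pushout_extension (φ : M' →ₗ[B] N) :
    ∃ (E : ModuleCat.{u} B) (ι : ModuleCat.of B N ⟶ E) (q : E ⟶ ModuleCat.of B M'') (w : ι ≫ q = 0)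
      (hE : (ShortComplex.mk ι q w).ShortExact) (ψ : M →ₗ[B] E),
      (∀ m, q.hom (ψ m) = g m) ∧ (∀ v, ψ (i v) = ι.hom (φ v)) ∧
      (shortExact_shortComplexOf i g h hi hg).extClass.comp
        (Abelian.Ext.mk₀ (ModuleCat.ofHom φ)) (add_zero 1) = hE.extClass := by
  -- The pushout is `N × M` modulo the pairs `(φ v, -i v)`.
  let K : Submodule B (N × M) := LinearMap.range (φ.prod (-i))
  let ι : N →ₗ[B] (N × M) ⧸ K := K.mkQ ∘ₗ LinearMap.inl B N M
  let ψ : M →ₗ[B] (N × M) ⧸ K := K.mkQ ∘ₗ LinearMap.inr B N M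
  let q : ((N × M) ⧸ K) →ₗ[B] M'' := K.liftQ (g ∘ₗ LinearMap.snd B N M) (by
    rintro _ ⟨v, rfl⟩
    rw [LinearMap.mem_ker]
    simp [h.apply_apply_eq_zero])
  have hψ : ∀ v, ψ (i v) = ι (φ v) := by
    intro v
    refine (Submodule.Quotient.eq K).2 ⟨-v, ?_⟩
    simp
  have hqψ : ∀ m, q (ψ m) = g m := fun m => rfl
  have hqι : ∀ n, q (ι n) = 0 := fun n => map_zero g
  have hι : Function.Injective ι := by
    rw [injective_iff_map_eq_zero]
    intro n hn
    obtain ⟨v, hv⟩ := (Submodule.Quotient.mk_eq_zero K).1 hn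
    have h1 : φ v = n := congrArg Prod.fst hv
    have h2 : -i v = 0 := congrArg Prod.snd hv
    rw [neg_eq_zero, ← map_zero i] at h2
    rw [← h1, hi h2, map_zero]
  have hex : Function.Exact ι q := by
    intro z
    refine ⟨fun hz => ?_, ?_⟩
    · obtain ⟨⟨n, m⟩, rfl⟩ := Submodule.Quotient.mk_surjective K z
      obtain ⟨v, rfl⟩ := (h m).1 hz
      refine ⟨n + φ v, (Submodule.Quotient.eq K).2 ⟨v, ?_⟩⟩
      simp
    · rintro ⟨n, rfl⟩
      exact hqι n
  have hq : Function.Surjective q := fun y => by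
    obtain ⟨m, rfl⟩ := hg y
    exact ⟨ψ m, rfl⟩
  have hE := shortExact_shortComplexOf ι q hex hι hq
  refine ⟨ModuleCat.of B _, ModuleCat.ofHom ι, ModuleCat.ofHom q, (shortComplexOf ι q hex).zero, hE,
    ψ, hqψ, hψ, ?_⟩
  -- Naturality of extension classes along this morphism, which is the identity on the quotients,
  -- gives the comparison.
  let F : shortComplexOf i g h ⟶ shortComplexOf ι q hex :=
    { τ₁ := ModuleCat.ofHom φ
      τ₂ := ModuleCat.ofHom ψ
      τ₃ := 𝟙 _
      comm₁₂ := by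
        ext v
        exact (hψ v).symm
      comm₂₃ := by
        ext m
        rfl }
  have h1 := ShortComplex.ShortExact.extClass_naturality
    (shortExact_shortComplexOf i g h hi hg) hE F
  refine h1.trans ?_
  exact Abelian.Ext.mk₀_id_comp _

variable (N) in
/-- The connecting homomorphism of an extension. -/
def extConnecting :
    (M' →ₗ[B] N) →ₗ[B] Abelian.Ext (ModuleCat.of B M'') (ModuleCat.of B N) 1 where
  toFun φ := (shortExact_shortComplexOf i g h hi hg).extClass.comp
    (Abelian.Ext.mk₀ (ModuleCat.ofHom φ)) (add_zero 1)
  map_add' φ ψ := by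
    rw [ModuleCat.ofHom_add, Abelian.Ext.mk₀_add, Abelian.Ext.comp_add]
  map_smul' b φ := by
    have : ModuleCat.ofHom (b • φ) = b • ModuleCat.ofHom φ := rfl
    rw [this, Abelian.Ext.mk₀_smul, Abelian.Ext.comp_smul]
    rfl

/-- Exactness of `Hom(M, N) → Hom(M', N) → Ext¹(M'', N)`. -/
theorem ker_extConnecting :
    LinearMap.ker (extConnecting N h hi hg) = LinearMap.range (LinearMap.lcomp B N i) := by
  have hS := shortExact_shortComplexOf i g h hi hg
  ext φ
  constructor
  · intro hφ
    obtain ⟨x, hx⟩ := Abelian.Ext.contravariant_sequence_exact₁ hS (ModuleCat.of B N)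
      (Abelian.Ext.mk₀ (ModuleCat.ofHom φ)) (add_zero 1) hφ
    obtain ⟨ψ, rfl⟩ := Abelian.Ext.addEquiv₀.symm.surjective x
    have h1 : Abelian.Ext.mk₀ (ModuleCat.ofHom i ≫ ψ) = Abelian.Ext.mk₀ (ModuleCat.ofHom φ) :=
      (Abelian.Ext.mk₀_comp_mk₀ _ _).symm.trans hx
    have h2 := Abelian.Ext.addEquiv₀.symm.injective h1
    exact ⟨ψ.hom, LinearMap.ext fun v => congrArg (fun F => F.hom v) h2⟩
  · rintro ⟨ψ, rfl⟩
    rw [LinearMap.mem_ker]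
    change hS.extClass.comp (Abelian.Ext.mk₀ (ModuleCat.ofHom i ≫ ModuleCat.ofHom ψ))
      (add_zero 1) = 0
    rw [← Abelian.Ext.mk₀_comp_mk₀]
    exact hS.extClass_comp_assoc _ (h := add_zero 1)

/-- The next term of the sequence, `Ext¹(M, N)`, vanishes. -/
theorem extConnecting_surjective [Module.Projective B M] :
    Function.Surjective (extConnecting N h hi hg) := by
  have hS := shortExact_shortComplexOf i g h hi hg
  intro x
  have : Projective (ModuleCat.of B M) := (IsProjective.iff_projective _).1 inferInstance
  obtain ⟨y, hy⟩ := Abelian.Ext.contravariant_sequence_exact₃ hS (ModuleCat.of B N) x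
    (Abelian.Ext.eq_zero_of_projective _) (add_zero 1)
  obtain ⟨φ, rfl⟩ := Abelian.Ext.addEquiv₀.symm.surjective y
  exact ⟨φ.hom, hy⟩

end Extensions

/-! ### The critical module as a sheaf of extensions -/

section CriticalExt

open KaehlerDifferential

variable {X Y S : Scheme.{u}} {π : X ⟶ Y} {f : Y ⟶ S}

/-- The critical module is an `Ext` module if the differentials over the base are projective. -/
theorem Chart.criticalIsoExt_of_projective (c : Chart π f)
    (hk : DerivationsKillKernel c.R c.A c.B) [Module.Projective c.B (Ω[c.B⁄c.R])] :
    c.CriticalIsoExt := by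
  have hex := exact_imageKaehler_subtype_map (R := c.R) (A := c.A) (B := c.B)
  have hi := Submodule.subtype_injective (imageKaehler c.R c.A c.B)
  have hg := KaehlerDifferential.map_surjective c.R c.A c.B
  let δ := extConnecting c.B hex hi hg
  let e := (cokernelEquiv hk).symm ≪≫ₗ
    Submodule.quotEquivOfEq _ _ (ker_extConnecting (N := c.B) hex hi hg).symm ≪≫ₗ
      δ.quotKerEquivOfSurjective (extConnecting_surjective hex hi hg)
  refine ⟨e, fun D => ?_⟩
  obtain ⟨φ, rfl⟩ := (homEquivDerivation hk).surjective D
  obtain ⟨E, ι, q, w, hE, ψ, h1, h2, h3⟩ := exists_pushout_extension hex hi hg φ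
  refine ⟨E, ι, q, w, hE, ψ, fun b => ?_, fun a => ?_, ?_⟩
  · rw [h1, map_D]
    rfl
  · have h4 := h2 ⟨D c.R c.B (algebraMap c.A c.B a), D_algebraMap_mem_imageKaehler a⟩
    rw [← derivationOfHom_apply φ a] at h4
    exact h4
  · rw [← h3]
    have h5 : (cokernelEquiv hk).symm (Submodule.Quotient.mk (homEquivDerivation hk φ)) =
        Submodule.Quotient.mk φ := by
      rw [LinearEquiv.symm_apply_eq]
      rfl
    change δ.quotKerEquivOfSurjective (extConnecting_surjective hex hi hg)
      (Submodule.quotEquivOfEq _ _ (ker_extConnecting (N := c.B) hex hi hg).symm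
      ((cokernelEquiv hk).symm (Submodule.Quotient.mk (homEquivDerivation hk φ)))) = _
    rw [h5]
    rfl

/-- If the images of `R` and `R'` in `B` are killed by the universal derivations over `R'` and `R`,
then the differentials over `R` and over `R'` are the same. -/
theorem projective_kaehler_of_D_eq_zero (R R' : Type u) {B : Type u} [CommRing R] [CommRing R']
    [CommRing B] [Algebra R B] [Algebra R' B] (h : ∀ r, D R' B (algebraMap R B r) = 0)
    (h' : ∀ r, D R B (algebraMap R' B r) = 0) [Module.Projective B (Ω[B⁄R'])] :
    Module.Projective B (Ω[B⁄R]) := by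
  have : SMulCommClass R R' B := ⟨fun r r' b => by
    simp only [Algebra.smul_def]
    exact mul_left_comm _ _ _⟩
  have : SMulCommClass R' R B := SMulCommClass.symm R R' B
  -- Each universal derivation is linear over the other base ring, so each factors through the
  -- other, and `Ω_{B/R}` is a retract of `Ω_{B/R'}`.
  let d : Derivation R B (Ω[B⁄R']) := Derivation.mk'
    { toFun := D R' B
      map_add' := map_add _
      map_smul' := fun r b => by
        rw [Algebra.smul_def, Derivation.leibniz, h, smul_zero, add_zero, algebraMap_smul]
        rfl } (Derivation.leibniz _)
  let d' : Derivation R' B (Ω[B⁄R]) := Derivation.mk'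
    { toFun := D R B
      map_add' := map_add _
      map_smul' := fun r b => by
        rw [Algebra.smul_def, Derivation.leibniz, h', smul_zero, add_zero, algebraMap_smul]
        rfl } (Derivation.leibniz _)
  refine Module.Projective.of_split d.liftKaehlerDifferential d'.liftKaehlerDifferential
    (kaehler_hom_ext fun b => ?_)
  rw [LinearMap.comp_apply, Derivation.liftKaehlerDifferential_comp_D]
  exact Derivation.liftKaehlerDifferential_comp_D d' b

theorem Chart.exists_prime_eq (c : Chart π f) (P : PrimeSpectrum c.B) :
    ∃ x : c.U, c.affineU.primeIdealOf x = P := by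
  have hPU : c.affineU.fromSpec P ∈ c.U := by
    have := Set.mem_range_self (f := c.affineU.fromSpec) P
    rwa [c.affineU.range_fromSpec] at this
  refine ⟨⟨_, hPU⟩, c.affineU.fromSpec.isOpenEmbedding.injective ?_⟩
  exact c.affineU.fromSpec_primeIdealOf _

attribute [local instance] stalkAlg stalkAlgOver stalkTower

/-- A function coming locally from the base has differential zero. -/
theorem Chart.D_eq_zero (c : Chart π f) (t : c.B)
    (h : ∀ x : c.U, ∃ r, algebraMap c.B (Loc X x.1) t =
      algebraMap (Loc S (f (π x.1))) (Loc X x.1) r) : D c.R c.B t = 0 := by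
  by_contra hne
  -- The annihilator of a nonzero differential lies in a maximal ideal. At the corresponding point
  -- `t` comes from the base, so the differential vanishes there and is killed by an element outside
  -- that ideal.
  obtain ⟨P, hP, hle⟩ := Ideal.exists_le_maximal (LinearMap.ker (LinearMap.toSpanSingleton c.B _
    (D c.R c.B t))) fun h1 => hne (by
      have : (1 : c.B) ∈ LinearMap.ker (LinearMap.toSpanSingleton c.B _ (D c.R c.B t)) :=
        h1 ▸ trivial
      rwa [LinearMap.mem_ker, LinearMap.toSpanSingleton_apply, one_smul] at this)
  obtain ⟨x, hx⟩ := c.exists_prime_eq ⟨P, hP.isPrime⟩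
  have hl := isLocalizedModule_kaehler c.R (Loc S (f (π x.1))) c.B (Loc X x.1)
    (c.prime x).primeCompl
  obtain ⟨r, hr⟩ := h x
  have h0 : KaehlerDifferential.map c.R (Loc S (f (π x.1))) c.B (Loc X x.1) (D c.R c.B t) = 0 := by
    rw [map_D, hr, Derivation.map_algebraMap]
  obtain ⟨s, hs⟩ := (IsLocalizedModule.eq_zero_iff (c.prime x).primeCompl _).1 h0
  have h2 : (s : c.B) ∈ P := hle hs
  have h3 : P = c.prime x := congrArg PrimeSpectrum.asIdeal hx.symm
  exact s.2 (h3.le h2)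

theorem Chart.exists_algebraMap_eq (c : Chart π f) (x : c.U) (r : c.R) :
    ∃ r', algebraMap c.B (Loc X x.1) (algebraMap c.R c.B r) =
      algebraMap (Loc S (f (π x.1))) (Loc X x.1) r' :=
  ⟨algebraMap c.R (Loc S (f (π x.1))) r, by
    rw [← IsScalarTower.algebraMap_apply c.R c.B (Loc X x.1),
      ← IsScalarTower.algebraMap_apply c.R (Loc S (f (π x.1))) (Loc X x.1)]⟩

/-- Restriction of sections is the ring map of the identity of `X` between affine opens, and the
identity is étale. -/
theorem Chart.formallyEtale_restrict (c : Chart π f) (U : X.Opens) (hU : IsAffineOpen U)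
    (h : U ≤ c.U) : (X.presheaf.map (homOfLE h).op).hom.FormallyEtale := by
  have h1 : ((𝟙 X : X ⟶ X).appLE c.U U h).hom.Etale := (𝟙 X : X ⟶ X).etale_appLE c.affineU hU h
  have h2 : (𝟙 X : X ⟶ X).appLE c.U U h = X.presheaf.map (homOfLE h).op := by
    have : (𝟙 X : X ⟶ X).app c.U = 𝟙 _ := Scheme.Hom.id_app c.U
    simp only [Scheme.Hom.appLE, this]
    exact Category.id_comp _
  rw [h2] at h1
  exact h1.formallyEtale

theorem projective_kaehler_of_formallyEtale (R : Type u) {B B' : Type u} [CommRing R] [CommRing B]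
    [CommRing B'] [Algebra R B] [Algebra B B'] [Algebra R B'] [IsScalarTower R B B']
    [Algebra.FormallyEtale B B'] [Module.Projective B (Ω[B⁄R])] :
    Module.Projective B' (Ω[B'⁄R]) :=
  Module.Projective.of_equiv (tensorKaehlerEquivOfFormallyEtale R B B')

/-- Projectivity of the differentials over the base passes to smaller charts. -/
theorem Chart.projective_kaehler_of_le (c₀ c : Chart π f) (hle : c.U ≤ c₀.U)
    [Module.Projective c₀.B (Ω[c₀.B⁄c₀.R])] : Module.Projective c.B (Ω[c.B⁄c.R]) := by
  let c' := c₀.shrink c.U c.affineU hle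
  let : Algebra c₀.B c.B := (X.presheaf.map (homOfLE hle).op).hom.toAlgebra
  let : Algebra c₀.R c.B := c'.algRB
  have : IsScalarTower c₀.R c₀.B c.B := IsScalarTower.of_algebraMap_eq fun a => by
    change π.appLE c₀.V c.U _ (f.appLE c₀.W c₀.V c₀.leVW a) =
      X.presheaf.map (homOfLE hle).op (π.appLE c₀.V c₀.U c₀.leUV (f.appLE c₀.W c₀.V c₀.leVW a))
    rw [← CommRingCat.comp_apply, ← CommRingCat.comp_apply, ← CommRingCat.comp_apply,
      Scheme.Hom.appLE_map]
  have : Algebra.FormallyEtale c₀.B c.B := c₀.formallyEtale_restrict c.U c.affineU hle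
  have : Module.Projective c.B (Ω[c.B⁄c₀.R]) := projective_kaehler_of_formallyEtale c₀.R (B := c₀.B)
  -- The base rings of the two charts are unrelated, but at each point both map to `𝒪_X` through the
  -- stalk of `𝒪_S`.
  have h1 : ∀ r, D c.R c.B (algebraMap c₀.R c.B r) = 0 := fun r =>
    c.D_eq_zero _ fun x => c'.exists_algebraMap_eq x r
  have h2 : ∀ r, D c₀.R c.B (algebraMap c.R c.B r) = 0 := fun r =>
    c'.D_eq_zero _ fun x => c.exists_algebraMap_eq x r
  exact projective_kaehler_of_D_eq_zero c.R c₀.R h2 h1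

/-- If the differentials over the base are locally projective, then the critical module is the sheaf
of extensions of the relative differentials by the structure sheaf. -/
theorem criticalModuleIsoExt [IsIntegral X] (hπ : GenericallySmooth π)
    (hproj : LocallyProjectiveDifferentials π f) : CriticalModuleIsoExt π f := by
  intro x
  obtain ⟨c₀, hx, h⟩ := hproj x
  refine ⟨c₀.U, hx, fun c hle => ?_⟩
  have := c₀.projective_kaehler_of_le c hle
  refine c.criticalIsoExt_of_projective ?_
  -- Over the empty chart the ring is zero; a nonempty chart contains the generic point, so generic
  -- smoothness applies.
  rcases eq_bot_or_bot_lt c.U with hU | hU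
  · have : Subsingleton c.B := by
      rw [Chart.B, hU]
      infer_instance
    exact fun _ _ _ => Subsingleton.elim _ _
  · obtain ⟨x, hx⟩ := (TopologicalSpace.Opens.ne_bot_iff_nonempty c.U).1 hU.ne'
    exact hπ.derivationsKillKernel_chart c ⟨x, hx⟩

end CriticalExt

end

end PurityLoci

theorem theorem3p5 {X Y S : Scheme.{u}} [IsIntegral X] [IsIntegral Y]
    [IsNoetherian X] [IsNoetherian Y] (π : X ⟶ Y) (f : Y ⟶ S)
    [LocallyOfFiniteType π] [IsDominant π] (hπ : GenericallySmooth π) :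
    -- inclusion of the loci, and the critical module as a sheaf Ext
    (criticalLocus π f ⊆ branchLocus π ∧
      (LocallyProjectiveDifferentials π f → CriticalModuleIsoExt π f)) ∧
    -- bounds for the higher branch loci
    (LocallyOfFiniteType f → LocallyOfFiniteType (π ≫ f) →
      -- all suprema below are finite
      (BddAbove (Set.range fun x : X => chiTwo (Omega π x)) ∧
        BddAbove (Set.range fun x : X => betti (ImageOmega π f x) 0) ∧
        BddAbove (Set.range fun x : X => betti (OmegaOver π f x) 1) ∧
        BddAbove (Set.range fun y : Y => betti (Omega f y) 0)) ∧
      ∀ i : ℕ,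
        codimPlus (branchLocusHigher π i) ≤
          toE ((relDim π + i + 1) * (i + 1 + ⨆ x : X, chiTwo (Omega π x))) ∧
        codimPlus (branchLocusHigher π i) ≤
          toE ((relDim π + i + 1) * (relDim π - relDimOver π f + i + 1 +
            (⨆ x : X, betti (ImageOmega π f x) 0 : ℕ) +
            (⨆ x : X, betti (OmegaOver π f x) 1 : ℕ))) ∧
        ((relDim π + i + 1 : ℤ) * (relDim π - relDimOver π f + i + 1 +
            (⨆ x : X, betti (ImageOmega π f x) 0 : ℕ) +
            (⨆ x : X, betti (OmegaOver π f x) 1 : ℕ)) ≤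
          (relDim π + i + 1) * (i + 1 +
            (⨆ x : X, betti (ImageOmega π f x) 0 : ℕ) +
            (⨆ x : X, betti (OmegaOver π f x) 1 : ℕ) - relDim f)) ∧
        (GenericallySmooth (π ≫ f) →
          (relDim π + i + 1 : ℤ) * (relDim π - relDimOver π f + i + 1 +
            (⨆ x : X, betti (ImageOmega π f x) 0 : ℕ) +
            (⨆ x : X, betti (OmegaOver π f x) 1 : ℕ)) =
          (relDim π + i + 1) * (i + 1 +
            (⨆ x : X, betti (ImageOmega π f x) 0 : ℕ) +
            (⨆ x : X, betti (OmegaOver π f x) 1 : ℕ) - relDim f)) ∧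
        -- the same chain at the points, continued by the bound through `δ_{Y/S}`
        (∀ x ∈ maxPoints (branchLocusHigher π i),
          heightE x ≤ toE ((relDim π + i + 1) * (relDim π - relDimOver π f + i + 1 +
            betti (ImageOmega π f x) 0 + betti (OmegaOver π f x) 1))) ∧
        (∀ x : X,
          (relDim π + i + 1 : ℤ) * (relDim π - relDimOver π f + i + 1 +
              betti (ImageOmega π f x) 0 + betti (OmegaOver π f x) 1) ≤
            (relDim π + i + 1) * (i + 1 +
              betti (ImageOmega π f x) 0 + betti (OmegaOver π f x) 1 - relDim f) ∧
          (relDim π + i + 1 : ℤ) * (i + 1 +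
              betti (ImageOmega π f x) 0 + betti (OmegaOver π f x) 1 - relDim f) ≤
            (relDim π + i + 1) * (smoothDefectAt f (π x) - betti (Imperfection π f x) 0 +
              betti (ImageOmega π f x) 1 + betti (OmegaOver π f x) 1 + i + 1) ∧
          (relDim π + i + 1 : ℤ) * (smoothDefectAt f (π x) - betti (Imperfection π f x) 0 +
              betti (ImageOmega π f x) 1 + betti (OmegaOver π f x) 1 + i + 1) ≤
            (relDim π + i + 1) * (smoothDefect f - betti (Imperfection π f x) 0 +
              betti (ImageOmega π f x) 1 + betti (OmegaOver π f x) 1 + i + 1))) ∧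
    -- bounds for the higher critical loci
    (LocallyOfFiniteType f → LocallyOfFiniteType (π ≫ f) →
      (BddAbove (Set.range fun x : X => chiTwo (Critical π f x)) ∧
        BddAbove (Set.range fun x : X => betti (TangentImage π f x) 0) ∧
        BddAbove (Set.range fun x : X => betti (TangentAlong π f x) 1) ∧
        BddAbove (Set.range fun x : X => betti (TangentOver π f x) 0)) ∧
      ∀ i : ℕ,
        codimPlus (criticalLocusHigher π f i) ≤
          toE ((relDim π + i + 1) * (i + 1 + ⨆ x : X, chiTwo (Critical π f x))) ∧
        codimPlus (criticalLocusHigher π f i) ≤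
          toE ((i + 1) * ((⨆ x : X, betti (TangentImage π f x) 0 : ℕ) +
            (⨆ x : X, betti (TangentAlong π f x) 1 : ℕ) -
            genRank (TangentAlong π f (genericPoint X)) + i + 1)) ∧
        ((i + 1 : ℤ) * ((⨆ x : X, betti (TangentImage π f x) 0 : ℕ) +
            (⨆ x : X, betti (TangentAlong π f x) 1 : ℕ) -
            genRank (TangentAlong π f (genericPoint X)) + i + 1) ≤
          (i + 1) * ((⨆ x : X, betti (TangentImage π f x) 0 : ℕ) +
            (⨆ x : X, betti (TangentAlong π f x) 1 : ℕ) - relDim f + i + 1)) ∧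
        (GenericallySmooth f →
          (i + 1 : ℤ) * ((⨆ x : X, betti (TangentImage π f x) 0 : ℕ) +
            (⨆ x : X, betti (TangentAlong π f x) 1 : ℕ) -
            genRank (TangentAlong π f (genericPoint X)) + i + 1) =
          (i + 1) * ((⨆ x : X, betti (TangentImage π f x) 0 : ℕ) +
            (⨆ x : X, betti (TangentAlong π f x) 1 : ℕ) - relDim f + i + 1)) ∧
        -- the same chain at the points, continued by the bound through `η_{X/S}` and `η_{X/Y}`
        (∀ x ∈ maxPoints (criticalLocusHigher π f i),
          heightE x ≤ toE ((i + 1) * (betti (TangentImage π f x) 0 +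
            betti (TangentAlong π f x) 1 -
            genRank (TangentAlong π f (genericPoint X)) + i + 1))) ∧
        (∀ x : X,
          (i + 1 : ℤ) * (betti (TangentImage π f x) 0 + betti (TangentAlong π f x) 1 -
              genRank (TangentAlong π f (genericPoint X)) + i + 1) ≤
            (i + 1) * (betti (TangentImage π f x) 0 + betti (TangentAlong π f x) 1 -
              relDim f + i + 1) ∧
          (i + 1 : ℤ) * (betti (TangentImage π f x) 0 + betti (TangentAlong π f x) 1 -
              relDim f + i + 1) ≤
            (i + 1) * (tangentDefectOverAt π f x - tangentDefectAt π x +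
              betti (TangentImage π f x) 1 + betti (TangentAlong π f x) 1 + i + 1) ∧
          (i + 1 : ℤ) * (tangentDefectOverAt π f x - tangentDefectAt π x +
              betti (TangentImage π f x) 1 + betti (TangentAlong π f x) 1 + i + 1) ≤
            (i + 1) * (tangentDefectOver π f - tangentDefectAt π x +
              betti (TangentImage π f x) 1 + betti (TangentAlong π f x) 1 + i + 1))) ∧
    -- purity of the critical locus
    (CoherentDifferentials π f →
      ((∀ x : X, SerreAt 2 (TangentImage π f x)) → codimPlus (criticalLocus π f) ≤ 1) ∧
      ((∀ x : X, height x ≤ 1 → IsRegularLocalRing (Loc X x)) →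
        (∀ x : X, height x ≤ 1 → Module.Free (Loc X x) (OmegaOver π f x)) →
        {x | x ∈ maxPoints (criticalLocus π f) ∧ height x = 1} =
          {x | x ∈ maxPoints (branchLocus π) ∧ height x = 1})) ∧
    -- purity of the branch locus in the smooth case
    (Smooth (π ≫ f) → Smooth f → (∀ x : X, SerreAt 2 (TangentImage π f x)) →
      codimPlus (branchLocus π) ≤ 1) ∧
    -- differential complete intersections
    (IsDCI π → ∀ i : ℕ,
      codimPlus (branchLocusHigher π i) ≤ toE ((relDim π + i + 1) * (i + 1))) := by
  exact ⟨⟨criticalLocus_subset_branchLocus hπ f, criticalModuleIsoExt hπ⟩, fun hf hπf =>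
    branchLocusHigher_bounds hπ hf (coherentDifferentials_of_locallyOfFiniteType π f),
    fun hf hπf => criticalLocusHigher_bounds hπ (coherentDifferentials_of_locallyOfFiniteType π f),
    fun hc => ⟨codimPlus_criticalLocus_le_one hc hπ, maxPoints_height_one_eq hc hπ⟩,
    fun _ _ hS => codimPlus_branchLocus_le_one hπ hS,
    fun h i => codimPlus_branchLocusHigher_le_of_isDCI h i⟩
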